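/- **Setting.** Let $d,n\in\mathbb N$, let $A_1,\dots,A_d\in\mathbb R^{n\times n}$ be symmetric, let $E\in\mathbb R^{n\times n}$ be skew-symmetric, and let $T:\mathbb R^n\times\mathbb R^n\times\mathbb R^n\to\mathbb R^n$ be trilinear; its trilinear extension to $\mathbb C^n$ is also denoted by $T$. Put $A(\beta)=\sum_{\ell=1}^d\beta_\ell A_\ell$, $A(\partial)=\sum_{\ell=1}^d A_\ell\partial_\ell$ and $\mathcal L(\alpha,\beta)=-\alpha I+A(\beta)-\mathrm iE$ for $\alpha\in\mathbb R$, $\beta\in\mathbb R^d$. Let $W$ be the Wiener algebra of functions $f:\mathbb R^d\to\mathbb C^n$ with $\widehat f\in L^1$, with norm $\|f\|_W=\int_{\mathbb R^d}|\widehat f(k)|_2\,dk$, where $\widehat f(k)=(2\pi)^{-d/2}\int f(x)e^{-\mathrm ik\cdot x}\,dx$, and for $s\in\mathbb N$ let $W^s$ be the space of $f\in W$ with $\partial^\alpha f\in W$ for all $|\alpha|_1\le s$, normed by $\sum_{|\alpha|_1\le s}\|\partial^\alpha f\|_W$. Let $\kappa\in\mathbb R^d\setminus\{0\}$, $\omega\in\mathbb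 R$ and $p\in W^2$. For $\varepsilon\in(0,1]$ consider the problem $$\partial_t\mathbf u+A(\partial)\mathbf u+\tfrac1\varepsilon E\mathbf u=\varepsilon T(\mathbf u,\mathbf u,\mathbf u),\qquad \mathbf u(0,x)=p(x)e^{\mathrm i\kappa\cdot x/\varepsilon}+\overline{p(x)e^{\mathrm i\kappa\cdot x/\varepsilon}}, \tag{1}$$ and, with $\mathcal J=\{\pm1,\pm3\}$ and the convention $u_{-j}=\overline{u_j}$, the envelope system $$\partial_tu_j+\tfrac{\mathrm i}{\varepsilon}\mathcal L(j\omega,j\kappa)u_j+A(\partial)u_j=\varepsilon\sum_{\substack{(j_1,j_2,j_3)\in\mathcal J^3\\ j_1+j_2+j_3=j}}T(u_{j_1},u_{j_2},u_{j_3}),\quad j\in\{1,3\},\qquad u_1(0)=p,\ u_3(0)=0. \tag{2}$$ A mild solution of (1) on $[0,\tau]$ is a $\mathbf u\in C([0,\tau],W)$ that satisfies the variation-of-constants formula for (1); a classical solution of (2) on $[0,\tau]$ is a pair of $u_j\in C^1([0,\tau],W)\cap C([0,\tau],W^1)$ that satisfies (2). **Assumptions.** 1. $\ker\mathcal L(\omega,\kappa)$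 is one-dimensional, $p(x)\in\ker\mathcal L(\omega,\kappa)$ for all $x\in\mathbb R^d$, and $\mathcal L(3\omega,3\kappa)$ and $\mathcal L(5\omega,5\kappa)$ are invertible. 2. The eigenvalues of $\mathcal L(0,\beta)$, counted with multiplicity, can be written as $\lambda_1(\beta),\dots,\lambda_n(\beta)$ with functions $\lambda_m:\mathbb R^d\to\mathbb R$ that are $C^\infty$ on $\mathbb R^d\setminus\{0\}$ and satisfy $|\lambda_m(\widetilde\beta)-\lambda_m(\beta)|\le c\,|\widetilde\beta-\beta|_1$ for all $\beta,\widetilde\beta\in\mathbb R^d$ with some constant $c$, and for every $m$ there are eigenvectors $\psi_m(\beta)$ of $\mathcal L(0,\beta)$ for $\lambda_m(\beta)$ with $|\psi_m(\beta)|_2=1$ for all $\beta$ and $\psi_m\in C^\infty(\mathbb R^d\setminus\{0\},\mathbb C^n)$. 3. $\mathcal L(3\omega,3\kappa)$ and $\mathcal L(5\omega,5\kappa)$ have no common eigenvalue. **Theorem.** Under these assumptions there are constants $t_\star>0$ and $C$, independent of $\varepsilon$, such that for every $\varepsilon\in(0,1]$ the following holds. On $[0,t_\star/\varepsilon]$ problem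 (1) has a unique mild solution $\mathbf u$, which is real-valued, and system (2) has a unique classical solution $(u_1,u_3)$, which satisfies $u_j\in C^2([0,t_\star/\varepsilon],W)\cap C^1([0,t_\star/\varepsilon],W^1)\cap C([0,t_\star/\varepsilon],W^2)$. The approximation $$\widetilde{\mathbf u}(t,x)=\sum_{j\in\mathcal J}e^{\mathrm ij(\kappa\cdot x-\omega t)/\varepsilon}u_j(t,x)$$ satisfies $$\sup_{t\in[0,t_\star/\varepsilon]}\|\mathbf u(t)-\widetilde{\mathbf u}(t)\|_W\le C\varepsilon^2,\qquad \sup_{t\in[0,t_\star/\varepsilon]}\|\mathbf u(t)-\widetilde{\mathbf u}(t)\|_{L^\infty}\le C\varepsilon^2.$$ -/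

import Mathlib

open MeasureTheory Complex
open scoped Real FourierTransform SchwartzMap InnerProductSpace

noncomputable section

/-- The physical (and frequency) space `ℝ^d` with the Euclidean structure. -/
abbrev Space (d : ℕ) : Type := EuclideanSpace ℝ (Fin d)

/-- The state space `ℂ^n` with the Euclidean norm `|·|₂`. -/
abbrev State (n : ℕ) : Type := EuclideanSpace ℂ (Fin n)

/-! ### The Wiener algebra -/

/-- The inverse Fourier transform `x ↦ (2π)^{-d/2} ∫ g(k) e^{i k·x} dk`. -/
def invFourier {d n : ℕ} (g : Space d → State n) (x : Space d) : State n :=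
  ((2 * π) ^ (-(d : ℝ) / 2) : ℝ) • ∫ k, cexp (I * ((⟪k, x⟫_ℝ : ℝ) : ℂ)) • g k

theorem integrable_phase {d n : ℕ} {g : Space d → State n} (hg : Integrable g) (x : Space d) :
    Integrable (fun k => cexp (I * ((⟪k, x⟫_ℝ : ℝ) : ℂ)) • g k) := by
  have hc : Continuous (fun k : Space d => cexp (I * ((⟪k, x⟫_ℝ : ℝ) : ℂ))) := by fun_prop
  refine hg.bdd_smul 1 hc.aestronglyMeasurable ?_
  filter_upwards with k
  rw [mul_comm, norm_exp_ofReal_mul_I]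

theorem invFourier_add {d n : ℕ} {g h : Space d → State n} (hg : Integrable g)
    (hh : Integrable h) : invFourier (g + h) = invFourier g + invFourier h := by
  funext x
  simp only [invFourier, Pi.add_apply, smul_add]
  rw [integral_add (integrable_phase hg x) (integrable_phase hh x), smul_add]

theorem invFourier_smul {d n : ℕ} (c : ℂ) (g : Space d → State n) :
    invFourier (c • g) = c • invFourier g := by
  funext x
  simp only [invFourier, Pi.smul_apply]
  rw [smul_comm c, ← integral_smul c]
  congr 2
  funext k
  rw [smul_comm]

theorem invFourier_congr {d n : ℕ} {g h : Space d → State n} (hgh : g =ᵐ[volume] h) :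
    invFourier g = invFourier h := by
  funext x
  simp only [invFourier]
  congr 1
  refine integral_congr_ae ?_
  filter_upwards [hgh] with k hk
  rw [hk]

/-- The inverse Fourier transform is injective on `L¹`. -/
theorem invFourier_injective {d n : ℕ} {g : Space d → State n} (hg : Integrable g)
    (h0 : invFourier g = 0) : g =ᵐ[volume] 0 := by
  have hF : ∀ y, 𝓕 g y = 0 := by
    intro y
    have h1 := congrFun h0 (-(2 * π) • y)
    simp only [invFourier, Pi.zero_apply, smul_eq_zero] at h1
    rcases h1 with h1 | h1
    · exact absurd h1 (Real.rpow_pos_of_pos (by positivity) _).ne'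
    · rw [Real.fourier_eq', ← h1]
      congr 1
      funext k
      congr 2
      rw [inner_smul_right]
      push_cast
      ring
  refine ae_eq_zero_of_integral_contDiff_smul_eq_zero hg.locallyIntegrable ?_
  intro φ hφ hφc
  have hφ' : ContDiff ℝ (⊤ : ℕ∞) (fun x => (φ x : ℂ)) := ofRealCLM.contDiff.comp hφ
  have hφc' : HasCompactSupport (fun x => (φ x : ℂ)) :=
    hφc.comp_left (g := fun r : ℝ => (r : ℂ)) (by simp)
  let Φ : 𝓢(Space d, ℂ) := hφc'.toSchwartzMap hφ'
  have hΦ : ∀ x, Φ x = (φ x : ℂ) := fun x => rfl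
  let Ψ : 𝓢(Space d, ℂ) := 𝓕⁻ Φ
  have hΨ : 𝓕 (Ψ : Space d → ℂ) = fun x => (φ x : ℂ) := by
    have : 𝓕 Ψ = Φ := by simp [Ψ]
    rw [← SchwartzMap.fourier_coe, this]
    rfl
  have key := VectorFourier.integral_fourierIntegral_smul_eq_flip (L := innerₗ (Space d))
    (μ := volume) (ν := volume) (e := 𝐞) (f := (Ψ : Space d → ℂ)) (g := g)
    Real.continuous_fourierChar continuous_inner Ψ.integrable hg
  rw [flip_innerₗ] at key
  have e1 : ∀ x, VectorFourier.fourierIntegral 𝐞 volume (innerₗ (Space d)) g x = 0 := hF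
  have e2 : ∀ x, VectorFourier.fourierIntegral 𝐞 volume (innerₗ (Space d))
      (Ψ : Space d → ℂ) x = (φ x : ℂ) := fun x => congrFun hΨ x
  simp only [e1, e2, smul_zero, integral_zero] at key
  simpa using key

theorem invFourier_inj {d n : ℕ} {g h : Space d → State n} (hg : Integrable g)
    (hh : Integrable h) (hgh : invFourier g = invFourier h) : g =ᵐ[volume] h := by
  have h1 : invFourier (g + (-1 : ℂ) • h) = 0 := by
    rw [invFourier_add hg (hh.smul _), invFourier_smul, hgh]
    simp
  filter_upwards [invFourier_injective (hg.add (hh.smul (-1 : ℂ))) h1] with k hk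
  have : g k + (-1 : ℂ) • h k = 0 := hk
  rwa [neg_one_smul, ← sub_eq_add_neg, sub_eq_zero] at this

/-- The functions `ℝ^d → ℂ^n` whose Fourier transform is in `L¹`, each one given by its
continuous representative. -/
def wienerSubmodule (d n : ℕ) : Submodule ℂ (Space d → State n) where
  carrier := {f | ∃ g : Space d → State n, Integrable g ∧ f = invFourier g}
  zero_mem' := ⟨0, integrable_zero _ _ _, by funext x; simp [invFourier]⟩
  add_mem' := by
    rintro _ _ ⟨g, hg, rfl⟩ ⟨h, hh, rfl⟩
    exact ⟨g + h, hg.add hh, (invFourier_add hg hh).symm⟩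
  smul_mem' := by
    rintro c _ ⟨g, hg, rfl⟩
    exact ⟨c • g, hg.smul c, (invFourier_smul c g).symm⟩

/-- The Wiener algebra `W` of functions `ℝ^d → ℂ^n`. (A separate type, so that it carries the
topology of `‖·‖_W` and not the one of pointwise convergence.) -/
def Wiener (d n : ℕ) : Type := ↥(wienerSubmodule d n)

namespace Wiener

variable {d n : ℕ}

instance : AddCommGroup (Wiener d n) := inferInstanceAs (AddCommGroup ↥(wienerSubmodule d n))

instance : Module ℂ (Wiener d n) := inferInstanceAs (Module ℂ ↥(wienerSubmodule d n))

instance : CoeFun (Wiener d n) (fun _ => Space d → State n) := ⟨fun f => f.1⟩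

/-- The element of `W` with Fourier transform `g ∈ L¹`. -/
def ofFourier (g : Space d → State n) (hg : Integrable g) : Wiener d n :=
  ⟨invFourier g, g, hg, rfl⟩

/-- The Fourier transform `W → L¹`: the unique `g ∈ L¹` with `f = invFourier g`. -/
def fourier (f : Wiener d n) : Lp (State n) 1 (volume : Measure (Space d)) :=
  f.2.choose_spec.1.toL1 _

theorem invFourier_fourier (f : Wiener d n) :
    invFourier (f.fourier : Space d → State n) = f := by
  rw [fourier, invFourier_congr f.2.choose_spec.1.coeFn_toL1]
  exact f.2.choose_spec.2.symm

theorem fourier_unique (f : Wiener d n) {g : Lp (State n) 1 (volume : Measure (Space d))}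
    (h : invFourier (g : Space d → State n) = f) : f.fourier = g := by
  refine Lp.ext (invFourier_inj (L1.integrable_coeFn _) (L1.integrable_coeFn _) ?_)
  rw [invFourier_fourier, h]

/-- The Fourier transform as a linear bijection `W ≃ L¹`. -/
def fourierEquiv : Wiener d n ≃ₗ[ℂ] Lp (State n) 1 (volume : Measure (Space d)) where
  toFun := fourier
  map_add' f g := by
    apply fourier_unique
    rw [invFourier_congr (Lp.coeFn_add _ _),
      invFourier_add (L1.integrable_coeFn _) (L1.integrable_coeFn _),
      invFourier_fourier, invFourier_fourier]
    rfl
  map_smul' c f := by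
    apply fourier_unique
    rw [RingHom.id_apply, invFourier_congr (Lp.coeFn_smul _ _), invFourier_smul,
      invFourier_fourier]
    rfl
  invFun g := ofFourier g (L1.integrable_coeFn g)
  left_inv f := Subtype.ext (invFourier_fourier f)
  right_inv _ := fourier_unique _ rfl

/-- `‖f‖_W = ‖f̂‖_{L¹} = ∫ |f̂(k)|₂ dk`. -/
instance : NormedAddCommGroup (Wiener d n) :=
  NormedAddCommGroup.induced (Wiener d n) (Lp (State n) 1 (volume : Measure (Space d)))
    (fourierEquiv (d := d) (n := n)).toLinearMap fourierEquiv.injective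

instance : NormedSpace ℂ (Wiener d n) :=
  NormedSpace.induced ℂ (Wiener d n) (Lp (State n) 1 (volume : Measure (Space d)))
    (fourierEquiv (d := d) (n := n)).toLinearMap

/-- The Fourier transform is an isometry of `W` onto `L¹`. -/
def fourierIso : Wiener d n ≃ₗᵢ[ℂ] Lp (State n) 1 (volume : Measure (Space d)) where
  toLinearEquiv := fourierEquiv
  norm_map' _ := rfl

instance : CompleteSpace (Wiener d n) :=
  (completeSpace_congr (e := (fourierIso (d := d) (n := n)).toEquiv)
    fourierIso.isometry.isUniformEmbedding).2 inferInstance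

/-- The Fourier multiplier with symbol `m`, i.e. `f ↦ 𝓕⁻¹(m f̂)`, if `m f̂ ∈ L¹` (which holds
whenever `m` is bounded and measurable). -/
def multiplier (m : Space d → Matrix (Fin n) (Fin n) ℂ) (f : Wiener d n) : Wiener d n :=
  open Classical in
  if h : Integrable (fun k => Matrix.toEuclideanLin (m k) (f.fourier k)) then ofFourier _ h else 0

/-- `h = ∂_ℓ f`. -/
def IsPartial (ℓ : Fin d) (f h : Wiener d n) : Prop :=
  ∀ x, HasLineDerivAt ℝ (f : Space d → State n) (h x) x (EuclideanSpace.single ℓ 1)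

/-- `f ∈ W^s`: all partial derivatives of `f` up to order `s` exist and are in `W`. -/
def MemW : ℕ → Wiener d n → Prop
  | 0, _ => True
  | s + 1, f => ∀ ℓ, ∃ h, IsPartial ℓ f h ∧ MemW s h

/-- `u ∈ C^m(S, W^s)` for an interval `S`: the curves `t ↦ ∂^α u(t)`, `|α|₁ ≤ s`, are in
`C^m(S, W)`. -/
def InCW (m : ℕ) : ℕ → Set ℝ → (ℝ → Wiener d n) → Prop
  | 0, S, u => ContDiffOn ℝ m u S
  | s + 1, S, u => ContDiffOn ℝ m u S ∧
      ∀ ℓ, ∃ v : ℝ → Wiener d n, (∀ t ∈ S, IsPartial ℓ (u t) (v t)) ∧ InCW m s S v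

end Wiener

/-! ### The hyperbolic system and its symbols -/

/-- A real matrix as a complex one. -/
def cMatrix {n : ℕ} (M : Matrix (Fin n) (Fin n) ℝ) : Matrix (Fin n) (Fin n) ℂ :=
  M.map (fun r : ℝ => (r : ℂ))

/-- `A(β) = ∑_ℓ β_ℓ A_ℓ`. -/
def symbolA {d n : ℕ} (A : Fin d → Matrix (Fin n) (Fin n) ℝ) (β : Space d) :
    Matrix (Fin n) (Fin n) ℂ :=
  ∑ ℓ, (β ℓ : ℂ) • cMatrix (A ℓ)

/-- `L(α, β) = -α I + A(β) - i E`. -/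
def symbolL {d n : ℕ} (A : Fin d → Matrix (Fin n) (Fin n) ℝ) (E : Matrix (Fin n) (Fin n) ℝ)
    (α : ℝ) (β : Space d) : Matrix (Fin n) (Fin n) ℂ :=
  -(α : ℂ) • (1 : Matrix (Fin n) (Fin n) ℂ) + symbolA A β - I • cMatrix E

/-- The eigenvalues of `L(0, β) = A(β) - i E`, listed with multiplicity as
`lam 1 β, …, lam n β`, are smooth in `β ≠ 0` and globally Lipschitz continuous with respect to
`|·|₁`, and each of them has an eigenvector of norm one that is smooth in `β ≠ 0`. -/
def HasSmoothEigendecomposition {d n : ℕ} (A : Fin d → Matrix (Fin n) (Fin n) ℝ)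
    (E : Matrix (Fin n) (Fin n) ℝ) : Prop :=
  ∃ (lam : Fin n → Space d → ℝ) (ψ : Fin n → Space d → State n),
    (∀ β, (symbolL A E 0 β).charpoly =
      ∏ m, (Polynomial.X - Polynomial.C (lam m β : ℂ))) ∧
    (∀ m β, Matrix.toEuclideanLin (symbolL A E 0 β) (ψ m β) = (lam m β : ℂ) • ψ m β) ∧
    (∀ m β, ‖ψ m β‖ = 1) ∧
    (∀ m, ContDiffOn ℝ (⊤ : ℕ∞) (lam m) {0}ᶜ) ∧
    (∀ m, ContDiffOn ℝ (⊤ : ℕ∞) (ψ m) {0}ᶜ) ∧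
    (∀ m, ∃ C : ℝ, ∀ β β', |lam m β' - lam m β| ≤ C * ∑ ℓ, |β' ℓ - β ℓ|)

/-- The trilinear extension of `T : ℝ^n × ℝ^n × ℝ^n → ℝ^n` to `ℂ^n`. -/
def trilinearExt {n : ℕ}
    (T : (Fin n → ℝ) →ₗ[ℝ] (Fin n → ℝ) →ₗ[ℝ] (Fin n → ℝ) →ₗ[ℝ] (Fin n → ℝ))
    (a b c : State n) : State n :=
  ∑ q, ∑ r, ∑ s, (a q * b r * c s) •
    WithLp.toLp 2 (fun i => (T (Pi.single q 1) (Pi.single r 1) (Pi.single s 1) i : ℂ))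

/-- Complex conjugation on `ℂ^n`. -/
def conjState {n : ℕ} (v : State n) : State n :=
  WithLp.toLp 2 (fun i => (starRingEnd ℂ) (v i))

/-- The group generated by `-(A(∂) + E/ε)`, as a Fourier multiplier. -/
def propagator {d n : ℕ} (A : Fin d → Matrix (Fin n) (Fin n) ℝ) (E : Matrix (Fin n) (Fin n) ℝ)
    (ε t : ℝ) : Wiener d n → Wiener d n :=
  Wiener.multiplier fun k =>
    NormedSpace.exp ((-(t : ℂ)) • (I • symbolA A k + ((1 / ε : ℝ) : ℂ) • cMatrix E))

/-- `u ∈ C([0, τ], W)` is a mild solution of `∂_t u + A(∂) u + E u / ε = ε T(u, u, u)` with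
`u(0, x) = p(x) e^{i κ·x/ε} + c.c.`. -/
structure IsMildSolution {d n : ℕ} (A : Fin d → Matrix (Fin n) (Fin n) ℝ)
    (E : Matrix (Fin n) (Fin n) ℝ)
    (T : (Fin n → ℝ) →ₗ[ℝ] (Fin n → ℝ) →ₗ[ℝ] (Fin n → ℝ) →ₗ[ℝ] (Fin n → ℝ))
    (κ : Space d) (p : Wiener d n) (ε τ : ℝ) (u : ℝ → Wiener d n) : Prop where
  continuousOn : ContinuousOn u (Set.Icc 0 τ)
  initial : ∀ x, u 0 x = cexp (I * ((⟪κ, x⟫_ℝ / ε : ℝ) : ℂ)) • p x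
    + conjState (cexp (I * ((⟪κ, x⟫_ℝ / ε : ℝ) : ℂ)) • p x)
  duhamel : ∃ N : ℝ → Wiener d n,
    (∀ s ∈ Set.Icc 0 τ, ∀ x, N s x = trilinearExt T (u s x) (u s x) (u s x)) ∧
    ∀ t ∈ Set.Icc 0 τ, u t = propagator A E ε t (u 0)
      + (ε : ℂ) • ∫ s in (0 : ℝ)..t, propagator A E ε (t - s) (N s)

/-! ### The envelope system and the approximation -/

/-- The index set `{±1, ±3}`. -/
def modes : Finset ℤ := {-3, -1, 1, 3}

/-- The values `u_j` for `j ∈ {±1, ±3}`, where `u_{-j}` is the complex conjugate of `u_j`. -/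
def envelope {n : ℕ} (a₁ a₃ : State n) (j : ℤ) : State n :=
  if j = 1 then a₁ else if j = 3 then a₃
  else if j = -1 then conjState a₁ else if j = -3 then conjState a₃ else 0

/-- `∑_{j₁+j₂+j₃=j} T(u_{j₁}, u_{j₂}, u_{j₃})`, all indices in `{±1, ±3}`. -/
def envelopeNonlinearity {n : ℕ}
    (T : (Fin n → ℝ) →ₗ[ℝ] (Fin n → ℝ) →ₗ[ℝ] (Fin n → ℝ) →ₗ[ℝ] (Fin n → ℝ))
    (a₁ a₃ : State n) (j : ℤ) : State n :=
  ∑ J ∈ (modes ×ˢ modes ×ˢ modes).filter (fun J => J.1 + J.2.1 + J.2.2 = j),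
    trilinearExt T (envelope a₁ a₃ J.1) (envelope a₁ a₃ J.2.1) (envelope a₁ a₃ J.2.2)

/-- `(u₁, u₃)` is a classical solution on `[0, τ]`, i.e. with
`u_j ∈ C¹([0, τ], W) ∩ C([0, τ], W¹)`, of
`∂_t u_j + (i/ε) L(jω, jκ) u_j + A(∂) u_j = ε ∑_{j₁+j₂+j₃=j} T(u_{j₁}, u_{j₂}, u_{j₃})`,
`j ∈ {1, 3}`, with initial data `u₁(0) = p`, `u₃(0) = 0`. -/
structure IsClassicalEnvelopeSolution {d n : ℕ} (A : Fin d → Matrix (Fin n) (Fin n) ℝ)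
    (E : Matrix (Fin n) (Fin n) ℝ)
    (T : (Fin n → ℝ) →ₗ[ℝ] (Fin n → ℝ) →ₗ[ℝ] (Fin n → ℝ) →ₗ[ℝ] (Fin n → ℝ))
    (ω : ℝ) (κ : Space d) (p : Wiener d n) (ε τ : ℝ) (u₁ u₃ : ℝ → Wiener d n) : Prop where
  regular : ∀ w ∈ ({u₁, u₃} : Set (ℝ → Wiener d n)),
    Wiener.InCW 1 0 (Set.Icc 0 τ) w ∧ Wiener.InCW 0 1 (Set.Icc 0 τ) w
  initial₁ : u₁ 0 = p
  initial₃ : u₃ 0 = 0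
  equation : ∀ jw ∈ ({(1, u₁), (3, u₃)} : Set (ℤ × (ℝ → Wiener d n))),
    ∀ t ∈ Set.Ioc 0 τ, ∀ x,
      derivWithin jw.2 (Set.Icc 0 τ) t x
        + (I / (ε : ℂ)) • Matrix.toEuclideanLin
            (symbolL A E ((jw.1 : ℝ) * ω) ((jw.1 : ℝ) • κ)) (jw.2 t x)
        + ∑ ℓ, Matrix.toEuclideanLin (cMatrix (A ℓ))
            (lineDeriv ℝ (jw.2 t : Space d → State n) x (EuclideanSpace.single ℓ 1))
      = (ε : ℂ) • envelopeNonlinearity T (u₁ t x) (u₃ t x) jw.1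

/-- `ũ(t, x) = ∑_{j ∈ {±1, ±3}} e^{i j (κ·x - ω t)/ε} u_j(t, x)`. -/
def approximation {d n : ℕ} (ω : ℝ) (κ : Space d) (ε : ℝ) (u₁ u₃ : ℝ → Wiener d n)
    (t : ℝ) (x : Space d) : State n :=
  ∑ j ∈ modes, cexp (I * (((j : ℝ) * (⟪κ, x⟫_ℝ - ω * t) / ε : ℝ) : ℂ)) •
    envelope (u₁ t x) (u₃ t x) j

end

/-! In the frame moving with its unitary group, each equation becomes an ODE in `W` whose cubic
right-hand side has size `ε`. Picard iteration then gives solutions on `[0, τ/ε]`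
(`exists_cubic_solution`), and Gronwall on that interval costs only a constant factor
(`norm_le_of_norm_deriv_le_scaled`). The carrier `e^{ij(κ·x - ωt)/ε}` intertwines the group of the
`j`-th amplitude with that of the original problem (`U_carrier`). In the original moving frame, the
free evolution of the ansatz therefore disappears and only nonlinear terms remain.

A forcing of size `ε^m` accumulates to `ε^(m-1)` over time `1/ε`, so an error `ε²` requires forcings
of size `ε³`, up to total derivatives of `ε²`-terms. Four facts provide this. (a) Since `p` is
polarized, the `1/ε` term vanishes initially and `∂_t u₁(0)`, `∂_t u₃(0)` are bounded. The velocity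
solves a linear equation with coefficient of size `ε`, because the unbounded terms cancel, so it
stays bounded (`norm_vel_le`). (b) In the equation for `u₃`, the triple `(1,1,1)` is the only source
without a factor `u_{±3}`. As `u₁` varies slowly and `L(3ω, 3κ)` is invertible, this source is a
total derivative up to higher order, whence `u₃ = O(ε)` (`norm_third_le`). (c) In `T(ũ, ũ, ũ)` the
triples with sum `±1, ±3` cancel against the envelope system. All others contain at least two
entries `±3`, thus are `O(ε²)`, except the permutations of `±(1,1,3)`, which have sum `±5`
(`sum_modes_triples`). (d) The exceptional terms give a forcing `ε²`, one power too large. Since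
`u₃` rotates with `L(3ω, 3κ)/ε`, a normal form removes them if the Sylvester equation `L₅ P(a,b,c) -
P(a,b,L₃ c) = T(a,b,c) + T(a,c,b) + T(c,a,b)` is solvable. Disjointness of the spectra guarantees
this (`exists_cubic_of_disjoint_spectrum`, `exists_hasDerivWithinAt_fifth`, `norm_error_le`).

Derivatives are controlled with the multiplier `J` with symbol `1/(1 + |k|₁)`: the space `W^s` is
the range of `J^s`, and the generators composed with `J` are bounded. Envelopes are written as `u =
J² U(t) z(t)`, and `z` solves a cubic ODE in `W`, because the weight is submultiplicative and so
trilinear maps lift through `J^s` (`smoothing_tri`). One factor `J` pays for the time derivative and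
the other for the spatial term in the normal forms. The estimates are carried out in the abstract
`EnvelopeSetting`, which contains no `ε`; the `ε`-dependent groups and carriers form a `Frame`. This
makes the constants visibly uniform in `ε`. -/

noncomputable section

/-! ### Strongly continuous families of operators and cubic evolution equations -/

section Abstract

set_option maxSynthPendingDepth 3

open Set Filter Topology

variable {Y Z : Type*} [NormedAddCommGroup Y] [NormedSpace ℝ Y] [NormedAddCommGroup Z]
  [NormedSpace ℝ Z]

/-- A curve `q` is transported continuously by a strongly continuous family of contractions. -/
theorem continuousWithinAt_contraction_apply {V : ℝ → Y →L[ℝ] Y} (hV : ∀ t y, ‖V t y‖ ≤ ‖y‖)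
    {q : ℝ → Y} {S : Set ℝ} {t : ℝ} (hVc : ContinuousWithinAt (fun s => V s (q t)) S t)
    (hq : ContinuousWithinAt q S t) : ContinuousWithinAt (fun s => V s (q s)) S t := by
  have h1 : Tendsto (fun s => V s (q s - q t)) (𝓝[S] t) (𝓝 0) := by
    refine squeeze_zero_norm (fun s => hV s _) ?_
    have := (hq.sub (continuousWithinAt_const (b := q t))).norm
    simpa [ContinuousWithinAt] using this
  have h2 := h1.add hVc
  simpa [ContinuousWithinAt] using h2

/-- The product rule for a strongly differentiable family of contractions. -/
theorem HasDerivWithinAt.contraction_apply {V : ℝ → Y →L[ℝ] Y} (hV : ∀ t y, ‖V t y‖ ≤ ‖y‖)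
    {q : ℝ → Y} {q' e : Y} {S : Set ℝ} {t : ℝ} (hVc : Continuous fun s => V s q')
    (hVd : HasDerivWithinAt (fun s => V s (q t)) e S t) (hq : HasDerivWithinAt q q' S t) :
    HasDerivWithinAt (fun s => V s (q s)) (V t q' + e) S t := by
  have h1 : HasDerivWithinAt (fun s => V s (q s - q t)) (V t q') S t := by
    rw [hasDerivWithinAt_iff_isLittleO] at hq ⊢
    have e1 : (fun s => V s (q s - q t - (s - t) • q')) =o[𝓝[S] t] fun s => s - t :=
      (Asymptotics.isBigO_of_le _ fun s => hV s _).trans_isLittleO hq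
    have e2 : (fun s => (s - t) • (V s q' - V t q')) =o[𝓝[S] t] fun s => s - t := by
      have : Tendsto (fun s => V s q' - V t q') (𝓝[S] t) (𝓝 0) := by
        rw [← sub_self (V t q')]
        exact (hVc.continuousWithinAt (s := S) (x := t)).sub continuousWithinAt_const
      simpa using! (Asymptotics.isBigO_refl (fun s : ℝ => s - t) (𝓝[S] t)).smul_isLittleO
        ((Asymptotics.isLittleO_one_iff ℝ).2 this)
    refine (e1.add e2).congr_left fun s => ?_
    simp only [map_sub, map_smul, sub_self, map_zero, sub_zero, smul_sub]
    abel
  exact (h1.add hVd).congr_of_eventuallyEq (Eventually.of_forall fun s => by simp) (by simp)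

/-- The derivative of a trilinear expression along curves. -/
theorem HasDerivWithinAt.trilinear {X₁ X₂ X₃ : Type*} [NormedAddCommGroup X₁] [NormedSpace ℝ X₁]
    [NormedAddCommGroup X₂] [NormedSpace ℝ X₂] [NormedAddCommGroup X₃] [NormedSpace ℝ X₃]
    (M : X₁ →L[ℝ] X₂ →L[ℝ] X₃ →L[ℝ] Z) {a : ℝ → X₁} {b : ℝ → X₂} {c : ℝ → X₃}
    {a' : X₁} {b' : X₂} {c' : X₃} {S : Set ℝ} {t : ℝ} (ha : HasDerivWithinAt a a' S t)
    (hb : HasDerivWithinAt b b' S t) (hc : HasDerivWithinAt c c' S t) :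
    HasDerivWithinAt (fun s => M (a s) (b s) (c s))
      (M a' (b t) (c t) + M (a t) b' (c t) + M (a t) (b t) c') S t := by
  have h1 := (M.hasFDerivAt (x := a t)).comp_hasDerivWithinAt t ha
  exact (h1.clm_apply hb).clm_apply hc

theorem norm_trilinear_le {X₁ X₂ X₃ : Type*} [NormedAddCommGroup X₁] [NormedSpace ℝ X₁]
    [NormedAddCommGroup X₂] [NormedSpace ℝ X₂] [NormedAddCommGroup X₃] [NormedSpace ℝ X₃]
    (M : X₁ →L[ℝ] X₂ →L[ℝ] X₃ →L[ℝ] Z) (a : X₁) (b : X₂) (c : X₃) {ra rb rc : ℝ}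
    (ha : ‖a‖ ≤ ra) (hb : ‖b‖ ≤ rb) (hc : ‖c‖ ≤ rc) :
    ‖M a b c‖ ≤ ‖M‖ * ra * rb * rc := by
  have h0 : 0 ≤ ra := (norm_nonneg _).trans ha
  have h1 : 0 ≤ rb := (norm_nonneg _).trans hb
  calc ‖M a b c‖ ≤ ‖M a b‖ * ‖c‖ := (M a b).le_opNorm c
    _ ≤ (‖M‖ * ‖a‖ * ‖b‖) * ‖c‖ := by gcongr; exact M.le_opNorm₂ a b
    _ ≤ _ := by gcongr

/-- Telescoping, replacing one argument at a time. -/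
theorem trilinear_sub_le (M : Y →L[ℝ] Y →L[ℝ] Y →L[ℝ] Z) {a b : Y} {R : ℝ}
    (ha : ‖a‖ ≤ R) (hb : ‖b‖ ≤ R) :
    ‖M a a a - M b b b‖ ≤ 3 * ‖M‖ * R ^ 2 * ‖a - b‖ := by
  have e : M a a a - M b b b = M (a - b) a a + M b (a - b) a + M b b (a - b) := by
    simp only [map_sub, sub_apply]; abel
  rw [e]
  refine (norm_add₃_le).trans ?_
  have h1 := norm_trilinear_le M (a - b) a a le_rfl ha ha
  have h2 := norm_trilinear_le M b (a - b) a hb le_rfl ha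
  have h3 := norm_trilinear_le M b b (a - b) hb hb le_rfl
  nlinarith

theorem HasDerivWithinAt.Ici_of_Icc {f : ℝ → Y} {f' : Y} {a b t : ℝ} (ht : t ∈ Ico a b)
    (h : HasDerivWithinAt f f' (Icc a b) t) : HasDerivWithinAt f f' (Ici t) t :=
  h.mono_of_mem_nhdsWithin (Icc_mem_nhdsGE_of_mem ht)

/-- Gronwall's lemma on the time scale `1 / ε`. -/
theorem norm_le_of_norm_deriv_le_scaled {f f' : ℝ → Y} {ε τ a η : ℝ} (hε : 0 < ε) (ha : 1 ≤ a)
    (hη : 0 ≤ η) (hf : ∀ t ∈ Icc 0 (τ / ε), HasDerivWithinAt f (f' t) (Icc 0 (τ / ε)) t)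
    (h0 : ‖f 0‖ ≤ η) (hb : ∀ t ∈ Icc 0 (τ / ε), ‖f' t‖ ≤ ε * (a * ‖f t‖ + η)) :
    ∀ t ∈ Icc 0 (τ / ε), ‖f t‖ ≤ 2 * η * Real.exp (a * τ) := by
  intro t ht
  have h := norm_le_gronwallBound_of_norm_deriv_right_le (K := ε * a) (ε := ε * η)
    (fun s hs => (hf s hs).continuousWithinAt)
    (fun s hs => (hf s (Ico_subset_Icc_self hs)).Ici_of_Icc hs) h0
    (fun s hs => (hb s (Ico_subset_Icc_self hs)).trans (by ring_nf; rfl)) t ht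
  refine h.trans ?_
  rw [gronwallBound_of_K_ne_0 (by positivity)]
  simp only [sub_zero]
  have hle : Real.exp (ε * a * t) ≤ Real.exp (a * τ) := by
    apply Real.exp_le_exp.2
    have := (le_div_iff₀ hε).1 ht.2
    nlinarith
  -- Growth rate and forcing both carry the factor `ε`, so their quotient is free of it; `a ≥ 1`
  -- serves to drop the denominator.
  have hd : ε * η / (ε * a) ≤ η := by
    rw [mul_div_mul_left _ _ hε.ne']
    exact div_le_self hη ha
  have hge : 0 ≤ Real.exp (ε * a * t) - 1 := by
    rw [sub_nonneg]; exact Real.one_le_exp (mul_nonneg (by positivity) ht.1)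
  have := mul_le_mul_of_nonneg_right hd hge
  nlinarith

section Evolution

variable {V : ℝ → Y →L[ℝ] Y}

/-- The right-hand side of a cubic evolution equation in the frame moving with the group `V`. -/
def cubicField (V : ℝ → Y →L[ℝ] Y) (M : Y →L[ℝ] Y →L[ℝ] Y →L[ℝ] Y) (ε t : ℝ) (y : Y) : Y :=
  ε • V (-t) (M (V t y) (V t y) (V t y))

theorem norm_cubicField_le (hV : ∀ t y, ‖V t y‖ ≤ ‖y‖)
    (M : Y →L[ℝ] Y →L[ℝ] Y →L[ℝ] Y) {ε : ℝ} (hε : 0 < ε) (t : ℝ) {y : Y} {R : ℝ}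
    (hy : ‖y‖ ≤ R) :
    ‖cubicField V M ε t y‖ ≤ ε * (‖M‖ * R ^ 3) := by
  have hy' := (hV t y).trans hy
  rw [cubicField, norm_smul, Real.norm_of_nonneg hε.le]
  gcongr
  refine (hV _ _).trans ((norm_trilinear_le M _ _ _ hy' hy' hy').trans (le_of_eq (by ring)))

/-- The group only contributes isometries or contractions, so the constant is that of the cubic
times `ε`; the cubic forces a restriction to balls. -/
theorem lipschitzOnWith_cubicField (hV : ∀ t y, ‖V t y‖ ≤ ‖y‖)
    (M : Y →L[ℝ] Y →L[ℝ] Y →L[ℝ] Y) {ε : ℝ} (hε : 0 < ε) (t R : ℝ) :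
    LipschitzOnWith (NNReal.mk (ε * (3 * ‖M‖ * R ^ 2)) (by positivity)) (cubicField V M ε t)
      (Metric.closedBall 0 R) := by
  refine LipschitzOnWith.of_dist_le_mul fun a ha b hb => ?_
  rw [mem_closedBall_zero_iff] at ha hb
  rw [dist_eq_norm, dist_eq_norm, cubicField, cubicField, ← smul_sub, ← map_sub, norm_smul,
    Real.norm_of_nonneg hε.le, NNReal.coe_mk, mul_assoc]
  gcongr
  refine (hV _ _).trans ((trilinear_sub_le M ((hV t a).trans ha) ((hV t b).trans hb)).trans ?_)
  gcongr
  rw [← map_sub]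
  exact hV _ _

/-- Only strong continuity of `V` is available. Uniform boundedness lets it be combined with a
moving argument, once inside and once outside the cubic. -/
theorem continuousOn_cubicField (hV : ∀ t y, ‖V t y‖ ≤ ‖y‖)
    (hVc : ∀ y, Continuous fun t => V t y) (M : Y →L[ℝ] Y →L[ℝ] Y →L[ℝ] Y) {ε : ℝ}
    {q : ℝ → Y} {S : Set ℝ} (hq : ContinuousOn q S) :
    ContinuousOn (fun t => cubicField V M ε t (q t)) S := by
  intro t ht
  have h1 : ContinuousWithinAt (fun s => V s (q s)) S t :=
    continuousWithinAt_contraction_apply hV (hVc _).continuousWithinAt (hq t ht)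
  have h2 : ContinuousWithinAt (fun s => M (V s (q s)) (V s (q s)) (V s (q s))) S t :=
    ((M.continuous.continuousAt.comp_continuousWithinAt h1).clm_apply h1).clm_apply h1
  exact (continuousWithinAt_contraction_apply (V := fun s => V (-s)) (fun s => hV _)
    ((hVc _).comp continuous_neg).continuousWithinAt h2).const_smul ε

/-- Solutions of cubic evolution equations exist on a time interval of length `τ / ε`. -/
theorem exists_cubic_solution [CompleteSpace Y] (hV : ∀ t y, ‖V t y‖ ≤ ‖y‖)
    (hVc : ∀ y, Continuous fun t => V t y) (M : Y →L[ℝ] Y →L[ℝ] Y →L[ℝ] Y)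
    {ε τ r : ℝ} (hε : 0 < ε) (hτ : 0 < τ) (y₀ : Y)
    (hy₀ : ‖y₀‖ ≤ r) (hM : τ * (‖M‖ * (r + 1) ^ 3) ≤ 1) :
    ∃ z : ℝ → Y, z 0 = y₀ ∧ ∀ t ∈ Icc 0 (τ / ε), ‖z t‖ ≤ r + 1 ∧
      HasDerivWithinAt z (cubicField V M ε t (z t)) (Icc 0 (τ / ε)) t := by
  have hr : 0 ≤ r := (norm_nonneg _).trans hy₀
  have hsub : ∀ y ∈ Metric.closedBall y₀ ((1 : NNReal) : ℝ), ‖y‖ ≤ r + 1 := by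
    intro y hy
    rw [Metric.mem_closedBall, dist_eq_norm] at hy
    have := norm_le_insert' y y₀
    have h1 : ‖y - y₀‖ ≤ 1 := hy
    linarith
  have hT : 0 ≤ τ / ε := by positivity
  let t₀ : Icc (0 : ℝ) (τ / ε) := ⟨0, le_rfl, hT⟩
  -- Unit ball around `y₀`: there the speed is at most `ε ‖M‖ (r + 1)³`, and `hM` says that time `τ
  -- / ε` is too short to leave the ball.
  have hf : IsPicardLindelof (cubicField V M ε) t₀ y₀ 1 0
      (NNReal.mk (ε * (‖M‖ * (r + 1) ^ 3)) (by positivity))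
      (NNReal.mk (ε * (3 * ‖M‖ * (r + 1) ^ 2)) (by positivity)) := by
    refine ⟨fun t _ => ?_, fun y _ => ?_, fun t _ y hy => ?_, ?_⟩
    · refine (lipschitzOnWith_cubicField hV M hε t (r + 1)).mono fun y hy => ?_
      rw [mem_closedBall_zero_iff]
      exact hsub y hy
    · exact continuousOn_cubicField hV hVc M continuousOn_const
    · exact norm_cubicField_le hV M hε t (hsub y hy)
    · simp only [NNReal.coe_mk, NNReal.coe_one, NNReal.coe_zero, sub_zero, t₀, max_eq_left hT]
      calc ε * (‖M‖ * (r + 1) ^ 3) * (τ / ε) = τ * (‖M‖ * (r + 1) ^ 3) := by field_simp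
        _ ≤ 1 := hM
  -- The fixed point of the Picard map is taken directly, since its curve stays in the unit ball by
  -- construction; this gives the bound `r + 1` along with the equation.
  obtain ⟨α, hα⟩ := ODE.FunSpace.exists_isFixedPt_next hf (Metric.mem_closedBall_self le_rfl)
  refine ⟨α.compProj, ?_, fun t ht => ⟨hsub _ (α.compProj_mem_closedBall hf.mul_max_le), ?_⟩⟩
  · change α.compProj t₀ = y₀
    rw [ODE.FunSpace.compProj_val, ← hα, ODE.FunSpace.next_apply₀]
  · apply ODE.hasDerivWithinAt_picard_Icc t₀.2 hf.continuousOn_uncurry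
      α.continuous_compProj.continuousOn (fun _ ht' => α.compProj_mem_closedBall hf.mul_max_le)
      y₀ ht |>.congr_of_mem _ ht
    intro t' ht'
    nth_rw 1 [← hα]
    rw [ODE.FunSpace.compProj_of_mem ht', ODE.FunSpace.next_apply]

/-- A solution of the differential equation solves the integral equation. -/
theorem eq_add_integral_of_hasDerivWithinAt [CompleteSpace Y] {f f' : ℝ → Y} {τ : ℝ}
    (hf : ContinuousOn f (Icc 0 τ)) (hf' : ContinuousOn f' (Icc 0 τ))
    (hd : ∀ t ∈ Ioo 0 τ, HasDerivWithinAt f (f' t) (Icc 0 τ) t) :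
    ∀ t ∈ Icc 0 τ, f t = f 0 + ∫ s in (0 : ℝ)..t, f' s := by
  intro t ht
  have hsub : Icc 0 t ⊆ Icc 0 τ := Icc_subset_Icc_right ht.2
  have hi : IntervalIntegrable f' volume 0 t := by
    apply ContinuousOn.intervalIntegrable
    rw [uIcc_of_le ht.1]
    exact hf'.mono hsub
  rw [intervalIntegral.integral_eq_sub_of_hasDeriv_right_of_le ht.1 (hf.mono hsub)
    (fun s hs => ((hd s ⟨hs.1, hs.2.trans_le ht.2⟩).hasDerivAt
      (Icc_mem_nhds hs.1 (hs.2.trans_le ht.2))).hasDerivWithinAt) hi]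
  abel

/-- A solution of the integral equation solves the differential equation. -/
theorem hasDerivWithinAt_of_eq_add_integral [CompleteSpace Y] {f f' : ℝ → Y} {c : Y} {τ : ℝ}
    (hf' : ContinuousOn f' (Icc 0 τ))
    (h : ∀ t ∈ Icc 0 τ, f t = c + ∫ s in (0 : ℝ)..t, f' s) :
    ∀ t ∈ Icc 0 τ, HasDerivWithinAt f (f' t) (Icc 0 τ) t := by
  intro t ht
  refine HasDerivWithinAt.congr_of_mem ?_ h ht
  apply HasDerivWithinAt.const_add
  have : Fact (t ∈ Icc 0 τ) := ⟨ht⟩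
  refine intervalIntegral.integral_hasDerivWithinAt_right ?_
    (hf'.stronglyMeasurableAtFilter_nhdsWithin measurableSet_Icc t) (hf' t ht)
  apply ContinuousOn.intervalIntegrable
  rw [uIcc_of_le ht.1]
  exact hf'.mono (Icc_subset_Icc_right ht.2)

/-- Uniqueness for cubic evolution equations, with the equation only in the open interval. -/
theorem cubic_solution_unique [CompleteSpace Y] (hV : ∀ t y, ‖V t y‖ ≤ ‖y‖)
    (hVc : ∀ y, Continuous fun t => V t y) (M : Y →L[ℝ] Y →L[ℝ] Y →L[ℝ] Y)
    {ε τ : ℝ} (hε : 0 < ε) {z w : ℝ → Y}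
    (hz : ContinuousOn z (Icc 0 τ)) (hw : ContinuousOn w (Icc 0 τ))
    (hz' : ∀ t ∈ Ioo 0 τ, HasDerivWithinAt z (cubicField V M ε t (z t)) (Icc 0 τ) t)
    (hw' : ∀ t ∈ Ioo 0 τ, HasDerivWithinAt w (cubicField V M ε t (w t)) (Icc 0 τ) t)
    (h0 : z 0 = w 0) : EqOn z w (Icc 0 τ) := by
  obtain ⟨R₁, hR₁⟩ := isCompact_Icc.exists_bound_of_continuousOn hz
  obtain ⟨R₂, hR₂⟩ := isCompact_Icc.exists_bound_of_continuousOn hw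
  -- The field is Lipschitz on balls only; compactness of the interval gives a common ball for both
  -- curves.
  set R := max 0 (max R₁ R₂)
  -- Continuity turns the equation on the open interval into the integral equation on the closed
  -- one, which also returns the equation at `t = 0`.
  have hd : ∀ f : ℝ → Y, ContinuousOn f (Icc 0 τ) →
      (∀ t ∈ Ioo 0 τ, HasDerivWithinAt f (cubicField V M ε t (f t)) (Icc 0 τ) t) →
      ∀ t ∈ Ico 0 τ, HasDerivWithinAt f (cubicField V M ε t (f t)) (Ici t) t :=
    fun f hf hf' t ht => (hasDerivWithinAt_of_eq_add_integral
      (continuousOn_cubicField hV hVc M hf) (eq_add_integral_of_hasDerivWithinAt hf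
        (continuousOn_cubicField hV hVc M hf) hf') t (Ico_subset_Icc_self ht)).Ici_of_Icc ht
  refine ODE_solution_unique_of_mem_Icc_right (v := cubicField V M ε)
    (s := fun _ => Metric.closedBall 0 R)
    (fun t _ => lipschitzOnWith_cubicField hV M hε t R) hz (hd z hz hz')
    (fun t ht => ?_) hw (hd w hw hw') (fun t ht => ?_) h0
  · rw [mem_closedBall_zero_iff]
    exact (hR₁ t (Ico_subset_Icc_self ht)).trans ((le_max_left _ _).trans (le_max_right _ _))
  · rw [mem_closedBall_zero_iff]
    exact (hR₂ t (Ico_subset_Icc_self ht)).trans ((le_max_right _ _).trans (le_max_right _ _))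

end Evolution

end Abstract

/-! ### Groups with a generator regularized by `J`, and the velocity of solutions. -/

section RegularGroups

set_option maxSynthPendingDepth 3

open Set Filter Topology

variable {Y Z : Type*} [NormedAddCommGroup Y] [NormedSpace ℝ Y] [NormedAddCommGroup Z]
  [NormedSpace ℝ Z]

/-- A strongly continuous group of isometries that commutes with a smoothing operator `J`, the
generator of the group being defined on the range of `J`; here `gen` stands for the generator
composed with `J`. -/
structure RegularGroup (J : Y →L[ℝ] Y) where
  /-- The group. -/
  U : ℝ → Y →L[ℝ] Y
  /-- The generator, composed with `J`. -/
  gen : Y →L[ℝ] Y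
  U_zero : ∀ f, U 0 f = f
  U_add : ∀ s t f, U (s + t) f = U s (U t f)
  norm_U : ∀ t f, ‖U t f‖ = ‖f‖
  continuous_U : ∀ f, Continuous fun t => U t f
  U_J : ∀ t f, U t (J f) = J (U t f)
  U_gen : ∀ t f, U t (gen f) = gen (U t f)
  gen_J : ∀ f, gen (J f) = J (gen f)
  hasDerivAt : ∀ f t, HasDerivAt (fun s => U s (J f)) (U t (gen f)) t

namespace RegularGroup

variable {J : Y →L[ℝ] Y} (g : RegularGroup J)

theorem U_neg_U (t : ℝ) (f : Y) : g.U (-t) (g.U t f) = f := by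
  rw [← g.U_add, neg_add_cancel, g.U_zero]

theorem U_U_neg (t : ℝ) (f : Y) : g.U t (g.U (-t) f) = f := by
  rw [← g.U_add, add_neg_cancel, g.U_zero]

theorem continuousOn_U_apply {q : ℝ → Y} {S : Set ℝ} (hq : ContinuousOn q S) :
    ContinuousOn (fun t => g.U t (q t)) S := fun t ht =>
  continuousWithinAt_contraction_apply (fun s y => (g.norm_U s y).le)
    (g.continuous_U _).continuousWithinAt (hq t ht)

theorem continuousOn_U_neg_apply {q : ℝ → Y} {S : Set ℝ} (hq : ContinuousOn q S) :
    ContinuousOn (fun t => g.U (-t) (q t)) S := fun t ht =>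
  continuousWithinAt_contraction_apply (V := fun s => g.U (-s)) (fun _ y => (g.norm_U _ y).le)
    ((g.continuous_U _).comp continuous_neg).continuousWithinAt (hq t ht)

theorem hasDerivWithinAt_U_apply {q : ℝ → Y} {q' f : Y} {S : Set ℝ} {t : ℝ}
    (hq : HasDerivWithinAt q q' S t) (hf : q t = J f) :
    HasDerivWithinAt (fun s => g.U s (q s)) (g.U t (q' + g.gen f)) S t := by
  rw [map_add]
  refine HasDerivWithinAt.contraction_apply (fun s y => (g.norm_U s y).le) (g.continuous_U _) ?_ hq
  rw [hf]
  exact (g.hasDerivAt f t).hasDerivWithinAt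

theorem hasDerivWithinAt_U_neg_apply {q : ℝ → Y} {q' f : Y} {S : Set ℝ} {t : ℝ}
    (hq : HasDerivWithinAt q q' S t) (hf : q t = J f) :
    HasDerivWithinAt (fun s => g.U (-s) (q s)) (g.U (-t) (q' - g.gen f)) S t := by
  rw [map_sub, sub_eq_add_neg]
  refine HasDerivWithinAt.contraction_apply (V := fun s => g.U (-s)) (fun _ y => (g.norm_U _ y).le)
    ((g.continuous_U _).comp continuous_neg) ?_ hq
  rw [hf]
  have h := (g.hasDerivAt f (-t)).scomp t (hasDerivAt_neg t)
  simpa [Function.comp_def] using h.hasDerivWithinAt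

/-- The product of two groups. -/
def prod {K : Z →L[ℝ] Z} (h : RegularGroup K) : RegularGroup (J.prodMap K) where
  U t := (g.U t).prodMap (h.U t)
  gen := g.gen.prodMap h.gen
  U_zero f := Prod.ext (g.U_zero _) (h.U_zero _)
  U_add s t f := Prod.ext (g.U_add s t _) (h.U_add s t _)
  norm_U t f := by
    change max ‖g.U t f.1‖ ‖h.U t f.2‖ = max ‖f.1‖ ‖f.2‖
    rw [g.norm_U, h.norm_U]
  continuous_U f := (g.continuous_U f.1).prodMk (h.continuous_U f.2)
  U_J t f := Prod.ext (g.U_J t _) (h.U_J t _)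
  U_gen t f := Prod.ext (g.U_gen t _) (h.U_gen t _)
  gen_J f := Prod.ext (g.gen_J _) (h.gen_J _)
  hasDerivAt f t := (g.hasDerivAt f.1 t).prodMk (h.hasDerivAt f.2 t)

variable (M₁ M₂ : Y →L[ℝ] Y →L[ℝ] Y →L[ℝ] Y)

/-- The velocity, in the moving frame, of the curve `t ↦ J (U t (z t))`, if `z` solves a cubic
evolution equation. -/
def velocity (M₂ : Y →L[ℝ] Y →L[ℝ] Y →L[ℝ] Y) (ε : ℝ) (z : ℝ → Y) (t : ℝ) : Y :=
  J (cubicField g.U M₂ ε t (z t)) + g.gen (z t)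

/-- The derivative of the velocity. -/
def acceleration (M₁ M₂ : Y →L[ℝ] Y →L[ℝ] Y →L[ℝ] Y) (ε : ℝ) (z : ℝ → Y) (t : ℝ) : Y :=
  ε • g.U (-t) (M₁ (g.U t (g.velocity M₂ ε z t)) (g.U t (J (z t))) (g.U t (J (z t)))
    + M₁ (g.U t (J (z t))) (g.U t (g.velocity M₂ ε z t)) (g.U t (J (z t)))
    + M₁ (g.U t (J (z t))) (g.U t (J (z t))) (g.U t (g.velocity M₂ ε z t)))

variable {M₁ M₂} {ε τ R : ℝ} {z : ℝ → Y} {t : ℝ}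

/-- Consequently `J z` solves the same kind of equation one level lower. -/
theorem J_cubicField (hM : ∀ a b c, J (M₂ a b c) = M₁ (J a) (J b) (J c)) (ε t : ℝ) (y : Y) :
    J (cubicField g.U M₂ ε t y) = cubicField g.U M₁ ε t (J y) := by
  simp only [cubicField, map_smul, ← g.U_J, hM]

theorem hasDerivWithinAt_U_J {S : Set ℝ}
    (hz : HasDerivWithinAt z (cubicField g.U M₂ ε t (z t)) S t) :
    HasDerivWithinAt (fun s => g.U s (J (z s))) (g.U t (g.velocity M₂ ε z t)) S t :=
  g.hasDerivWithinAt_U_apply (J.hasFDerivAt.comp_hasDerivWithinAt t hz) rfl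

/-- The cubic term takes values in the range of `J`, where `U (-t)` can be differentiated. This
produces `-gen` applied to the cubic field at the level of `M₂`, which cancels the derivative of
`gen (z t)`. What remains contains neither the generator nor `1/ε` explicitly and is linear in the
velocity. -/
theorem hasDerivWithinAt_velocity (hM : ∀ a b c, J (M₂ a b c) = M₁ (J a) (J b) (J c))
    {S : Set ℝ} (hz : HasDerivWithinAt z (cubicField g.U M₂ ε t (z t)) S t) :
    HasDerivWithinAt (g.velocity M₂ ε z) (g.acceleration M₁ M₂ ε z t) S t := by
  have hu := g.hasDerivWithinAt_U_J hz
  have hq := hu.trilinear M₁ hu hu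
  have hf : M₁ (g.U t (J (z t))) (g.U t (J (z t))) (g.U t (J (z t)))
      = J (M₂ (g.U t (z t)) (g.U t (z t)) (g.U t (z t))) := by
    rw [hM, g.U_J]
  have h1 := (g.hasDerivWithinAt_U_neg_apply hq hf).const_smul ε
  have h2 := g.gen.hasFDerivAt.comp_hasDerivWithinAt t hz
  refine ((h1.add h2).congr_of_eventuallyEq (Eventually.of_forall fun s => ?_) ?_).congr_deriv ?_
  · simp only [velocity, g.J_cubicField hM]
    rfl
  · simp only [velocity, g.J_cubicField hM]
    rfl
  · simp only [acceleration, cubicField, map_smul, map_sub, smul_sub, ← g.U_gen]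
    abel

theorem norm_acceleration_le (hJ : ∀ f, ‖J f‖ ≤ ‖f‖) (hε : 0 < ε) (hz : ‖z t‖ ≤ R) :
    ‖g.acceleration M₁ M₂ ε z t‖ ≤ ε * (3 * ‖M₁‖ * R ^ 2 * ‖g.velocity M₂ ε z t‖) := by
  have h1 : ‖g.U t (J (z t))‖ ≤ R := by
    rw [g.norm_U]; exact (hJ _).trans hz
  have h2 : ‖g.U t (g.velocity M₂ ε z t)‖ ≤ ‖g.velocity M₂ ε z t‖ := (g.norm_U _ _).le
  rw [acceleration, norm_smul, Real.norm_of_nonneg hε.le, g.norm_U]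
  gcongr
  refine norm_add₃_le.trans ?_
  have e1 := norm_trilinear_le M₁ _ _ _ h2 h1 h1
  have e2 := norm_trilinear_le M₁ _ _ _ h1 h2 h1
  have e3 := norm_trilinear_le M₁ _ _ _ h1 h1 h2
  linarith

/-- The velocity stays bounded on time intervals of length `τ / ε`. -/
theorem norm_velocity_le (hM : ∀ a b c, J (M₂ a b c) = M₁ (J a) (J b) (J c))
    (hJ : ∀ f, ‖J f‖ ≤ ‖f‖) (hε : 0 < ε) {η : ℝ}
    (hz : ∀ t ∈ Icc 0 (τ / ε), ‖z t‖ ≤ R ∧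
      HasDerivWithinAt z (cubicField g.U M₂ ε t (z t)) (Icc 0 (τ / ε)) t)
    (h0 : ‖g.velocity M₂ ε z 0‖ ≤ η) :
    ∀ t ∈ Icc 0 (τ / ε), ‖g.velocity M₂ ε z t‖
      ≤ 2 * η * Real.exp ((1 + 3 * ‖M₁‖ * R ^ 2) * τ) := by
  have hη : 0 ≤ η := (norm_nonneg _).trans h0
  refine norm_le_of_norm_deriv_le_scaled hε (le_add_of_nonneg_right (by positivity)) hη
    (fun t ht => g.hasDerivWithinAt_velocity hM (hz t ht).2) h0 fun t ht => ?_
  refine (g.norm_acceleration_le hJ hε (hz t ht).1).trans ?_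
  gcongr
  nlinarith [norm_nonneg (g.velocity M₂ ε z t)]

theorem continuousOn_acceleration (hM : ∀ a b c, J (M₂ a b c) = M₁ (J a) (J b) (J c))
    {S : Set ℝ} (hz : ∀ t ∈ S, HasDerivWithinAt z (cubicField g.U M₂ ε t (z t)) S t) :
    ContinuousOn (g.acceleration M₁ M₂ ε z) S := by
  have hu : ContinuousOn (fun s => g.U s (J (z s))) S :=
    fun t ht => (g.hasDerivWithinAt_U_J (hz t ht)).continuousWithinAt
  have hv : ContinuousOn (fun s => g.U s (g.velocity M₂ ε z s)) S :=
    g.continuousOn_U_apply fun t ht =>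
      (g.hasDerivWithinAt_velocity hM (hz t ht)).continuousWithinAt
  refine (g.continuousOn_U_neg_apply (((?_ : ContinuousOn _ S).add ?_).add ?_)).const_smul ε
  · exact ((M₁.continuous.comp_continuousOn hv).clm_apply hu).clm_apply hu
  · exact ((M₁.continuous.comp_continuousOn hu).clm_apply hv).clm_apply hu
  · exact ((M₁.continuous.comp_continuousOn hu).clm_apply hu).clm_apply hv

end RegularGroup

theorem contDiffOn_one_of_hasDerivWithinAt {f f' : ℝ → Y} {S : Set ℝ} (hS : UniqueDiffOn ℝ S)
    (h : ∀ t ∈ S, HasDerivWithinAt f (f' t) S t) (hc : ContinuousOn f' S) :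
    ContDiffOn ℝ 1 f S := by
  rw [show (1 : WithTop ℕ∞) = 0 + 1 from rfl, contDiffOn_succ_iff_derivWithin hS]
  refine ⟨fun t ht => (h t ht).differentiableWithinAt, by simp, contDiffOn_zero.2 (hc.congr ?_)⟩
  exact fun t ht => (h t ht).derivWithin (hS t ht)

theorem contDiffOn_two_of_hasDerivWithinAt {f f' f'' : ℝ → Y} {S : Set ℝ}
    (hS : UniqueDiffOn ℝ S) (h : ∀ t ∈ S, HasDerivWithinAt f (f' t) S t)
    (h' : ∀ t ∈ S, HasDerivWithinAt f' (f'' t) S t) (hc : ContinuousOn f'' S) :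
    ContDiffOn ℝ 2 f S := by
  rw [show (2 : WithTop ℕ∞) = 1 + 1 from rfl, contDiffOn_succ_iff_derivWithin hS]
  refine ⟨fun t ht => (h t ht).differentiableWithinAt, by simp,
    (contDiffOn_one_of_hasDerivWithinAt hS h' hc).congr ?_⟩
  exact fun t ht => (h t ht).derivWithin (hS t ht)

/-! ### Removal of nonresonant trilinear terms. -/

section NormalForm

variable {X : Type*} [NormedAddCommGroup X] [NormedSpace ℂ X] {J : X →L[ℝ] X}

/-- Normal form: a trilinear expression `T(a, a, c)` in slowly varying `a` and in `c` that rotates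
with `K`, transported back with a group that rotates with `L`, is a total derivative up to small
terms, if `T` is in the range of the map `S ↦ L S - S(·, ·, K ·)`. -/
theorem RegularGroup.hasDerivWithinAt_normalForm (g : RegularGroup J) {ε : ℝ}
    {L K B : X →L[ℝ] X} (hgen : ∀ f, g.gen f = -(I • (ε⁻¹ • L (J f) + B f)))
    {S₀ S₁ : X →L[ℝ] X →L[ℝ] X →L[ℝ] X} {T₀ : X → X → X → X}
    (hS : ∀ a b c, J (S₁ a b c) = S₀ (J a) (J b) (J c))
    (hT : ∀ a b c, S₀ a b (I • K c) = I • L (S₀ a b c) - I • T₀ a b c)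
    {a c : ℝ → X} {a' a₁ c₁ r : X} {D : Set ℝ} {t : ℝ} (ha : HasDerivWithinAt a a' D t)
    (hc : HasDerivWithinAt c (r - ε⁻¹ • (I • K (c t))) D t) (ha₁ : a t = J a₁)
    (hc₁ : c t = J c₁) :
    HasDerivWithinAt (fun s => g.U (-s) (S₀ (a s) (a s) (c s)))
      (g.U (-t) (ε⁻¹ • (I • T₀ (a t) (a t) (c t)) + (S₀ a' (a t) (c t) + S₀ (a t) a' (c t)
        + S₀ (a t) (a t) r + I • B (S₁ a₁ a₁ c₁)))) D t := by
  have hf : S₀ (a t) (a t) (c t) = J (S₁ a₁ a₁ c₁) := by rw [hS, ha₁, hc₁]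
  refine (g.hasDerivWithinAt_U_neg_apply (ha.trilinear S₀ ha hc) hf).congr_deriv ?_
  congr 1
  -- By `hT`, the rotation of `c` contributes `-ε⁻¹ (I L S₀ - I T₀)`; its first part cancels the
  -- rotation `ε⁻¹ I L S₀` from the group, and only `ε⁻¹ I T₀` survives.
  rw [hgen, ← hf, map_sub, map_smul, hT, smul_sub, smul_add, smul_comm I ε⁻¹]
  abel

end NormalForm

end RegularGroups

/-! ### Combinatorics of the modes `±1, ±3`. -/

section Envelopes

set_option maxSynthPendingDepth 3

open Set Filter Topology

section TriComp

variable {𝕜 X Y Z W : Type*} [NontriviallyNormedField 𝕜] [NormedAddCommGroup X] [NormedSpace 𝕜 X]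
  [NormedAddCommGroup Y] [NormedSpace 𝕜 Y] [NormedAddCommGroup Z] [NormedSpace 𝕜 Z]
  [NormedAddCommGroup W] [NormedSpace 𝕜 W]

/-- Composition of a trilinear map with linear maps on both sides. -/
def triComp (P : Z →L[𝕜] W) (M : X →L[𝕜] X →L[𝕜] X →L[𝕜] Z) (e₁ e₂ e₃ : Y →L[𝕜] X) :
    Y →L[𝕜] Y →L[𝕜] Y →L[𝕜] W :=
  (ContinuousLinearMap.compL 𝕜 Y (X →L[𝕜] Z) (Y →L[𝕜] W)
    ((ContinuousLinearMap.compL 𝕜 Y Z W P) ∘L ((ContinuousLinearMap.compL 𝕜 Y X Z).flip e₃)))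
    ∘L (M.bilinearComp e₁ e₂)

@[simp]
theorem triComp_apply (P : Z →L[𝕜] W) (M : X →L[𝕜] X →L[𝕜] X →L[𝕜] Z) (e₁ e₂ e₃ : Y →L[𝕜] X)
    (a b c : Y) : triComp P M e₁ e₂ e₃ a b c = P (M (e₁ a) (e₂ b) (e₃ c)) := rfl

end TriComp

variable {X : Type*} [NormedAddCommGroup X] [NormedSpace ℂ X]

/-- The amplitude `u_j` as a function of `(u₁, u₃)`, where `u_{-j} = C u_j`. -/
def amplitude (C : X →L[ℝ] X) (j : ℤ) : X × X →L[ℝ] X :=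
  if j = 1 then ContinuousLinearMap.fst ℝ X X else if j = 3 then ContinuousLinearMap.snd ℝ X X
  else if j = -1 then C ∘L ContinuousLinearMap.fst ℝ X X
  else if j = -3 then C ∘L ContinuousLinearMap.snd ℝ X X else 0

/-- The triples of modes with sum `j`. -/
def triads (j : ℤ) : Finset (ℤ × ℤ × ℤ) :=
  (modes ×ˢ modes ×ˢ modes).filter (fun J => J.1 + J.2.1 + J.2.2 = j)

/-- The nonlinearity in the equation for the `j`-th amplitude. -/
def amplitudeCubic (T : X →L[ℝ] X →L[ℝ] X →L[ℝ] X) (C : X →L[ℝ] X) (j : ℤ) :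
    X × X →L[ℝ] X × X →L[ℝ] X × X →L[ℝ] X :=
  ∑ J ∈ triads j, triComp (ContinuousLinearMap.id ℝ X) T (amplitude C J.1) (amplitude C J.2.1)
    (amplitude C J.2.2)

theorem amplitudeCubic_apply (T : X →L[ℝ] X →L[ℝ] X →L[ℝ] X) (C : X →L[ℝ] X) (j : ℤ)
    (a b c : X × X) : amplitudeCubic T C j a b c
      = ∑ J ∈ triads j, T (amplitude C J.1 a) (amplitude C J.2.1 b) (amplitude C J.2.2 c) := by
  simp [amplitudeCubic, sum_apply]

/-- The nonlinearity of the envelope system. -/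
def envelopeCubic (T : X →L[ℝ] X →L[ℝ] X →L[ℝ] X) (C : X →L[ℝ] X) :
    X × X →L[ℝ] X × X →L[ℝ] X × X →L[ℝ] X × X :=
  triComp (ContinuousLinearMap.inl ℝ X X) (amplitudeCubic T C 1) (.id ℝ _) (.id ℝ _) (.id ℝ _)
  + triComp (ContinuousLinearMap.inr ℝ X X) (amplitudeCubic T C 3) (.id ℝ _) (.id ℝ _) (.id ℝ _)

theorem envelopeCubic_apply (T : X →L[ℝ] X →L[ℝ] X →L[ℝ] X) (C : X →L[ℝ] X) (a b c : X × X) :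
    envelopeCubic T C a b c = (amplitudeCubic T C 1 a b c, amplitudeCubic T C 3 a b c) := by
  simp [envelopeCubic]

theorem norm_amplitude_le {C : X →L[ℝ] X} (hC : ∀ f, ‖C f‖ ≤ ‖f‖) (j : ℤ) (y : X × X) :
    ‖amplitude C j y‖ ≤ ‖y‖ := by
  unfold amplitude
  split_ifs
  · exact norm_fst_le y
  · exact norm_snd_le y
  · exact (hC _).trans (norm_fst_le y)
  · exact (hC _).trans (norm_snd_le y)
  · simp

theorem norm_amplitude_three_le {C : X →L[ℝ] X} (hC : ∀ f, ‖C f‖ ≤ ‖f‖) {j : ℤ}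
    (hj : j = 3 ∨ j = -3) (y : X × X) : ‖amplitude C j y‖ ≤ ‖y.2‖ := by
  rcases hj with rfl | rfl
  · exact le_rfl
  · exact hC _

theorem map_amplitude {J C : X →L[ℝ] X} (hJC : ∀ f, J (C f) = C (J f)) (j : ℤ) (y : X × X) :
    J (amplitude C j y) = amplitude C j (J.prodMap J y) := by
  unfold amplitude
  split_ifs <;> simp [hJC]

theorem conj_amplitude {C : X →L[ℝ] X} (hC : ∀ f, C (C f) = f) (j : ℤ) (y : X × X) :
    C (amplitude C j y) = amplitude C (-j) y := by
  by_cases h1 : j = 1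
  · subst h1; simp [amplitude]
  by_cases h2 : j = 3
  · subst h2; simp [amplitude]
  by_cases h3 : j = -1
  · subst h3; simp [amplitude, hC]
  by_cases h4 : j = -3
  · subst h4; simp [amplitude, hC]
  have e1 : -j ≠ 1 := by omega
  have e2 : -j ≠ 3 := by omega
  have e3 : -j ≠ -1 := by omega
  have e4 : -j ≠ -3 := by omega
  simp only [amplitude, h1, h2, h3, h4, e1, e2, e3, e4, if_false, zero_apply, map_zero]

theorem map_envelopeCubic {J C : X →L[ℝ] X} (hJC : ∀ f, J (C f) = C (J f))
    {T T' : X →L[ℝ] X →L[ℝ] X →L[ℝ] X} (hT : ∀ a b c, J (T' a b c) = T (J a) (J b) (J c))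
    (a b c : X × X) : J.prodMap J (envelopeCubic T' C a b c)
      = envelopeCubic T C (J.prodMap J a) (J.prodMap J b) (J.prodMap J c) := by
  have h (j : ℤ) : J (amplitudeCubic T' C j a b c)
      = amplitudeCubic T C j (J.prodMap J a) (J.prodMap J b) (J.prodMap J c) := by
    simp only [amplitudeCubic_apply, map_sum, hT, map_amplitude hJC]
  rw [envelopeCubic_apply, envelopeCubic_apply, ← h, ← h]
  rfl

/-- The triple `(1, 1, 1)` is the only one with sum `3` and without an entry `±3`. -/
theorem sum_triads_three {A : Type*} [AddCommMonoid A] (f : ℤ × ℤ × ℤ → A) :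
    ∑ J ∈ triads 3, f J = f (1, 1, 1) + ∑ J ∈ (triads 3).erase (1, 1, 1), f J :=
  (Finset.add_sum_erase _ _ (by decide)).symm

/-- Apart from the source `T(u₁, u₁, u₁)`, the nonlinearity of the third harmonic is thereby bounded
by a multiple of the third amplitude itself, as Gronwall requires. -/
theorem exists_three_of_mem_triads_three {J : ℤ × ℤ × ℤ} (hJ : J ∈ (triads 3).erase (1, 1, 1)) :
    (J.1 = 3 ∨ J.1 = -3) ∨ (J.2.1 = 3 ∨ J.2.1 = -3) ∨ (J.2.2 = 3 ∨ J.2.2 = -3) := by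
  revert J
  decide

/-- The triples of modes, up to sign, with sum `5` and with exactly one entry `3`. -/
def fifthTriads : Finset (ℤ × ℤ × ℤ) := {(1, 1, 3), (1, 3, 1), (3, 1, 1)}

/-- The triples of modes that are in none of `triads j` with `j ∈ {±1, ±3}` and not in
`±fifthTriads`. -/
def remainingTriads : Finset (ℤ × ℤ × ℤ) :=
  (modes ×ˢ modes ×ˢ modes).filter (fun J =>
    J.1 + J.2.1 + J.2.2 ∉ modes ∧ J ∉ fifthTriads ∧ -J ∉ fifthTriads)

/-- The sets on the right partition all 64 triples, and `J ↦ -J` exchanges the two halves that are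
conjugate to each other; both are finite checks. -/
theorem sum_modes_triples {A : Type*} [AddCommGroup A] (f : ℤ × ℤ × ℤ → A) :
    ∑ J ∈ modes ×ˢ modes ×ˢ modes, f J
      = ((∑ J ∈ triads 1, f J + ∑ J ∈ triads 3, f J + ∑ J ∈ fifthTriads, f J)
        + (∑ J ∈ triads 1, f (-J) + ∑ J ∈ triads 3, f (-J) + ∑ J ∈ fifthTriads, f (-J)))
        + ∑ J ∈ remainingTriads, f J := by
  have hneg : ∀ s : Finset (ℤ × ℤ × ℤ), ∑ J ∈ s, f (-J) = ∑ J ∈ s.image Neg.neg, f J :=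
    fun s => (Finset.sum_image fun a _ b _ h => neg_injective h).symm
  simp only [hneg]
  rw [← Finset.sum_union (by decide), ← Finset.sum_union (by decide),
    ← Finset.sum_union (by decide), ← Finset.sum_union (by decide),
    ← Finset.sum_union (by decide), ← Finset.sum_union (by decide)]
  exact Finset.sum_congr (by decide +kernel) fun _ _ => rfl

/-- The reason why these triples are harmless: two factors of size `ε`. -/
theorem two_threes_of_mem_remainingTriads {J : ℤ × ℤ × ℤ} (hJ : J ∈ remainingTriads) :
    ((J.1 = 3 ∨ J.1 = -3) ∧ (J.2.1 = 3 ∨ J.2.1 = -3)) ∨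
    ((J.1 = 3 ∨ J.1 = -3) ∧ (J.2.2 = 3 ∨ J.2.2 = -3)) ∨
    ((J.2.1 = 3 ∨ J.2.1 = -3) ∧ (J.2.2 = 3 ∨ J.2.2 = -3)) := by
  revert J
  decide

end Envelopes

/-! ### Abstract setting; bounds for the velocity and for the third harmonic. -/

section ErrorAnalysis

set_option maxSynthPendingDepth 3

open Set Filter Topology

/-- The operators that enter the envelope system and do not depend on `ε`: the smoothing operator
`J`, the conjugation `C`, the regularized spatial part `Q` and the rotations `L j` of the
generators, the nonlinearity `T s` on the range of `J ^ s`, and the trilinear maps `S s`, `P s` that remove the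
nonresonant terms. -/
structure EnvelopeSetting (X : Type*) [NormedAddCommGroup X] [NormedSpace ℂ X] where
  /-- The smoothing operator. -/
  J : X →L[ℝ] X
  /-- The conjugation. -/
  C : X →L[ℝ] X
  /-- The spatial part of the generators, composed with `J`. -/
  Q : X →L[ℝ] X
  /-- The rotations. -/
  L : ℤ → X →L[ℝ] X
  /-- The nonlinearity. -/
  T : ℕ → X →L[ℝ] X →L[ℝ] X →L[ℝ] X
  /-- The normal form transformation for the third harmonic. -/
  S : ℕ → X →L[ℝ] X →L[ℝ] X →L[ℝ] X
  /-- The normal form transformation for the fifth harmonic. -/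
  P : ℕ → X →L[ℝ] X →L[ℝ] X →L[ℝ] X
  norm_J_le : ∀ f, ‖J f‖ ≤ ‖f‖
  norm_C_le : ∀ f, ‖C f‖ ≤ ‖f‖
  C_C : ∀ f, C (C f) = f
  J_C : ∀ f, J (C f) = C (J f)
  J_T : ∀ s a b c, J (T (s + 1) a b c) = T s (J a) (J b) (J c)
  J_S : ∀ s a b c, J (S (s + 1) a b c) = S s (J a) (J b) (J c)
  J_P : ∀ s a b c, J (P (s + 1) a b c) = P s (J a) (J b) (J c)
  C_T : ∀ a b c, C (T 0 a b c) = T 0 (C a) (C b) (C c)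
  L_S : ∀ s a b c, L 3 (S s a b c) = T s a b c
  L_P : ∀ a b c, P 0 a b (I • L 3 c)
    = I • L 5 (P 0 a b c) - I • (T 0 a b c + T 0 a c b + T 0 c a b)

/-- The groups and the modulations in an envelope setting, for a given `ε`. -/
structure EnvelopeSetting.Frame {X : Type*} [NormedAddCommGroup X] [NormedSpace ℂ X]
    (σ : EnvelopeSetting X) (ε : ℝ) where
  /-- The group of the `j`-th amplitude; the one with `j = 0` belongs to the original problem. -/
  g : ℤ → RegularGroup σ.J
  /-- The modulation with the `j`-th power of the carrier wave at a given time. -/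
  e : ℤ → ℝ → X →L[ℝ] X
  gen_eq : ∀ j f, (g j).gen f = -(I • (ε⁻¹ • σ.L j (σ.J f) + σ.Q f))
  U_I_smul : ∀ j t f, (g j).U t (I • f) = I • (g j).U t f
  norm_e_le : ∀ j t f, ‖e j t f‖ ≤ ‖f‖
  U_e : ∀ j t f, (g 0).U (-t) (e j t f) = e j 0 ((g j).U (-t) f)
  e_T : ∀ i j k t a b c, σ.T 0 (e i t a) (e j t b) (e k t c) = e (i + j + k) t (σ.T 0 a b c)
  C_e : ∀ j t f, σ.C (e j t f) = e (-j) t (σ.C f)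
  C_U : ∀ t f, σ.C ((g 0).U t f) = (g 0).U t (σ.C f)

namespace EnvelopeSetting

variable {X : Type*} [NormedAddCommGroup X] [NormedSpace ℂ X] (σ : EnvelopeSetting X)

/-- The smoothing operator on pairs. -/
abbrev JJ : X × X →L[ℝ] X × X := σ.J.prodMap σ.J

/-- The nonlinearity of the envelope system on the range of `J ^ s`. -/
abbrev M (s : ℕ) : X × X →L[ℝ] X × X →L[ℝ] X × X →L[ℝ] X × X := envelopeCubic (σ.T s) σ.C

theorem norm_JJ_le (y : X × X) : ‖σ.JJ y‖ ≤ ‖y‖ := by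
  change max ‖σ.J y.1‖ ‖σ.J y.2‖ ≤ max ‖y.1‖ ‖y.2‖
  exact max_le_max (σ.norm_J_le _) (σ.norm_J_le _)

theorem JJ_M (s : ℕ) (a b c : X × X) :
    σ.JJ (σ.M (s + 1) a b c) = σ.M s (σ.JJ a) (σ.JJ b) (σ.JJ c) :=
  map_envelopeCubic σ.J_C (σ.J_T s) a b c

namespace Frame

variable {σ} {ε : ℝ} (F : σ.Frame ε)

/-- The group of the envelope system. -/
abbrev G : RegularGroup σ.JJ := (F.g 1).prod (F.g 3)

/-- `z` solves the envelope system on `[0, τ / ε]` in the moving frame, on the range of `J ^ 2`,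
and is bounded by `R`. -/
def IsSolution (τ R : ℝ) (z : ℝ → X × X) : Prop :=
  ∀ t ∈ Icc 0 (τ / ε), ‖z t‖ ≤ R ∧
    HasDerivWithinAt z (cubicField F.G.U (σ.M 2) ε t (z t)) (Icc 0 (τ / ε)) t

/-- The velocity of the envelopes in the moving frame. -/
abbrev vel (z : ℝ → X × X) (t : ℝ) : X × X := F.G.velocity (σ.M 2) ε z t

variable {F} {τ R : ℝ} {z : ℝ → X × X}

/-- At `t = 0` the hypotheses annihilate both `1/ε` terms of the generators, so the initial velocity
is bounded uniformly in `ε`; `norm_velocity_le` propagates this bound. -/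
theorem norm_vel_le (hε : 0 < ε) (hε1 : ε ≤ 1) (hτ : 0 < τ) (hz : F.IsSolution τ R z)
    (h1 : σ.L 1 (σ.J (z 0).1) = 0) (h3 : (z 0).2 = 0) :
    ∀ t ∈ Icc 0 (τ / ε), ‖F.vel z t‖ ≤ 2 * (‖σ.M 2‖ * R ^ 3 + ‖σ.Q‖ * R)
      * Real.exp ((1 + 3 * ‖σ.M 1‖ * R ^ 2) * τ) := by
  refine F.G.norm_velocity_le (σ.JJ_M 1) σ.norm_JJ_le hε hz ?_
  have hz0 := (hz 0 ⟨le_rfl, by positivity⟩).1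
  refine (norm_add_le _ _).trans (add_le_add ?_ ?_)
  · refine (σ.norm_JJ_le _).trans ((norm_cubicField_le (fun t y => (F.G.norm_U t y).le)
      (σ.M 2) hε 0 hz0).trans ?_)
    exact mul_le_of_le_one_left (by have := (norm_nonneg _).trans hz0; positivity) hε1
  · change max ‖(F.g 1).gen (z 0).1‖ ‖(F.g 3).gen (z 0).2‖ ≤ _
    rw [F.gen_eq, h1, h3, map_zero, norm_zero, smul_zero, zero_add, norm_neg, norm_smul, norm_I,
      one_mul]
    have h := σ.Q.le_opNorm_of_le ((norm_fst_le (z 0)).trans hz0)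
    exact max_le h ((norm_nonneg _).trans h)

theorem hasDerivWithinAt_fst (hz : F.IsSolution τ R z) {t : ℝ} (ht : t ∈ Icc 0 (τ / ε)) :
    HasDerivWithinAt (fun s => (F.g 1).U s (σ.J (z s).1)) ((F.g 1).U t (F.vel z t).1)
      (Icc 0 (τ / ε)) t :=
  (ContinuousLinearMap.fst ℝ X X).hasFDerivAt.comp_hasDerivWithinAt t
    (F.G.hasDerivWithinAt_U_J (hz t ht).2)

theorem hasDerivWithinAt_snd (hz : F.IsSolution τ R z) {t : ℝ} (ht : t ∈ Icc 0 (τ / ε)) :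
    HasDerivWithinAt (fun s => (F.g 3).U s (σ.J (z s).2)) ((F.g 3).U t (F.vel z t).2)
      (Icc 0 (τ / ε)) t :=
  (ContinuousLinearMap.snd ℝ X X).hasFDerivAt.comp_hasDerivWithinAt t
    (F.G.hasDerivWithinAt_U_J (hz t ht).2)

theorem norm_sum_triads_three_le (T : X →L[ℝ] X →L[ℝ] X →L[ℝ] X) {y : X × X} (hy : ‖y‖ ≤ R) :
    ‖∑ J ∈ (triads 3).erase (1, 1, 1), T (amplitude σ.C J.1 y) (amplitude σ.C J.2.1 y)
      (amplitude σ.C J.2.2 y)‖ ≤ 64 * ‖T‖ * R ^ 2 * ‖y.2‖ := by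
  have hR : 0 ≤ R := (norm_nonneg _).trans hy
  have hterm : ∀ J ∈ (triads 3).erase (1, 1, 1), ‖T (amplitude σ.C J.1 y)
      (amplitude σ.C J.2.1 y) (amplitude σ.C J.2.2 y)‖ ≤ ‖T‖ * R ^ 2 * ‖y.2‖ := by
    intro J hJ
    have hn := fun j => (norm_amplitude_le σ.norm_C_le j y).trans hy
    rcases exists_three_of_mem_triads_three hJ with h | h | h
    · exact (norm_trilinear_le T _ _ _ (norm_amplitude_three_le σ.norm_C_le h y) (hn _)
        (hn _)).trans (le_of_eq (by ring))
    · exact (norm_trilinear_le T _ _ _ (hn _) (norm_amplitude_three_le σ.norm_C_le h y)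
        (hn _)).trans (le_of_eq (by ring))
    · exact (norm_trilinear_le T _ _ _ (hn _) (hn _)
        (norm_amplitude_three_le σ.norm_C_le h y)).trans (le_of_eq (by ring))
  refine (norm_sum_le_of_le _ hterm).trans ?_
  -- There are `4³ = 64` triples in total, which bounds the number of summands crudely.
  rw [Finset.sum_const, nsmul_eq_mul, mul_assoc 64, mul_assoc 64]
  gcongr
  norm_cast

/-- The third harmonic is of size `O(ε)` on the range of `J`. -/
theorem norm_third_le {K : ℝ} (hε : 0 < ε) (hε1 : ε ≤ 1) (hτ : 0 < τ)
    (hz : F.IsSolution τ R z) (h3 : (z 0).2 = 0)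
    (hK : ∀ t ∈ Icc 0 (τ / ε), ‖F.vel z t‖ ≤ K) :
    ∀ t ∈ Icc 0 (τ / ε), ‖σ.J (z t).2‖ ≤ ε * (2 * ((1 + 64 * ‖σ.T 1‖ * R ^ 2) * (‖σ.S 1‖ * R ^ 3)
      + (3 * ‖σ.S 1‖ * R ^ 2 * K + ‖σ.Q‖ * (‖σ.S 2‖ * R ^ 3)))
      * Real.exp ((1 + 64 * ‖σ.T 1‖ * R ^ 2) * τ) + ‖σ.S 1‖ * R ^ 3) := by
  have h0mem : (0 : ℝ) ∈ Icc 0 (τ / ε) := ⟨le_rfl, by positivity⟩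
  have hR : 0 ≤ R := (norm_nonneg _).trans (hz 0 h0mem).1
  have hK0 : 0 ≤ K := (norm_nonneg _).trans (hK 0 h0mem)
  set b := ‖σ.S 1‖ * R ^ 3 with hb
  set ρB := 3 * ‖σ.S 1‖ * R ^ 2 * K + ‖σ.Q‖ * (‖σ.S 2‖ * R ^ 3) with hρB
  set α := 1 + 64 * ‖σ.T 1‖ * R ^ 2 with hα
  have hb0 : 0 ≤ b := by positivity
  have hρ0 : 0 ≤ ρB := by positivity
  have hα1 : 1 ≤ α := le_add_of_nonneg_right (by positivity)
  let u : ℝ → X := fun s => (F.g 1).U s (σ.J (z s).1)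
  -- The normal form: the derivative of `B` is `ε⁻¹ I T(u, u, u)`, transported back with the group,
  -- plus the bounded term `ρ`. In `ρ`, the spatial part of the generator acts on `S 2`, one level
  -- above `S 1`.
  let B : ℝ → X := fun s => (F.g 3).U (-s) (σ.S 1 (u s) (u s) (u s))
  let ρ : ℝ → X := fun t => σ.S 1 ((F.g 1).U t (F.vel z t).1) (u t) (u t)
    + σ.S 1 (u t) ((F.g 1).U t (F.vel z t).1) (u t)
    + σ.S 1 (u t) (u t) ((F.g 1).U t (F.vel z t).1)
    + I • σ.Q (σ.S 2 ((F.g 1).U t (z t).1) ((F.g 1).U t (z t).1) ((F.g 1).U t (z t).1))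
  let rest : ℝ → X := fun t => ∑ J ∈ (triads 3).erase (1, 1, 1),
    σ.T 1 (amplitude σ.C J.1 (F.G.U t (σ.JJ (z t)))) (amplitude σ.C J.2.1 (F.G.U t (σ.JJ (z t))))
      (amplitude σ.C J.2.2 (F.G.U t (σ.JJ (z t))))
  have hzn : ∀ t ∈ Icc 0 (τ / ε), ‖(F.g 1).U t (z t).1‖ ≤ R := fun t ht => by
    rw [(F.g 1).norm_U]; exact (norm_fst_le _).trans (hz t ht).1
  have hun : ∀ t ∈ Icc 0 (τ / ε), ‖u t‖ ≤ R := fun t ht => by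
    change ‖(F.g 1).U t (σ.J (z t).1)‖ ≤ R
    rw [(F.g 1).U_J]; exact (σ.norm_J_le _).trans (hzn t ht)
  have hBn : ∀ t ∈ Icc 0 (τ / ε), ‖B t‖ ≤ b := fun t ht => by
    change ‖(F.g 3).U (-t) (σ.S 1 (u t) (u t) (u t))‖ ≤ b
    rw [(F.g 3).norm_U]
    exact (norm_trilinear_le _ _ _ _ (hun t ht) (hun t ht) (hun t ht)).trans
      (le_of_eq (by rw [hb]; ring))
  have hρn : ∀ t ∈ Icc 0 (τ / ε), ‖ρ t‖ ≤ ρB := fun t ht => by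
    have hv : ‖(F.g 1).U t (F.vel z t).1‖ ≤ K := by
      rw [(F.g 1).norm_U]; exact (norm_fst_le _).trans (hK t ht)
    have e1 := norm_trilinear_le (σ.S 1) _ _ _ hv (hun t ht) (hun t ht)
    have e2 := norm_trilinear_le (σ.S 1) _ _ _ (hun t ht) hv (hun t ht)
    have e3 := norm_trilinear_le (σ.S 1) _ _ _ (hun t ht) (hun t ht) hv
    have e4 := σ.Q.le_opNorm_of_le
      (norm_trilinear_le (σ.S 2) _ _ _ (hzn t ht) (hzn t ht) (hzn t ht))
    refine (norm_add_le _ _).trans ((add_le_add norm_add₃_le le_rfl).trans ?_)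
    rw [norm_smul, norm_I, one_mul, hρB]
    refine (add_le_add (add_le_add (add_le_add e1 e2) e3) e4).trans (le_of_eq (by ring))
  have hrest : ∀ t ∈ Icc 0 (τ / ε), ‖rest t‖ ≤ 64 * ‖σ.T 1‖ * R ^ 2 * ‖σ.J (z t).2‖ := by
    intro t ht
    have hy : ‖F.G.U t (σ.JJ (z t))‖ ≤ R := by
      rw [F.G.norm_U]; exact (σ.norm_JJ_le _).trans (hz t ht).1
    refine (norm_sum_triads_three_le (σ.T 1) hy).trans (le_of_eq ?_)
    congr 1
    exact (F.g 3).norm_U t _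
  have hB' : ∀ t ∈ Icc 0 (τ / ε), HasDerivWithinAt B ((F.g 3).U (-t)
      (ε⁻¹ • (I • σ.T 1 (u t) (u t) (u t)) + ρ t)) (Icc 0 (τ / ε)) t := by
    intro t ht
    have hd := hasDerivWithinAt_fst hz ht
    have hu1 : u t = σ.J ((F.g 1).U t (z t).1) := (F.g 1).U_J t _
    -- All three slots contain the slow first amplitude, so nothing rotates: with `K = 0` the
    -- condition on `S 1` reduces to `L_S`.
    refine (F.g 3).hasDerivWithinAt_normalForm (K := 0) (F.gen_eq 3) (σ.J_S 1)
      (T₀ := fun a b c => σ.T 1 a b c) (fun a b c => ?_) hd (hd.congr_deriv ?_) hu1 hu1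
    · simp [σ.L_S]
    · simp
  have hz3 : ∀ t ∈ Icc 0 (τ / ε), HasDerivWithinAt (fun s => σ.J (z s).2)
      (ε • (F.g 3).U (-t) (σ.T 1 (u t) (u t) (u t) + rest t)) (Icc 0 (τ / ε)) t := by
    intro t ht
    have h := (σ.JJ.hasFDerivAt.comp_hasDerivWithinAt t (hz t ht).2)
    rw [F.G.J_cubicField (σ.JJ_M 1)] at h
    refine ((ContinuousLinearMap.snd ℝ X X).hasFDerivAt.comp_hasDerivWithinAt t h).congr_deriv ?_
    rw [cubicField, envelopeCubic_apply, amplitudeCubic_apply, amplitudeCubic_apply,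
      sum_triads_three]
    rfl
  -- Since `ε² I · ε⁻¹ I = -ε`, adding `ε² I B` cancels the source `ε T(u, u, u)` and leaves `ε² ρ`.
  let x : ℝ → X := fun s => σ.J (z s).2 + ε ^ 2 • (I • B s)
  have hx' : ∀ t ∈ Icc 0 (τ / ε), HasDerivWithinAt x
      (ε • (F.g 3).U (-t) (rest t) + ε ^ 2 • (I • (F.g 3).U (-t) (ρ t))) (Icc 0 (τ / ε)) t := by
    intro t ht
    refine ((hz3 t ht).add (((hB' t ht).const_smul I).const_smul (ε ^ 2))).congr_deriv ?_
    simp only [map_add, map_smul, F.U_I_smul, smul_add]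
    rw [smul_comm I ε⁻¹, smul_smul I I, I_mul_I, neg_one_smul, smul_smul (ε ^ 2) ε⁻¹,
      show ε ^ 2 * ε⁻¹ = ε by field_simp, smul_neg]
    abel
  have hle : ∀ t ∈ Icc 0 (τ / ε), ‖ε ^ 2 • (I • B t)‖ ≤ ε * b := by
    intro t ht
    rw [norm_smul, norm_smul, norm_I, one_mul, Real.norm_of_nonneg (by positivity)]
    have := hBn t ht
    have hε2 : ε ^ 2 ≤ ε := by nlinarith
    gcongr
  have hJx : ∀ t ∈ Icc 0 (τ / ε), ‖σ.J (z t).2‖ ≤ ‖x t‖ + ε * b := by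
    intro t ht
    have : σ.J (z t).2 = x t - ε ^ 2 • (I • B t) := by simp [x]
    rw [this]
    exact (norm_sub_le _ _).trans (by gcongr; exact hle t ht)
  -- The share `b` of `α b` covers the initial value of the correction; the share `(α - 1) b` covers
  -- the replacement of `J z₃` by `x` in `rest`.
  have hη : 0 ≤ ε * (α * b + ρB) := by positivity
  have key := norm_le_of_norm_deriv_le_scaled (f := x) hε hα1 hη hx' ?_ ?_
  · intro t ht
    refine (hJx t ht).trans ?_
    have := key t ht
    nlinarith
  · change ‖σ.J (z 0).2 + ε ^ 2 • (I • B 0)‖ ≤ _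
    rw [h3, map_zero, zero_add]
    refine (hle 0 h0mem).trans ?_
    gcongr
    nlinarith
  · intro t ht
    refine (norm_add_le _ _).trans ?_
    rw [norm_smul, norm_smul, norm_smul, norm_I, one_mul, (F.g 3).norm_U, (F.g 3).norm_U,
      Real.norm_of_nonneg hε.le, Real.norm_of_nonneg (by positivity : (0 : ℝ) ≤ ε ^ 2), sq,
      mul_assoc, ← mul_add]
    refine mul_le_mul_of_nonneg_left ?_ hε.le
    have e1 := (hrest t ht).trans (mul_le_mul_of_nonneg_left (hJx t ht)
      (by positivity : 0 ≤ 64 * ‖σ.T 1‖ * R ^ 2))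
    have e2 := mul_le_mul_of_nonneg_left (hρn t ht) hε.le
    have e3 : 0 ≤ ε * b := by positivity
    have e4 := norm_nonneg (x t)
    rw [hα]
    linarith [e1, e2, e3, e4]

end Frame

end EnvelopeSetting

end ErrorAnalysis

/-! ### Normal form for the fifth harmonic and the error estimate. -/

section ErrorBound

set_option maxSynthPendingDepth 3

open Set Filter Topology

namespace EnvelopeSetting

variable {X : Type*} [NormedAddCommGroup X] [NormedSpace ℂ X] {σ : EnvelopeSetting X}

namespace Frame

variable {ε : ℝ} (F : σ.Frame ε)

/-- The superposition of the modulated amplitudes. -/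
def superposition (t : ℝ) (y : X × X) : X := ∑ j ∈ modes, F.e j t (amplitude σ.C j y)

theorem superposition_eq (t : ℝ) (y : X × X) : F.superposition t y
    = (F.e 1 t y.1 + F.e 3 t y.2) + σ.C (F.e 1 t y.1 + F.e 3 t y.2) := by
  simp only [superposition, modes]
  rw [Finset.sum_insert (by decide), Finset.sum_insert (by decide), Finset.sum_insert (by decide),
    Finset.sum_singleton]
  simp only [map_add, F.C_e]
  simp [amplitude]
  abel

theorem norm_superposition_le (t : ℝ) {y : X × X} {R : ℝ} (hy : ‖y‖ ≤ R) :
    ‖F.superposition t y‖ ≤ 4 * R := by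
  have h : ∀ j ∈ modes, ‖F.e j t (amplitude σ.C j y)‖ ≤ R := fun j _ =>
    (F.norm_e_le _ _ _).trans ((norm_amplitude_le σ.norm_C_le j y).trans hy)
  refine (norm_sum_le_of_le _ h).trans (le_of_eq ?_)
  simp [modes]

/-- The nonlinearity in the equations for the harmonics `1`, `3` and the leading part of the one for
the fifth harmonic. -/
def harmonics (t : ℝ) (y : X × X) : X :=
  F.e 1 t (amplitudeCubic (σ.T 0) σ.C 1 y y y) + F.e 3 t (amplitudeCubic (σ.T 0) σ.C 3 y y y)
    + F.e 5 t (σ.T 0 y.1 y.1 y.2 + σ.T 0 y.1 y.2 y.1 + σ.T 0 y.2 y.1 y.1)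

/-- The contribution of the triples of modes with at least two entries `±3`. -/
def remainder (t : ℝ) (y : X × X) : X :=
  ∑ J ∈ remainingTriads, σ.T 0 (F.e J.1 t (amplitude σ.C J.1 y))
    (F.e J.2.1 t (amplitude σ.C J.2.1 y)) (F.e J.2.2 t (amplitude σ.C J.2.2 y))

/-- The phases multiply by `e_T`, so the triples with sum `j` combine to a `j`-th harmonic.
Conjugation acts on the summands as `J ↦ -J` because `T` is real; it thus accounts for the negative
harmonics. -/
theorem cubic_superposition (t : ℝ) (y : X × X) :
    σ.T 0 (F.superposition t y) (F.superposition t y) (F.superposition t y)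
      = (F.harmonics t y + σ.C (F.harmonics t y)) + F.remainder t y := by
  set α : ℤ → X := fun j => F.e j t (amplitude σ.C j y) with hα
  set f : ℤ × ℤ × ℤ → X := fun J => σ.T 0 (α J.1) (α J.2.1) (α J.2.2) with hf
  have hfe : ∀ J, f J = F.e (J.1 + J.2.1 + J.2.2) t (σ.T 0 (amplitude σ.C J.1 y)
      (amplitude σ.C J.2.1 y) (amplitude σ.C J.2.2 y)) := fun J => F.e_T _ _ _ _ _ _ _
  have hCα : ∀ j, σ.C (α j) = α (-j) := fun j => by
    simp only [hα, F.C_e, conj_amplitude σ.C_C]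
  have hCf : ∀ J, σ.C (f J) = f (-J) := fun J => by
    simp only [hf, σ.C_T, hCα, Prod.fst_neg, Prod.snd_neg]
  have htri : ∀ j, F.e j t (amplitudeCubic (σ.T 0) σ.C j y y y) = ∑ J ∈ triads j, f J := by
    intro j
    rw [amplitudeCubic_apply, map_sum]
    refine Finset.sum_congr rfl fun J hJ => ?_
    rw [hfe, (Finset.mem_filter.1 hJ).2]
  have hfifth : F.e 5 t (σ.T 0 y.1 y.1 y.2 + σ.T 0 y.1 y.2 y.1 + σ.T 0 y.2 y.1 y.1)
      = ∑ J ∈ fifthTriads, f J := by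
    rw [fifthTriads, Finset.sum_insert (by decide), Finset.sum_insert (by decide),
      Finset.sum_singleton, hfe, hfe, hfe]
    simp [amplitude, add_assoc]
  have hN : F.harmonics t y
      = ∑ J ∈ triads 1, f J + ∑ J ∈ triads 3, f J + ∑ J ∈ fifthTriads, f J := by
    rw [harmonics, htri, htri, hfifth]
  have hexp : σ.T 0 (F.superposition t y) (F.superposition t y) (F.superposition t y)
      = ∑ J ∈ modes ×ˢ modes ×ˢ modes, f J := by
    have hs : F.superposition t y = ∑ j ∈ modes, α j := rfl
    rw [hs, Finset.sum_product]
    simp only [Finset.sum_product, hf]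
    rw [map_sum (σ.T 0), sum_apply, sum_apply]
    refine Finset.sum_congr rfl fun i _ => ?_
    rw [map_sum (σ.T 0 (α i)), sum_apply]
    exact Finset.sum_congr rfl fun k _ => map_sum _ _ _
  rw [hexp, sum_modes_triples, hN]
  simp only [map_add, map_sum, hCf]
  rfl

/-- Each summand has two factors bounded by `r` and one bounded by `R`; with `r = O(ε)` the
remainder is of second order. -/
theorem norm_remainder_le (t : ℝ) {y : X × X} {R r : ℝ} (hy : ‖y‖ ≤ R) (hr : ‖y.2‖ ≤ r) :
    ‖F.remainder t y‖ ≤ 64 * ‖σ.T 0‖ * R * r ^ 2 := by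
  have hR : 0 ≤ R := (norm_nonneg _).trans hy
  have hr0 : 0 ≤ r := (norm_nonneg _).trans hr
  have hn : ∀ j, ‖F.e j t (amplitude σ.C j y)‖ ≤ R := fun j =>
    (F.norm_e_le _ _ _).trans ((norm_amplitude_le σ.norm_C_le j y).trans hy)
  have h3 : ∀ {j}, (j = 3 ∨ j = -3) → ‖F.e j t (amplitude σ.C j y)‖ ≤ r := fun h =>
    (F.norm_e_le _ _ _).trans ((norm_amplitude_three_le σ.norm_C_le h y).trans hr)
  have hterm : ∀ J ∈ remainingTriads, ‖σ.T 0 (F.e J.1 t (amplitude σ.C J.1 y))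
      (F.e J.2.1 t (amplitude σ.C J.2.1 y)) (F.e J.2.2 t (amplitude σ.C J.2.2 y))‖
      ≤ ‖σ.T 0‖ * R * r ^ 2 := by
    intro J hJ
    rcases two_threes_of_mem_remainingTriads hJ with h | h | h
    · exact (norm_trilinear_le _ _ _ _ (h3 h.1) (h3 h.2) (hn _)).trans (le_of_eq (by ring))
    · exact (norm_trilinear_le _ _ _ _ (h3 h.1) (hn _) (h3 h.2)).trans (le_of_eq (by ring))
    · exact (norm_trilinear_le _ _ _ _ (hn _) (h3 h.1) (h3 h.2)).trans (le_of_eq (by ring))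
  refine (norm_sum_le_of_le _ hterm).trans ?_
  rw [Finset.sum_const, nsmul_eq_mul, mul_assoc 64, mul_assoc 64]
  gcongr
  have : remainingTriads.card ≤ 64 := by decide
  exact_mod_cast this

variable {F} {τ R : ℝ} {z : ℝ → X × X}

/-- The total derivative in the normal form of the fifth harmonic. -/
theorem exists_hasDerivWithinAt_fifth {K K₃ : ℝ} (hε : 0 < ε)
    (hz : F.IsSolution τ R z) (hK : ∀ t ∈ Icc 0 (τ / ε), ‖F.vel z t‖ ≤ K)
    (hK₃ : ∀ t ∈ Icc 0 (τ / ε), ‖σ.J (z t).2‖ ≤ ε * K₃) :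
    ∃ B ρ : ℝ → X, ∀ t ∈ Icc 0 (τ / ε), ‖B t‖ ≤ ‖σ.P 0‖ * R ^ 3 ∧
      ‖ρ t‖ ≤ ε * (2 * ‖σ.P 0‖ * K * R * K₃ + ‖σ.P 0‖ * R ^ 2 * (‖σ.M 2‖ * R ^ 3 + ‖σ.Q‖ * K₃)
        + ‖σ.Q‖ * (‖σ.P 1‖ * R ^ 2 * K₃)) ∧
      HasDerivWithinAt B ((F.g 5).U (-t) (ε⁻¹ • (I • (
        σ.T 0 (F.G.U t (σ.JJ (σ.JJ (z t)))).1 (F.G.U t (σ.JJ (σ.JJ (z t)))).1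
          (F.G.U t (σ.JJ (σ.JJ (z t)))).2
        + σ.T 0 (F.G.U t (σ.JJ (σ.JJ (z t)))).1 (F.G.U t (σ.JJ (σ.JJ (z t)))).2
          (F.G.U t (σ.JJ (σ.JJ (z t)))).1
        + σ.T 0 (F.G.U t (σ.JJ (σ.JJ (z t)))).2 (F.G.U t (σ.JJ (σ.JJ (z t)))).1
          (F.G.U t (σ.JJ (σ.JJ (z t)))).1)) + ρ t)) (Icc 0 (τ / ε)) t := by
  let a : ℝ → X := fun s => (F.g 1).U s (σ.J (σ.J (z s).1))
  let c : ℝ → X := fun s => (F.g 3).U s (σ.J (σ.J (z s).2))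
  let a₁ : ℝ → X := fun s => (F.g 1).U s (σ.J (z s).1)
  let c₁ : ℝ → X := fun s => (F.g 3).U s (σ.J (z s).2)
  let a' : ℝ → X := fun s => σ.J ((F.g 1).U s (F.vel z s).1)
  -- The part of `∂_t u₃` other than the rotation `-ε⁻¹ I L₃ u₃`. It is `O(ε)`: the nonlinearity
  -- carries `ε`, and the spatial part acts on `c₁`, which is `O(ε)` one level higher. This is why
  -- the third harmonic is estimated after only one application of `J`.
  let r : ℝ → X := fun s => (F.g 3).U s (σ.J (σ.J (cubicField F.G.U (σ.M 2) ε s (z s)).2))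
    - I • σ.Q (c₁ s)
  have ha : ∀ t ∈ Icc 0 (τ / ε), HasDerivWithinAt a (a' t) (Icc 0 (τ / ε)) t := by
    intro t ht
    refine (σ.J.hasFDerivAt.comp_hasDerivWithinAt t (hasDerivWithinAt_fst hz ht)).congr_of_mem
      (fun s _ => ?_) ht
    exact (F.g 1).U_J s _
  have hc : ∀ t ∈ Icc 0 (τ / ε),
      HasDerivWithinAt c (r t - ε⁻¹ • (I • σ.L 3 (c t))) (Icc 0 (τ / ε)) t := by
    intro t ht
    refine ((σ.J.hasFDerivAt.comp_hasDerivWithinAt t (hasDerivWithinAt_snd hz ht)).congr_of_mem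
      (fun s _ => (F.g 3).U_J s _) ht).congr_deriv ?_
    have e1 : (F.vel z t).2 = σ.J (cubicField F.G.U (σ.M 2) ε t (z t)).2
        + (F.g 3).gen (z t).2 := rfl
    rw [e1, ← (F.g 3).U_J, map_add, map_add, ← (F.g 3).gen_J, (F.g 3).U_gen, F.gen_eq,
      ← (F.g 3).U_J]
    simp only [r, c, c₁, smul_add]
    rw [smul_comm I ε⁻¹]
    abel
  have hun : ∀ t ∈ Icc 0 (τ / ε), ‖a₁ t‖ ≤ R := fun t ht => by
    change ‖(F.g 1).U t (σ.J (z t).1)‖ ≤ R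
    rw [(F.g 1).norm_U]
    exact (σ.norm_J_le _).trans ((norm_fst_le _).trans (hz t ht).1)
  have han : ∀ t ∈ Icc 0 (τ / ε), ‖a t‖ ≤ R := fun t ht => by
    change ‖(F.g 1).U t (σ.J (σ.J (z t).1))‖ ≤ R
    rw [(F.g 1).U_J]
    exact (σ.norm_J_le _).trans (hun t ht)
  have hcn₁ : ∀ t ∈ Icc 0 (τ / ε), ‖c₁ t‖ ≤ ε * K₃ := fun t ht => by
    change ‖(F.g 3).U t (σ.J (z t).2)‖ ≤ _
    rw [(F.g 3).norm_U]
    exact hK₃ t ht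
  have hcn : ∀ t ∈ Icc 0 (τ / ε), ‖c t‖ ≤ ε * K₃ := fun t ht => by
    change ‖(F.g 3).U t (σ.J (σ.J (z t).2))‖ ≤ _
    rw [(F.g 3).U_J]
    exact (σ.norm_J_le _).trans (hcn₁ t ht)
  -- For `B` itself a bound without `ε` suffices, as `B` will enter with the factor `ε²`.
  have hcR : ∀ t ∈ Icc 0 (τ / ε), ‖c t‖ ≤ R := fun t ht => by
    change ‖(F.g 3).U t (σ.J (σ.J (z t).2))‖ ≤ _
    rw [(F.g 3).norm_U]
    exact (σ.norm_J_le _).trans ((σ.norm_J_le _).trans ((norm_snd_le _).trans (hz t ht).1))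
  have ha'n : ∀ t ∈ Icc 0 (τ / ε), ‖a' t‖ ≤ K := fun t ht => by
    refine (σ.norm_J_le _).trans ?_
    rw [(F.g 1).norm_U]
    exact (norm_fst_le _).trans (hK t ht)
  have hrn : ∀ t ∈ Icc 0 (τ / ε), ‖r t‖ ≤ ε * (‖σ.M 2‖ * R ^ 3 + ‖σ.Q‖ * K₃) := by
    intro t ht
    refine (norm_sub_le _ _).trans ?_
    rw [(F.g 3).norm_U, norm_smul, norm_I, one_mul, mul_add]
    refine add_le_add ((σ.norm_J_le _).trans ((σ.norm_J_le _).trans ((norm_snd_le _).trans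
      (norm_cubicField_le (fun t y => (F.G.norm_U t y).le) _ hε t (hz t ht).1)))) ?_
    exact (σ.Q.le_opNorm_of_le (hcn₁ t ht)).trans (le_of_eq (by ring))
  refine ⟨fun s => (F.g 5).U (-s) (σ.P 0 (a s) (a s) (c s)), fun t =>
    σ.P 0 (a' t) (a t) (c t) + σ.P 0 (a t) (a' t) (c t) + σ.P 0 (a t) (a t) (r t)
      + I • σ.Q (σ.P 1 (a₁ t) (a₁ t) (c₁ t)), fun t ht => ⟨?_, ?_, ?_⟩⟩
  · rw [(F.g 5).norm_U]
    exact (norm_trilinear_le _ _ _ _ (han t ht) (han t ht) (hcR t ht)).trans (le_of_eq (by ring))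
  · have e1 := norm_trilinear_le (σ.P 0) _ _ _ (ha'n t ht) (han t ht) (hcn t ht)
    have e2 := norm_trilinear_le (σ.P 0) _ _ _ (han t ht) (ha'n t ht) (hcn t ht)
    have e3 := norm_trilinear_le (σ.P 0) _ _ _ (han t ht) (han t ht) (hrn t ht)
    have e4 := σ.Q.le_opNorm_of_le
      (norm_trilinear_le (σ.P 1) _ _ _ (hun t ht) (hun t ht) (hcn₁ t ht))
    refine (norm_add_le _ _).trans ((add_le_add norm_add₃_le le_rfl).trans ?_)
    rw [norm_smul, norm_I, one_mul]
    exact (add_le_add (add_le_add (add_le_add e1 e2) e3) e4).trans (le_of_eq (by ring))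
  · exact (F.g 5).hasDerivWithinAt_normalForm (F.gen_eq 5) (σ.J_P 0)
      (T₀ := fun a b c => σ.T 0 a b c + σ.T 0 a c b + σ.T 0 c a b) σ.L_P (ha t ht) (hc t ht)
      ((F.g 1).U_J t _) ((F.g 3).U_J t _)

/-- The error of the approximation in the moving frame. -/
theorem norm_error_le {K K₃ R₀ : ℝ} (hε : 0 < ε) (hτ : 0 < τ)
    (hz : F.IsSolution τ R z) (h3 : (z 0).2 = 0)
    (hK : ∀ t ∈ Icc 0 (τ / ε), ‖F.vel z t‖ ≤ K)
    (hK₃ : ∀ t ∈ Icc 0 (τ / ε), ‖σ.J (z t).2‖ ≤ ε * K₃) {w : ℝ → X}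
    (hw : ∀ t ∈ Icc 0 (τ / ε), ‖w t‖ ≤ R₀ ∧
      HasDerivWithinAt w (cubicField (F.g 0).U (σ.T 0) ε t (w t)) (Icc 0 (τ / ε)) t)
    (hw0 : w 0 = F.e 1 0 (σ.J (σ.J (z 0).1)) + σ.C (F.e 1 0 (σ.J (σ.J (z 0).1)))) :
    ∀ t ∈ Icc 0 (τ / ε),
      ‖(F.g 0).U t (w t) - F.superposition t (F.G.U t (σ.JJ (σ.JJ (z t))))‖ ≤
      (2 * (2 * (1 + 3 * ‖σ.T 0‖ * (R₀ + 4 * R) ^ 2) * (‖σ.P 0‖ * R ^ 3)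
        + 64 * ‖σ.T 0‖ * R * K₃ ^ 2
        + 2 * (2 * ‖σ.P 0‖ * K * R * K₃ + ‖σ.P 0‖ * R ^ 2 * (‖σ.M 2‖ * R ^ 3 + ‖σ.Q‖ * K₃)
          + ‖σ.Q‖ * (‖σ.P 1‖ * R ^ 2 * K₃))) *
        Real.exp ((1 + 3 * ‖σ.T 0‖ * (R₀ + 4 * R) ^ 2) * τ) + 2 * (‖σ.P 0‖ * R ^ 3)) * ε ^ 2 := by
  have h0mem : (0 : ℝ) ∈ Icc 0 (τ / ε) := ⟨le_rfl, by positivity⟩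
  obtain ⟨B, ρ, hBρ⟩ := exists_hasDerivWithinAt_fifth hε hz hK hK₃
  have hR : 0 ≤ R := (norm_nonneg _).trans (hz 0 h0mem).1
  have hR₀ : 0 ≤ R₀ := (norm_nonneg _).trans (hw 0 h0mem).1
  set Kρ := 2 * ‖σ.P 0‖ * K * R * K₃ + ‖σ.P 0‖ * R ^ 2 * (‖σ.M 2‖ * R ^ 3 + ‖σ.Q‖ * K₃)
    + ‖σ.Q‖ * (‖σ.P 1‖ * R ^ 2 * K₃) with hKρ
  set b := ‖σ.P 0‖ * R ^ 3 with hb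
  set α := 1 + 3 * ‖σ.T 0‖ * (R₀ + 4 * R) ^ 2 with hα
  have hb0 : 0 ≤ b := by positivity
  have hα1 : 1 ≤ α := le_add_of_nonneg_right (by positivity)
  have hKρ0 : 0 ≤ Kρ := by
    have := (norm_nonneg _).trans (hBρ 0 h0mem).2.1
    exact nonneg_of_mul_nonneg_right this hε
  let y : ℝ → X × X := fun t => F.G.U t (σ.JJ (σ.JJ (z t)))
  have hyn : ∀ t ∈ Icc 0 (τ / ε), ‖y t‖ ≤ R := fun t ht => by
    change ‖F.G.U t (σ.JJ (σ.JJ (z t)))‖ ≤ R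
    rw [F.G.norm_U]
    exact (σ.norm_JJ_le _).trans ((σ.norm_JJ_le _).trans (hz t ht).1)
  have hyn3 : ∀ t ∈ Icc 0 (τ / ε), ‖(y t).2‖ ≤ ε * K₃ := fun t ht => by
    change ‖(F.g 3).U t (σ.J (σ.J (z t).2))‖ ≤ ε * K₃
    rw [(F.g 3).norm_U]
    exact (σ.norm_J_le _).trans (hK₃ t ht)
  -- The positive harmonics of the ansatz in the moving frame of the original problem: by `U_e`,
  -- only carriers at time `0` occur.
  let v₁ : ℝ → X := fun s => F.e 1 0 (σ.J (σ.J (z s).1)) + F.e 3 0 (σ.J (σ.J (z s).2))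
  -- The correction is chosen so that `-ε² I · ε⁻¹ I = ε` supplies the fifth harmonic which the
  -- ansatz lacks; the defect is `m = O(ε³)`.
  let v : ℝ → X := fun s => v₁ s - F.e 5 0 (ε ^ 2 • (I • B s))
  let m : ℝ → X := fun s => F.e 5 0 (ε ^ 2 • (I • (F.g 5).U (-s) (ρ s)))
  have hsup : ∀ t, (F.g 0).U (-t) (F.superposition t (y t)) = v₁ t + σ.C (v₁ t) := by
    intro t
    rw [superposition_eq, map_add, ← F.C_U, map_add, F.U_e, F.U_e]
    have e1 : (F.g 1).U (-t) (y t).1 = σ.J (σ.J (z t).1) := (F.g 1).U_neg_U t _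
    have e3 : (F.g 3).U (-t) (y t).2 = σ.J (σ.J (z t).2) := (F.g 3).U_neg_U t _
    rw [e1, e3]
  have hJJz : ∀ t ∈ Icc 0 (τ / ε), HasDerivWithinAt (fun s => σ.JJ (σ.JJ (z s)))
      (ε • F.G.U (-t) (σ.M 0 (y t) (y t) (y t))) (Icc 0 (τ / ε)) t := by
    intro t ht
    have h := (σ.JJ ∘L σ.JJ).hasFDerivAt.comp_hasDerivWithinAt t (hz t ht).2
    refine h.congr_deriv ?_
    rw [ContinuousLinearMap.comp_apply, F.G.J_cubicField (σ.JJ_M 1), F.G.J_cubicField (σ.JJ_M 0)]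
    rfl
  have hv' : ∀ t ∈ Icc 0 (τ / ε), HasDerivWithinAt v
      (ε • (F.g 0).U (-t) (F.harmonics t (y t)) - m t) (Icc 0 (τ / ε)) t := by
    intro t ht
    have h := hJJz t ht
    rw [envelopeCubic_apply] at h
    have h1 := (F.e 1 0 ∘L ContinuousLinearMap.fst ℝ X X).hasFDerivAt.comp_hasDerivWithinAt t h
    have h2 := (F.e 3 0 ∘L ContinuousLinearMap.snd ℝ X X).hasFDerivAt.comp_hasDerivWithinAt t h
    have h5 := (F.e 5 0).hasFDerivAt.comp_hasDerivWithinAt t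
      (((hBρ t ht).2.2.const_smul I).const_smul (ε ^ 2))
    refine ((h1.add h2).sub h5).congr_deriv ?_
    have e1 : ∀ q : X × X, (F.e 1 0 ∘L ContinuousLinearMap.fst ℝ X X) (ε • F.G.U (-t) q)
        = ε • F.e 1 0 ((F.g 1).U (-t) q.1) := fun q => (F.e 1 0).map_smul ε _
    have e3 : ∀ q : X × X, (F.e 3 0 ∘L ContinuousLinearMap.snd ℝ X X) (ε • F.G.U (-t) q)
        = ε • F.e 3 0 ((F.g 3).U (-t) q.2) := fun q => (F.e 3 0).map_smul ε _
    rw [e1, e3]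
    simp only [harmonics, map_add _ (_ : X) (_ : X), F.U_e, m, smul_add, map_smul, F.U_I_smul]
    rw [smul_comm I ε⁻¹, smul_comm I ε⁻¹, smul_comm I ε⁻¹]
    simp only [smul_smul I I, I_mul_I, neg_one_smul, smul_smul (ε ^ 2) ε⁻¹,
      show ε ^ 2 * ε⁻¹ = ε by field_simp, smul_neg, map_neg, map_smul]
    abel
  let x : ℝ → X := fun s => w s - (v s + σ.C (v s))
  have hx' : ∀ t ∈ Icc 0 (τ / ε), HasDerivWithinAt x
      (ε • (F.g 0).U (-t) (σ.T 0 ((F.g 0).U t (w t)) ((F.g 0).U t (w t)) ((F.g 0).U t (w t))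
        - σ.T 0 (F.superposition t (y t)) (F.superposition t (y t)) (F.superposition t (y t))
        + F.remainder t (y t)) + (m t + σ.C (m t))) (Icc 0 (τ / ε)) t := by
    intro t ht
    have h := (hw t ht).2.sub ((hv' t ht).add
      (σ.C.hasFDerivAt.comp_hasDerivWithinAt t (hv' t ht)))
    refine h.congr_deriv ?_
    -- The harmonics and their conjugates cancel exactly against the derivative of `v + C v`; only
    -- the remainder and `m` are left as forcing.
    rw [cubic_superposition]
    simp only [cubicField, map_sub, map_add, map_smul, F.C_U, smul_sub, smul_add]
    abel
  have hmn : ∀ t ∈ Icc 0 (τ / ε), ‖m t + σ.C (m t)‖ ≤ ε * (ε ^ 2 * (2 * Kρ)) := by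
    intro t ht
    have h1 : ‖m t‖ ≤ ε * (ε ^ 2 * Kρ) := by
      refine (F.norm_e_le _ _ _).trans ?_
      rw [norm_smul, norm_smul, norm_I, one_mul, (F.g 5).norm_U,
        Real.norm_of_nonneg (by positivity)]
      have := mul_le_mul_of_nonneg_left (hBρ t ht).2.1 (by positivity : (0 : ℝ) ≤ ε ^ 2)
      exact this.trans (le_of_eq (by ring))
    refine (norm_add_le _ _).trans ((add_le_add h1 ((σ.norm_C_le _).trans h1)).trans ?_)
    exact le_of_eq (by ring)
  have hE : ∀ t ∈ Icc 0 (τ / ε), ‖F.e 5 0 (ε ^ 2 • (I • B t))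
      + σ.C (F.e 5 0 (ε ^ 2 • (I • B t)))‖ ≤ ε ^ 2 * (2 * b) := by
    intro t ht
    have h1 : ‖F.e 5 0 (ε ^ 2 • (I • B t))‖ ≤ ε ^ 2 * b := by
      refine (F.norm_e_le _ _ _).trans ?_
      rw [norm_smul, norm_smul, norm_I, one_mul, Real.norm_of_nonneg (by positivity)]
      exact mul_le_mul_of_nonneg_left (hBρ t ht).1 (by positivity)
    refine (norm_add_le _ _).trans ((add_le_add h1 ((σ.norm_C_le _).trans h1)).trans ?_)
    exact le_of_eq (by ring)
  have hdiff : ∀ t ∈ Icc 0 (τ / ε),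
      ‖(F.g 0).U t (w t) - F.superposition t (y t)‖ ≤ ‖x t‖ + ε ^ 2 * (2 * b) := by
    intro t ht
    rw [← (F.g 0).norm_U (-t), map_sub, (F.g 0).U_neg_U, hsup]
    have : w t - (v₁ t + σ.C (v₁ t)) = x t - (F.e 5 0 (ε ^ 2 • (I • B t))
        + σ.C (F.e 5 0 (ε ^ 2 • (I • B t)))) := by
      simp only [x, v, map_sub]
      abel
    rw [this]
    exact (norm_sub_le _ _).trans (add_le_add le_rfl (hE t ht))
  -- The term `2 α b` covers both the initial value of the correction and its effect inside the
  -- Lipschitz estimate; the factor `2` stems from the complex conjugate.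
  have hη : 0 ≤ ε ^ 2 * (2 * α * b + 64 * ‖σ.T 0‖ * R * K₃ ^ 2 + 2 * Kρ) := by positivity
  have key := norm_le_of_norm_deriv_le_scaled (f := x) hε hα1 hη hx' ?_ ?_
  · intro t ht
    refine (hdiff t ht).trans ((add_le_add (key t ht) le_rfl).trans (le_of_eq (by ring)))
  · have h0 : x 0 = F.e 5 0 (ε ^ 2 • (I • B 0)) + σ.C (F.e 5 0 (ε ^ 2 • (I • B 0))) := by
      simp only [x, v, v₁, hw0, h3, map_zero, add_zero, map_sub]
      abel
    rw [h0]
    refine (hE 0 h0mem).trans ?_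
    gcongr
    have : 0 ≤ 64 * ‖σ.T 0‖ * R * K₃ ^ 2 := by positivity
    nlinarith
  · intro t ht
    refine (norm_add_le _ _).trans ?_
    rw [norm_smul, (F.g 0).norm_U, Real.norm_of_nonneg hε.le]
    refine (add_le_add le_rfl (hmn t ht)).trans ?_
    rw [← mul_add]
    refine mul_le_mul_of_nonneg_left ?_ hε.le
    have hwn : ‖(F.g 0).U t (w t)‖ ≤ R₀ + 4 * R := by
      rw [(F.g 0).norm_U]; exact (hw t ht).1.trans (by linarith)
    have hsn : ‖F.superposition t (y t)‖ ≤ R₀ + 4 * R :=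
      (F.norm_superposition_le t (hyn t ht)).trans (by linarith)
    have e1 := (trilinear_sub_le (σ.T 0) hwn hsn).trans
      (mul_le_mul_of_nonneg_left (hdiff t ht) (by positivity))
    have e2 := F.norm_remainder_le t (hyn t ht) (hyn3 t ht)
    refine (add_le_add ((norm_add_le _ _).trans (add_le_add e1 e2)) le_rfl).trans ?_
    have e3 := norm_nonneg (x t)
    have e4 : 0 ≤ ε ^ 2 * (2 * b) := by positivity
    rw [hα]
    linarith

end Frame

end EnvelopeSetting

end ErrorBound

/-! ### Fourier multipliers with bounded symbols on `L¹` and on the Wiener algebra. -/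

section Multipliers

set_option maxSynthPendingDepth 3

open Set Filter Topology

/-- Bounded measurable symbols of Fourier multipliers. -/
structure BddSymbol (d : ℕ) (E F : Type*) [NormedAddCommGroup E] [NormedSpace ℂ E]
    [NormedAddCommGroup F] [NormedSpace ℂ F] where
  /-- The symbol. -/
  toFun : Space d → E →L[ℂ] F
  aestronglyMeasurable : AEStronglyMeasurable toFun volume
  bounded : ∃ c, ∀ k, ‖toFun k‖ ≤ c

section General

variable {d : ℕ} {E F : Type*} [NormedAddCommGroup E] [NormedSpace ℂ E]
    [NormedAddCommGroup F] [NormedSpace ℂ F]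

namespace BddSymbol

theorem integrable (m : BddSymbol d E F) {f : Space d → E} (hf : Integrable f) :
    Integrable (fun k => m.toFun k (f k)) := by
  obtain ⟨c, hc⟩ := m.bounded
  refine (hf.norm.const_mul c).mono' ?_ (ae_of_all _ fun k => (m.toFun k).le_of_opNorm_le (hc k) _)
  exact isBoundedBilinearMap_apply.continuous.comp_aestronglyMeasurable
    (m.aestronglyMeasurable.prodMk hf.1)

/-- Multiplication with a bounded symbol in `L¹`. -/
def mulL1 (m : BddSymbol d E F) :
    Lp E 1 (volume : Measure (Space d)) →L[ℂ] Lp F 1 (volume : Measure (Space d)) :=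
  LinearMap.mkContinuousOfExistsBound
    { toFun := fun f => (m.integrable (L1.integrable_coeFn f)).toL1 _
      map_add' := fun f g => by
        rw [← Integrable.toL1_add]
        refine Integrable.toL1_eq_toL1_iff _ _ _ _ |>.2 ?_
        filter_upwards [Lp.coeFn_add f g] with k hk
        rw [hk, Pi.add_apply, map_add]
        rfl
      map_smul' := fun c f => by
        rw [RingHom.id_apply, ← Integrable.toL1_smul]
        refine Integrable.toL1_eq_toL1_iff _ _ _ _ |>.2 ?_
        filter_upwards [Lp.coeFn_smul c f] with k hk
        rw [hk, Pi.smul_apply, map_smul] } (by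
    obtain ⟨c, hc⟩ := m.bounded
    refine ⟨c, fun f => ?_⟩
    simp only [LinearMap.coe_mk, AddHom.coe_mk]
    rw [L1.norm_of_fun_eq_integral_norm, L1.norm_eq_integral_norm, ← integral_const_mul]
    exact integral_mono (m.integrable (L1.integrable_coeFn f)).norm
      ((L1.integrable_coeFn f).norm.const_mul c) fun k => (m.toFun k).le_of_opNorm_le (hc k) _)

theorem coeFn_mulL1 (m : BddSymbol d E F) (f : Lp E 1 (volume : Measure (Space d))) :
    m.mulL1 f =ᵐ[volume] fun k => m.toFun k (f k) :=
  (m.integrable (L1.integrable_coeFn f)).coeFn_toL1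

theorem norm_mulL1_le (m : BddSymbol d E F) {c : ℝ} (hc : ∀ k, ‖m.toFun k‖ ≤ c)
    (f : Lp E 1 (volume : Measure (Space d))) : ‖m.mulL1 f‖ ≤ c * ‖f‖ := by
  rw [L1.norm_eq_integral_norm, L1.norm_eq_integral_norm, ← integral_const_mul]
  refine integral_mono_ae (L1.integrable_coeFn _).norm
    ((L1.integrable_coeFn f).norm.const_mul c) ?_
  filter_upwards [m.coeFn_mulL1 f] with k hk
  rw [hk]
  exact (m.toFun k).le_of_opNorm_le (hc k) _

theorem norm_mulL1_eq (m : BddSymbol d E F) (hm : ∀ k v, ‖m.toFun k v‖ = ‖v‖)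
    (f : Lp E 1 (volume : Measure (Space d))) : ‖m.mulL1 f‖ = ‖f‖ := by
  rw [L1.norm_eq_integral_norm, L1.norm_eq_integral_norm]
  refine integral_congr_ae ?_
  filter_upwards [m.coeFn_mulL1 f] with k hk
  rw [hk, hm]

/-- Multipliers converge strongly, if their symbols are bounded and converge pointwise. -/
theorem tendsto_mulL1 {ι : Type*} {l : Filter ι} [l.IsCountablyGenerated]
    {m : ι → BddSymbol d E F} {m₀ : BddSymbol d E F} {c : ℝ}
    (hc : ∀ᶠ i in l, ∀ k, ‖(m i).toFun k‖ ≤ c)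
    (hm : ∀ k, Tendsto (fun i => (m i).toFun k) l (𝓝 (m₀.toFun k)))
    (f : Lp E 1 (volume : Measure (Space d))) :
    Tendsto (fun i => (m i).mulL1 f) l (𝓝 (m₀.mulL1 f)) := by
  obtain ⟨c₀, hc₀⟩ := m₀.bounded
  rw [tendsto_iff_norm_sub_tendsto_zero]
  have hn : ∀ i, ‖(m i).mulL1 f - m₀.mulL1 f‖
      = ∫ k, ‖(m i).toFun k (f k) - m₀.toFun k (f k)‖ := by
    intro i
    rw [L1.norm_eq_integral_norm]
    refine integral_congr_ae ?_
    filter_upwards [Lp.coeFn_sub ((m i).mulL1 f) (m₀.mulL1 f), (m i).coeFn_mulL1 f,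
      m₀.coeFn_mulL1 f] with k h1 h2 h3
    rw [h1, Pi.sub_apply, h2, h3]
  simp only [hn]
  have hf := L1.integrable_coeFn f
  have h0 : ∫ _ : Space d, (0 : ℝ) = 0 := integral_zero _ _
  rw [← h0]
  -- Dominated convergence, with `(c + c₀) |f|` as the majorant. Convergence holds for each `f`
  -- only; uniform convergence of the symbols is not required.
  refine tendsto_integral_filter_of_dominated_convergence (fun k => (c + c₀) * ‖f k‖) ?_ ?_ ?_ ?_
  · exact Eventually.of_forall fun i => (((m i).integrable hf).sub (m₀.integrable hf)).norm.1
  · filter_upwards [hc] with i hi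
    refine ae_of_all _ fun k => ?_
    rw [norm_norm, add_mul]
    exact (norm_sub_le _ _).trans (add_le_add ((ContinuousLinearMap.le_of_opNorm_le _ (hi k) _))
      ((ContinuousLinearMap.le_of_opNorm_le _ (hc₀ k) _)))
  · exact hf.norm.const_mul _
  · refine ae_of_all _ fun k => ?_
    have h1 : Tendsto (fun i => (m i).toFun k (f k)) l (𝓝 (m₀.toFun k (f k))) :=
      ((ContinuousLinearMap.apply ℂ F (f k)).continuous.tendsto _).comp (hm k)
    exact tendsto_iff_norm_sub_tendsto_zero.1 h1

end BddSymbol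

end General

namespace Wiener

variable {d n : ℕ}

theorem ext_fourier {f g : Wiener d n}
    (h : (f.fourier : Space d → State n) =ᵐ[volume] g.fourier) : f = g :=
  fourierIso.injective (Lp.ext h)

theorem fourier_ofFourier (g : Space d → State n) (hg : Integrable g) :
    ((ofFourier g hg).fourier : Space d → State n) =ᵐ[volume] g := by
  rw [fourier_unique (ofFourier g hg) (g := hg.toL1 g) (invFourier_congr hg.coeFn_toL1)]
  exact hg.coeFn_toL1

theorem coeFn_fourier_add (f g : Wiener d n) :
    ((f + g).fourier : Space d → State n) =ᵐ[volume] fun k => f.fourier k + g.fourier k := by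
  have : (f + g).fourier = f.fourier + g.fourier := fourierIso.map_add f g
  rw [this]
  exact Lp.coeFn_add _ _

theorem coeFn_fourier_smul (c : ℂ) (f : Wiener d n) :
    ((c • f).fourier : Space d → State n) =ᵐ[volume] fun k => c • f.fourier k := by
  have : (c • f).fourier = c • f.fourier := fourierIso.map_smul c f
  rw [this]
  exact Lp.coeFn_smul _ _

theorem norm_eq_integral (f : Wiener d n) : ‖f‖ = ∫ k, ‖f.fourier k‖ := by
  rw [← L1.norm_eq_integral_norm]
  rfl

theorem integrable_fourier (f : Wiener d n) : Integrable (f.fourier : Space d → State n) :=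
  L1.integrable_coeFn _

theorem apply_eq (f : Wiener d n) (x : Space d) :
    f x = invFourier (f.fourier : Space d → State n) x :=
  (congrFun (invFourier_fourier f) x).symm

/-- Holds with constant one because `(2π)^{-d/2} ≤ 1`. The bound in `L^∞` thus follows from the one
in `W`. -/
theorem norm_apply_le (f : Wiener d n) (x : Space d) : ‖f x‖ ≤ ‖f‖ := by
  rw [apply_eq, norm_eq_integral, invFourier, norm_smul]
  have h1 : ‖((2 * π) ^ (-(d : ℝ) / 2) : ℝ)‖ ≤ 1 := by
    rw [Real.norm_of_nonneg (by positivity)]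
    refine Real.rpow_le_one_of_one_le_of_nonpos (by linarith [Real.pi_gt_three]) ?_
    have : (0 : ℝ) ≤ d := by positivity
    linarith
  refine (mul_le_of_le_one_left (norm_nonneg _) h1).trans
    ((norm_integral_le_integral_norm _).trans (le_of_eq ?_))
  congr 1
  funext k
  rw [norm_smul, mul_comm I, norm_exp_ofReal_mul_I, one_mul]

/-- Evaluation at a point. -/
def eval (x : Space d) : Wiener d n →L[ℂ] State n :=
  LinearMap.mkContinuous
    { toFun := fun f => f x
      map_add' := fun _ _ => rfl
      map_smul' := fun _ _ => rfl } 1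
    (fun f => (norm_apply_le f x).trans (le_of_eq (one_mul _).symm))

@[simp]
theorem eval_apply (x : Space d) (f : Wiener d n) : eval x f = f x := rfl

theorem ext_apply {f g : Wiener d n} (h : ∀ x, f x = g x) : f = g := Subtype.ext (funext h)

theorem add_apply' (f g : Wiener d n) (x : Space d) : (f + g) x = f x + g x := rfl

theorem smul_apply' (c : ℂ) (f : Wiener d n) (x : Space d) : (c • f) x = c • f x := rfl

/-- The Fourier multiplier with a bounded symbol. -/
def mul (m : BddSymbol d (State n) (State n)) : Wiener d n →L[ℂ] Wiener d n :=
  (fourierIso.symm.toContinuousLinearEquiv.toContinuousLinearMap ∘L m.mulL1)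
    ∘L fourierIso.toContinuousLinearEquiv.toContinuousLinearMap

theorem fourier_mul (m : BddSymbol d (State n) (State n)) (f : Wiener d n) :
    (mul m f).fourier = m.mulL1 f.fourier :=
  (fourierIso (d := d) (n := n)).apply_symm_apply _

theorem coeFn_fourier_mul (m : BddSymbol d (State n) (State n)) (f : Wiener d n) :
    ((mul m f).fourier : Space d → State n) =ᵐ[volume] fun k => m.toFun k (f.fourier k) := by
  rw [fourier_mul]
  exact m.coeFn_mulL1 _

theorem norm_mul_le (m : BddSymbol d (State n) (State n)) {c : ℝ} (hc : ∀ k, ‖m.toFun k‖ ≤ c)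
    (f : Wiener d n) : ‖mul m f‖ ≤ c * ‖f‖ := by
  change ‖(mul m f).fourier‖ ≤ c * ‖f.fourier‖
  rw [fourier_mul]
  exact m.norm_mulL1_le hc _

theorem norm_mul_eq (m : BddSymbol d (State n) (State n)) (hm : ∀ k v, ‖m.toFun k v‖ = ‖v‖)
    (f : Wiener d n) : ‖mul m f‖ = ‖f‖ := by
  change ‖(mul m f).fourier‖ = ‖f.fourier‖
  rw [fourier_mul]
  exact m.norm_mulL1_eq hm _

theorem tendsto_mul {ι : Type*} {l : Filter ι} [l.IsCountablyGenerated]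
    {m : ι → BddSymbol d (State n) (State n)} {m₀ : BddSymbol d (State n) (State n)} {c : ℝ}
    (hc : ∀ᶠ i in l, ∀ k, ‖(m i).toFun k‖ ≤ c)
    (hm : ∀ k, Tendsto (fun i => (m i).toFun k) l (𝓝 (m₀.toFun k))) (f : Wiener d n) :
    Tendsto (fun i => mul (m i) f) l (𝓝 (mul m₀ f)) :=
  (fourierIso (d := d) (n := n)).symm.continuous.continuousAt.tendsto.comp
    (BddSymbol.tendsto_mulL1 hc hm f.fourier)

theorem mul_mul_congr {m₁ m₂ m₃ m₄ : BddSymbol d (State n) (State n)}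
    (h : ∀ k v, m₁.toFun k (m₂.toFun k v) = m₃.toFun k (m₄.toFun k v)) (f : Wiener d n) :
    mul m₁ (mul m₂ f) = mul m₃ (mul m₄ f) := by
  apply ext_fourier
  filter_upwards [coeFn_fourier_mul m₁ (mul m₂ f), coeFn_fourier_mul m₂ f,
    coeFn_fourier_mul m₃ (mul m₄ f), coeFn_fourier_mul m₄ f] with k h1 h2 h3 h4
  rw [h1, h2, h3, h4, h]

theorem mul_mul_eq {m₁ m₂ m₃ : BddSymbol d (State n) (State n)}
    (h : ∀ k v, m₁.toFun k (m₂.toFun k v) = m₃.toFun k v) (f : Wiener d n) :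
    mul m₁ (mul m₂ f) = mul m₃ f := by
  apply ext_fourier
  filter_upwards [coeFn_fourier_mul m₁ (mul m₂ f), coeFn_fourier_mul m₂ f,
    coeFn_fourier_mul m₃ f] with k h1 h2 h3
  rw [h1, h2, h3, h]

theorem mul_eq_self {m : BddSymbol d (State n) (State n)} (h : ∀ k v, m.toFun k v = v)
    (f : Wiener d n) : mul m f = f := by
  apply ext_fourier
  filter_upwards [coeFn_fourier_mul m f] with k h1
  rw [h1, h]

/-- Multipliers are linear in the symbol. -/
theorem mul_eq_smul_add_smul {m m₁ m₂ : BddSymbol d (State n) (State n)} {a b : ℂ}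
    (h : ∀ k, m.toFun k = a • m₁.toFun k + b • m₂.toFun k) (f : Wiener d n) :
    mul m f = a • mul m₁ f + b • mul m₂ f := by
  apply ext_fourier
  filter_upwards [coeFn_fourier_mul m f, coeFn_fourier_mul m₁ f, coeFn_fourier_mul m₂ f,
    coeFn_fourier_add (a • mul m₁ f) (b • mul m₂ f), coeFn_fourier_smul a (mul m₁ f),
    coeFn_fourier_smul b (mul m₂ f)] with k h1 h2 h3 h4 h5 h6
  rw [h1, h4, h5, h6, h2, h3, h]
  rfl

end Wiener

end Multipliers

/-! ### The weight and the unitary groups generated by first-order symbols. -/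

section WaveGroups

set_option maxSynthPendingDepth 3

open Set Filter Topology

/-! ### The weight and the smoothing operator -/

/-- The submultiplicative weight `1 + |k|₁`. -/
def weight {d : ℕ} (k : Space d) : ℝ := 1 + ∑ ℓ, |k ℓ|

section Weight

variable {d : ℕ}

theorem one_le_weight (k : Space d) : 1 ≤ weight k :=
  le_add_of_nonneg_right (Finset.sum_nonneg fun _ _ => abs_nonneg _)

theorem weight_pos (k : Space d) : 0 < weight k := zero_lt_one.trans_le (one_le_weight k)

theorem weight_ne_zero (k : Space d) : (weight k : ℂ) ≠ 0 := by
  exact_mod_cast (weight_pos k).ne'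

theorem abs_le_weight (k : Space d) (ℓ : Fin d) : |k ℓ| ≤ weight k :=
  (Finset.single_le_sum (f := fun ℓ => |k ℓ|) (fun _ _ => abs_nonneg _)
    (Finset.mem_univ ℓ)).trans (le_add_of_nonneg_left zero_le_one)

theorem continuous_weight : Continuous (weight : Space d → ℝ) := by
  unfold weight
  fun_prop

/-- From `1 + a + b ≤ (1 + a)(1 + b)`. This inequality makes the weighted `L¹` spaces convolution
algebras. -/
theorem weight_add_le (k k' : Space d) : weight (k + k') ≤ weight k * weight k' := by
  have h1 : ∑ ℓ, |(k + k') ℓ| ≤ ∑ ℓ, |k ℓ| + ∑ ℓ, |k' ℓ| := by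
    rw [← Finset.sum_add_distrib]
    exact Finset.sum_le_sum fun ℓ _ => abs_add_le _ _
  have h2 : 0 ≤ ∑ ℓ, |k ℓ| := Finset.sum_nonneg fun _ _ => abs_nonneg _
  have h3 : 0 ≤ ∑ ℓ, |k' ℓ| := Finset.sum_nonneg fun _ _ => abs_nonneg _
  unfold weight
  nlinarith

/-- A bounded scalar symbol. -/
def scalarSymbol (E : Type*) [NormedAddCommGroup E] [NormedSpace ℂ E] (φ : Space d → ℂ)
    (hφ : AEStronglyMeasurable φ volume) (hb : ∃ c, ∀ k, ‖φ k‖ ≤ c) : BddSymbol d E E where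
  toFun k := φ k • ContinuousLinearMap.id ℂ E
  aestronglyMeasurable := hφ.smul_const _
  bounded := by
    obtain ⟨c, hc⟩ := hb
    refine ⟨c, fun k => ?_⟩
    rw [norm_smul]
    exact (mul_le_of_le_one_right (norm_nonneg _) ContinuousLinearMap.norm_id_le).trans (hc k)

theorem continuous_inv_weight : Continuous fun k : Space d => ((weight k)⁻¹ : ℂ) :=
  (continuous_ofReal.comp continuous_weight).inv₀ weight_ne_zero

theorem norm_inv_weight_le (k : Space d) : ‖((weight k)⁻¹ : ℂ)‖ ≤ 1 := by
  rw [norm_inv, norm_real, Real.norm_of_nonneg (weight_pos k).le]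
  exact inv_le_one_of_one_le₀ (one_le_weight k)

/-- The symbol `1 / weight`. -/
def smoothingSymbol (d : ℕ) (E : Type*) [NormedAddCommGroup E] [NormedSpace ℂ E] :
    BddSymbol d E E :=
  scalarSymbol E (fun k => ((weight k)⁻¹ : ℂ)) continuous_inv_weight.aestronglyMeasurable
    ⟨1, norm_inv_weight_le⟩

theorem smoothingSymbol_apply {E : Type*} [NormedAddCommGroup E] [NormedSpace ℂ E] (k : Space d)
    (v : E) : (smoothingSymbol d E).toFun k v = ((weight k)⁻¹ : ℂ) • v := rfl

end Weight

namespace Wiener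

variable {d n : ℕ}

/-- The smoothing operator. -/
def smoothing (d n : ℕ) : Wiener d n →L[ℂ] Wiener d n := mul (smoothingSymbol d (State n))

theorem coeFn_fourier_smoothing (f : Wiener d n) :
    ((smoothing d n f).fourier : Space d → State n) =ᵐ[volume]
      fun k => ((weight k)⁻¹ : ℂ) • f.fourier k :=
  coeFn_fourier_mul _ f

theorem norm_smoothing_le (f : Wiener d n) : ‖smoothing d n f‖ ≤ ‖f‖ := by
  have h : ∀ k, ‖(smoothingSymbol d (State n)).toFun k‖ ≤ 1 := fun k => by
    change ‖((weight k)⁻¹ : ℂ) • ContinuousLinearMap.id ℂ (State n)‖ ≤ 1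
    rw [norm_smul]
    exact mul_le_one₀ (norm_inv_weight_le k) (norm_nonneg _) ContinuousLinearMap.norm_id_le
  exact (norm_mul_le _ h f).trans (le_of_eq (one_mul _))

/-- The weight is finite everywhere. Identities may therefore be verified after smoothing, where
pointwise formulas are available. -/
theorem smoothing_injective : Function.Injective (smoothing d n) := by
  intro f g h
  apply ext_fourier
  filter_upwards [coeFn_fourier_smoothing f, coeFn_fourier_smoothing g] with k h1 h2
  rw [h, h2] at h1
  exact (smul_right_injective _ (inv_ne_zero (weight_ne_zero k)) h1).symm

end Wiener

/-! ### Groups of Fourier multipliers -/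

/-- Continuous symbols of skew-adjoint operators of first order. -/
structure WaveSymbol (d n : ℕ) where
  /-- The symbol. -/
  D : Space d → State n →L[ℂ] State n
  continuous_D : Continuous D
  skew : ∀ k, D k ∈ skewAdjoint (State n →L[ℂ] State n)
  growth : ∃ c, ∀ k, ‖D k‖ ≤ c * weight k

namespace WaveSymbol

variable {d n : ℕ} (g : WaveSymbol d n)

instance : NormedAlgebra ℚ (State n →L[ℂ] State n) := NormedAlgebra.restrictScalars ℚ ℂ _

/-- The exponential of the symbol. -/
def expD (t : ℝ) (k : Space d) : State n →L[ℂ] State n := NormedSpace.exp ((t : ℂ) • g.D k)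

theorem continuous_expD (t : ℝ) : Continuous (g.expD t) := by
  have h : Continuous fun k => (t : ℂ) • g.D k := g.continuous_D.const_smul (t : ℂ)
  exact NormedSpace.exp_continuous.comp h

theorem continuous_expD_left (k : Space d) : Continuous fun t => g.expD t k := by
  have h : Continuous fun t : ℝ => (t : ℂ) • g.D k := continuous_ofReal.smul continuous_const
  exact NormedSpace.exp_continuous.comp h

/-- The exponential of a skew-adjoint operator is unitary. -/
theorem norm_expD_apply (t : ℝ) (k : Space d) (v : State n) : ‖g.expD t k v‖ = ‖v‖ := by
  have h := skewAdjoint.mem_iff.1 (g.skew k)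
  have h' : (t : ℂ) • g.D k ∈ skewAdjoint (State n →L[ℂ] State n) := by
    rw [skewAdjoint.mem_iff, star_smul, h, smul_neg]
    simp
  have hu : g.expD t k ∈ unitary (State n →L[ℂ] State n) :=
    NormedSpace.exp_mem_unitary_of_mem_skewAdjoint h'
  exact ContinuousLinearMap.norm_map_of_mem_unitary hu v

theorem norm_expD_le (t : ℝ) (k : Space d) : ‖g.expD t k‖ ≤ 1 :=
  ContinuousLinearMap.opNorm_le_bound _ zero_le_one fun v => by rw [g.norm_expD_apply, one_mul]

theorem expD_zero (k : Space d) (v : State n) : g.expD 0 k v = v := by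
  simp [expD]

theorem expD_add (s t : ℝ) (k : Space d) (v : State n) :
    g.expD (s + t) k v = g.expD s k (g.expD t k v) := by
  rw [expD, ofReal_add, add_smul, NormedSpace.exp_add_of_commute]
  · rfl
  · exact ((Commute.refl (g.D k)).smul_left _).smul_right _

theorem expD_D (t : ℝ) (k : Space d) (v : State n) :
    g.expD t k (g.D k v) = g.D k (g.expD t k v) := by
  have h : Commute (g.D k) (g.expD t k) :=
    ((Commute.refl (g.D k)).smul_right _).exp_right
  exact (DFunLike.congr_fun h.eq v).symm

/-- Mean value inequality: the derivative `exp(u D) D` has norm at most `‖D‖` for real `u`. This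
bound dominates the difference quotients by the weight. -/
theorem norm_expD_sub_le (s t : ℝ) (k : Space d) :
    ‖g.expD s k - g.expD t k‖ ≤ ‖g.D k‖ * |s - t| := by
  -- The parameter is complex here, so the inequality is applied on the convex set of real points,
  -- the only place where the exponential is unitary.
  have h := Convex.norm_image_sub_le_of_norm_hasDerivWithin_le (𝕜 := ℂ)
    (f := fun u : ℂ => NormedSpace.exp (u • g.D k))
    (f' := fun u : ℂ => NormedSpace.exp (u • g.D k) * g.D k) (s := {u : ℂ | u.im = 0})
    (x := (t : ℂ)) (y := (s : ℂ)) (C := ‖g.D k‖)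
    (fun u _ => (hasDerivAt_exp_smul_const (g.D k) u).hasDerivWithinAt) ?_ ?_ ?_ ?_
  · rw [← ofReal_sub, norm_real, Real.norm_eq_abs] at h
    exact h
  · intro u hu
    have hu' : u = (u.re : ℂ) := Complex.ext rfl hu
    rw [hu']
    exact (norm_mul_le _ _).trans (mul_le_of_le_one_left (norm_nonneg _) (g.norm_expD_le _ k))
  · intro a ha b hb p q _ _ _
    simp only [mem_ofPred_eq] at ha hb ⊢
    simp [ha, hb]
  · simp
  · simp

theorem tendsto_slope_expD (t : ℝ) (k : Space d) :
    Tendsto (fun s : ℝ => ((s : ℂ) - t)⁻¹ • (g.expD s k - g.expD t k)) (𝓝[≠] t)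
      (𝓝 (g.expD t k * g.D k)) := by
  have h := hasDerivAt_iff_tendsto_slope.1 (hasDerivAt_exp_smul_const (g.D k) (t : ℂ))
  have h2 : Tendsto (fun s : ℝ => (s : ℂ)) (𝓝[≠] t) (𝓝[≠] (t : ℂ)) := by
    refine tendsto_nhdsWithin_iff.2 ⟨(continuous_ofReal.tendsto t).mono_left nhdsWithin_le_nhds, ?_⟩
    filter_upwards [self_mem_nhdsWithin] with s hs
    exact fun h => hs (ofReal_injective h)
  exact h.comp h2

theorem expD_eq (t : ℝ) (k : Space d) : g.expD t k = NormedSpace.exp ((t : ℂ) • g.D k) := rfl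

attribute [irreducible] expD

/-- The symbol of the group. -/
def expSymbol (t : ℝ) : BddSymbol d (State n) (State n) where
  toFun := g.expD t
  aestronglyMeasurable := (g.continuous_expD t).aestronglyMeasurable
  bounded := ⟨1, g.norm_expD_le t⟩

theorem norm_inv_weight_smul_le {c : ℝ} (hc : ∀ k, ‖g.D k‖ ≤ c * weight k) (k : Space d) :
    ‖((weight k)⁻¹ : ℂ) • g.D k‖ ≤ c := by
  rw [norm_smul, norm_inv, norm_real, Real.norm_of_nonneg (weight_pos k).le,
    inv_mul_le_iff₀ (weight_pos k), mul_comm]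
  exact hc k

/-- The symbol of the generator, divided by the weight. -/
def genSymbol : BddSymbol d (State n) (State n) where
  toFun k := ((weight k)⁻¹ : ℂ) • g.D k
  aestronglyMeasurable := (continuous_inv_weight.smul g.continuous_D).aestronglyMeasurable
  bounded := by
    obtain ⟨c, hc⟩ := g.growth
    exact ⟨c, g.norm_inv_weight_smul_le hc⟩

/-- The difference quotients of the group, divided by the weight. -/
def slopeSymbol (t s : ℝ) : BddSymbol d (State n) (State n) where
  toFun k := ((weight k)⁻¹ : ℂ) • ((s : ℂ) - t)⁻¹ • (g.expD s k - g.expD t k)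
  aestronglyMeasurable := by
    have h : Continuous fun k => g.expD s k - g.expD t k :=
      (g.continuous_expD s).sub (g.continuous_expD t)
    have h' : Continuous fun k => ((s : ℂ) - t)⁻¹ • (g.expD s k - g.expD t k) :=
      h.const_smul (((s : ℂ) - t)⁻¹)
    exact (continuous_inv_weight.smul h').aestronglyMeasurable
  bounded := by
    refine ⟨‖((s : ℂ) - t)⁻¹‖ * 2, fun k => ?_⟩
    rw [norm_smul]
    refine (mul_le_of_le_one_left (norm_nonneg _) (norm_inv_weight_le k)).trans ?_
    rw [norm_smul]
    gcongr
    exact (norm_sub_le _ _).trans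
      ((add_le_add (g.norm_expD_le s k) (g.norm_expD_le t k)).trans (by norm_num))

/-- The derivative of the group, divided by the weight. -/
def derivSymbol (t : ℝ) : BddSymbol d (State n) (State n) where
  toFun k := ((weight k)⁻¹ : ℂ) • (g.expD t k * g.D k)
  aestronglyMeasurable := (continuous_inv_weight.smul ((g.continuous_expD t).mul
    g.continuous_D)).aestronglyMeasurable
  bounded := by
    obtain ⟨c, hc⟩ := g.growth
    refine ⟨c, fun k => ?_⟩
    rw [← mul_smul_comm]
    exact (norm_mul_le _ _).trans ((mul_le_of_le_one_left (norm_nonneg _)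
      (g.norm_expD_le t k)).trans (g.norm_inv_weight_smul_le hc k))

/-- The group with a given symbol. -/
def group : RegularGroup ((Wiener.smoothing d n).restrictScalars ℝ) where
  U t := (Wiener.mul (g.expSymbol t)).restrictScalars ℝ
  gen := (Wiener.mul g.genSymbol).restrictScalars ℝ
  U_zero f := Wiener.mul_eq_self g.expD_zero f
  U_add s t f := (Wiener.mul_mul_eq (fun k v => (g.expD_add s t k v).symm) f).symm
  norm_U t f := Wiener.norm_mul_eq (g.expSymbol t) (g.norm_expD_apply t) f
  continuous_U f := by
    refine continuous_iff_continuousAt.2 fun t => Wiener.tendsto_mul (c := 1)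
      (m := g.expSymbol) (m₀ := g.expSymbol t)
      (Eventually.of_forall fun s k => g.norm_expD_le s k)
      (fun k => (g.continuous_expD_left k).tendsto t) f
  U_J t f := Wiener.mul_mul_congr (fun k v => (g.expD t k).map_smul _ _) f
  U_gen t f := Wiener.mul_mul_congr (fun k v => by
    change g.expD t k (((weight k)⁻¹ : ℂ) • g.D k v) = ((weight k)⁻¹ : ℂ) • g.D k (g.expD t k v)
    rw [map_smul, g.expD_D]) f
  gen_J f := Wiener.mul_mul_congr (fun k v => by
    change ((weight k)⁻¹ : ℂ) • g.D k (((weight k)⁻¹ : ℂ) • v)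
      = ((weight k)⁻¹ : ℂ) • ((weight k)⁻¹ : ℂ) • g.D k v
    rw [map_smul]) f
  hasDerivAt f t := by
    rw [hasDerivAt_iff_tendsto_slope]
    obtain ⟨c, hc⟩ := g.growth
    -- After division by the weight the difference quotients are bounded by the growth constant `c`,
    -- uniformly in `s ≠ t`, and converge at every frequency; hence the orbits of smoothed functions
    -- are differentiable in `W`.
    have h1 : Tendsto (fun s => Wiener.mul (g.slopeSymbol t s) f) (𝓝[≠] t)
        (𝓝 (Wiener.mul (g.derivSymbol t) f)) := by
      refine Wiener.tendsto_mul (c := c) (m := g.slopeSymbol t) (m₀ := g.derivSymbol t) ?_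
        (fun k => (g.tendsto_slope_expD t k).const_smul _) f
      filter_upwards [self_mem_nhdsWithin] with s hs k
      have hs' : 0 < |s - t| := abs_pos.2 (sub_ne_zero.2 hs)
      change ‖((weight k)⁻¹ : ℂ) • ((s : ℂ) - t)⁻¹ • (g.expD s k - g.expD t k)‖ ≤ c
      rw [norm_smul, norm_smul, norm_inv, norm_inv, ← ofReal_sub, norm_real, norm_real,
        Real.norm_eq_abs, Real.norm_eq_abs, abs_of_pos (weight_pos k),
        inv_mul_le_iff₀ (weight_pos k), inv_mul_le_iff₀ hs', mul_comm (weight k)]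
      refine (g.norm_expD_sub_le s t k).trans ?_
      rw [mul_comm]
      exact mul_le_mul_of_nonneg_left (hc k) hs'.le
    have h2 : Wiener.mul (g.derivSymbol t) f
        = Wiener.mul (g.expSymbol t) (Wiener.mul g.genSymbol f) :=
      (Wiener.mul_mul_eq (fun k v => (g.expD t k).map_smul _ _) f).symm
    change Tendsto _ _ (𝓝 (Wiener.mul (g.expSymbol t) (Wiener.mul g.genSymbol f)))
    rw [← h2]
    refine h1.congr fun s => ?_
    have e1 : ∀ r, Wiener.mul (g.expSymbol r) (Wiener.smoothing d n f)
        = Wiener.smoothing d n (Wiener.mul (g.expSymbol r) f) := fun r =>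
      Wiener.mul_mul_congr (fun k v => (g.expD r k).map_smul _ _) f
    change _ = (s - t)⁻¹ • (Wiener.mul (g.expSymbol s) (Wiener.smoothing d n f)
      - Wiener.mul (g.expSymbol t) (Wiener.smoothing d n f))
    rw [e1, e1, ← map_sub]
    have e2 : ((s - t)⁻¹ : ℝ) • Wiener.smoothing d n
        (Wiener.mul (g.expSymbol s) f - Wiener.mul (g.expSymbol t) f)
        = Wiener.smoothing d n (((s : ℂ) - t)⁻¹ • Wiener.mul (g.expSymbol s) f
          + (-((s : ℂ) - t)⁻¹) • Wiener.mul (g.expSymbol t) f) := by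
      rw [neg_smul, ← sub_eq_add_neg, ← smul_sub, map_smul, ← ofReal_sub, ← ofReal_inv]
      rfl
    rw [e2]
    apply Wiener.ext_fourier
    filter_upwards [Wiener.coeFn_fourier_mul (g.slopeSymbol t s) f,
      Wiener.coeFn_fourier_smoothing (((s : ℂ) - t)⁻¹ • Wiener.mul (g.expSymbol s) f
          + (-((s : ℂ) - t)⁻¹) • Wiener.mul (g.expSymbol t) f),
      Wiener.coeFn_fourier_add (((s : ℂ) - t)⁻¹ • Wiener.mul (g.expSymbol s) f)
        ((-((s : ℂ) - t)⁻¹) • Wiener.mul (g.expSymbol t) f),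
      Wiener.coeFn_fourier_smul (((s : ℂ) - t)⁻¹) (Wiener.mul (g.expSymbol s) f),
      Wiener.coeFn_fourier_smul (-((s : ℂ) - t)⁻¹) (Wiener.mul (g.expSymbol t) f),
      Wiener.coeFn_fourier_mul (g.expSymbol s) f,
      Wiener.coeFn_fourier_mul (g.expSymbol t) f] with k h1 h2 h3 h4 h5 h6 h7
    rw [h1, h2, h3, h4, h5, h6, h7]
    change ((weight k)⁻¹ : ℂ) • ((s : ℂ) - t)⁻¹ • (g.expD s k (f.fourier k)
      - g.expD t k (f.fourier k)) = ((weight k)⁻¹ : ℂ) • (((s : ℂ) - t)⁻¹ • g.expD s k (f.fourier k)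
      + (-((s : ℂ) - t)⁻¹) • g.expD t k (f.fourier k))
    rw [smul_sub, neg_smul, sub_eq_add_neg]

end WaveSymbol

end WaveGroups

/-! ### Convolutions that lift bilinear maps through powers of `J`. -/

section WeightedConvolution

set_option maxSynthPendingDepth 3

open Set Filter Topology
open scoped Convolution

variable {d : ℕ} {E F G : Type*} [NormedAddCommGroup E] [NormedSpace ℂ E]
  [NormedAddCommGroup F] [NormedSpace ℂ F] [NormedAddCommGroup G] [NormedSpace ℂ G]

/-- Division by the `s`-th power of the weight. -/
def unweight (s : ℕ) (f : Space d → E) (k : Space d) : E := ((weight k : ℂ) ^ s)⁻¹ • f k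

theorem continuous_weight_pow (s : ℕ) : Continuous fun k : Space d => (weight k : ℂ) ^ s :=
  (continuous_ofReal.comp continuous_weight).pow s

theorem norm_weight_pow (s : ℕ) (k : Space d) : ‖(weight k : ℂ) ^ s‖ = weight k ^ s := by
  rw [norm_pow, norm_real, Real.norm_of_nonneg (weight_pos k).le]

theorem integrable_unweight (s : ℕ) {f : Space d → E} (hf : Integrable f) :
    Integrable (unweight s f) := by
  refine hf.mono (((continuous_weight_pow s).inv₀
    fun k => pow_ne_zero _ (weight_ne_zero k)).aestronglyMeasurable.smul hf.1)
    (ae_of_all _ fun k => ?_)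
  rw [unweight, norm_smul, norm_inv, norm_weight_pow]
  exact mul_le_of_le_one_left (norm_nonneg _)
    (inv_le_one_of_one_le₀ (one_le_pow₀ (one_le_weight k)))

/-- The convolution of functions that are divided by the `s`-th power of the weight, multiplied
with the `s`-th power of the weight. -/
def wconvFun (s : ℕ) (b : E →L[ℂ] F →L[ℂ] G) (f : Space d → E) (g : Space d → F) (k : Space d) :
    G :=
  ((weight k : ℂ) ^ s) • (unweight s f ⋆[b, volume] unweight s g) k

theorem wconvFun_congr (s : ℕ) (b : E →L[ℂ] F →L[ℂ] G) {f f' : Space d → E} {g g' : Space d → F}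
    (hf : f =ᵐ[volume] f') (hg : g =ᵐ[volume] g') : wconvFun s b f g = wconvFun s b f' g' := by
  funext k
  have h1 : unweight s f =ᵐ[volume] unweight s f' := by
    filter_upwards [hf] with t ht
    rw [unweight, unweight, ht]
  have h2 : unweight s g =ᵐ[volume] unweight s g' := by
    filter_upwards [hg] with t ht
    rw [unweight, unweight, ht]
  rw [wconvFun, wconvFun, convolution_congr b h1 h2]

/-- Submultiplicativity gives `w(k)^s ≤ w(t)^s w(k - t)^s`, which absorbs the weights in the
denominators. The estimate is then that of an ordinary convolution, with a constant independent of
`s`. -/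
theorem norm_wconvFun_le (s : ℕ) (b : E →L[ℂ] F →L[ℂ] G) {f : Space d → E} {g : Space d → F}
    (hf : Integrable f) (hg : Integrable g) :
    ∀ᵐ k, ‖wconvFun s b f g k‖ ≤ ‖b‖ * ((fun k => ‖f k‖) ⋆[ContinuousLinearMap.mul ℝ ℝ, volume]
      (fun k => ‖g k‖)) k := by
  filter_upwards [hf.norm.ae_convolution_exists (ContinuousLinearMap.mul ℝ ℝ) hg.norm] with k hk
  rw [wconvFun, convolution_def, convolution_def, ← integral_smul, ← integral_const_mul]
  refine norm_integral_le_of_norm_le (hk.const_mul _) (ae_of_all _ fun t => ?_)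
  rw [norm_smul, norm_weight_pow, ContinuousLinearMap.mul_apply']
  have hw : weight k ^ s ≤ weight t ^ s * weight (k - t) ^ s := by
    rw [← mul_pow]
    refine pow_le_pow_left₀ (weight_pos k).le ?_ s
    simpa using weight_add_le t (k - t)
  have hb := b.le_opNorm₂ (unweight s f t) (unweight s g (k - t))
  have hf' : ‖unweight s f t‖ = (weight t ^ s)⁻¹ * ‖f t‖ := by
    rw [unweight, norm_smul, norm_inv, norm_weight_pow]
  have hg' : ‖unweight s g (k - t)‖ = (weight (k - t) ^ s)⁻¹ * ‖g (k - t)‖ := by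
    rw [unweight, norm_smul, norm_inv, norm_weight_pow]
  rw [hf', hg'] at hb
  have p1 : 0 < weight t ^ s := pow_pos (weight_pos t) s
  have p2 : 0 < weight (k - t) ^ s := pow_pos (weight_pos _) s
  calc weight k ^ s * ‖b (unweight s f t) (unweight s g (k - t))‖
      ≤ (weight t ^ s * weight (k - t) ^ s) *
        (‖b‖ * ((weight t ^ s)⁻¹ * ‖f t‖) * ((weight (k - t) ^ s)⁻¹ * ‖g (k - t)‖)) := by
        gcongr
    _ = ‖b‖ * (‖f t‖ * ‖g (k - t)‖) := by field_simp

theorem integrable_wconvFun (s : ℕ) (b : E →L[ℂ] F →L[ℂ] G) {f : Space d → E} {g : Space d → F}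
    (hf : Integrable f) (hg : Integrable g) : Integrable (wconvFun s b f g) := by
  refine ((hf.norm.integrable_convolution (ContinuousLinearMap.mul ℝ ℝ) hg.norm).const_mul
    ‖b‖).mono' ?_ (norm_wconvFun_le s b hf hg)
  exact (continuous_weight_pow s).aestronglyMeasurable.smul
    ((integrable_unweight s hf).integrable_convolution b (integrable_unweight s hg)).1

theorem unweight_add (s : ℕ) (f g : Space d → E) :
    unweight s (f + g) = unweight s f + unweight s g := by
  funext k
  simp [unweight]

theorem unweight_smul (s : ℕ) (c : ℂ) (f : Space d → E) :
    unweight s (c • f) = c • unweight s f := by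
  funext k
  simp only [unweight, Pi.smul_apply]
  rw [smul_comm]

/-- The weighted convolution as a bilinear map on `L¹`. -/
def wconv (s : ℕ) (b : E →L[ℂ] F →L[ℂ] G) :
    Lp E 1 (volume : Measure (Space d)) →L[ℂ] Lp F 1 (volume : Measure (Space d)) →L[ℂ]
      Lp G 1 (volume : Measure (Space d)) :=
  LinearMap.mkContinuous₂
    (LinearMap.mk₂ ℂ (fun f g => (integrable_wconvFun s b (L1.integrable_coeFn f)
        (L1.integrable_coeFn g)).toL1 _)
      (fun f f' g => by
        rw [← Integrable.toL1_add]
        refine (Integrable.toL1_eq_toL1_iff _ _ _ _).2 ?_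
        rw [wconvFun_congr s b (Lp.coeFn_add f f') (ae_eq_refl _)]
        filter_upwards [(integrable_unweight s (L1.integrable_coeFn f)).ae_convolution_exists b
          (integrable_unweight s (L1.integrable_coeFn g)),
          (integrable_unweight s (L1.integrable_coeFn f')).ae_convolution_exists b
          (integrable_unweight s (L1.integrable_coeFn g))] with k h1 h2
        rw [Pi.add_apply, wconvFun, wconvFun, wconvFun, unweight_add, h1.add_distrib h2, smul_add])
      (fun c f g => by
        rw [← Integrable.toL1_smul]
        refine (Integrable.toL1_eq_toL1_iff _ _ _ _).2 ?_
        rw [wconvFun_congr s b (Lp.coeFn_smul c f) (ae_eq_refl _)]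
        refine ae_of_all _ fun k => ?_
        change wconvFun s b _ _ k = c • wconvFun s b _ _ k
        rw [wconvFun, wconvFun, unweight_smul, smul_convolution, Pi.smul_apply, smul_comm])
      (fun f g g' => by
        rw [← Integrable.toL1_add]
        refine (Integrable.toL1_eq_toL1_iff _ _ _ _).2 ?_
        rw [wconvFun_congr s b (ae_eq_refl _) (Lp.coeFn_add g g')]
        filter_upwards [(integrable_unweight s (L1.integrable_coeFn f)).ae_convolution_exists b
          (integrable_unweight s (L1.integrable_coeFn g)),
          (integrable_unweight s (L1.integrable_coeFn f)).ae_convolution_exists b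
          (integrable_unweight s (L1.integrable_coeFn g'))] with k h1 h2
        rw [Pi.add_apply, wconvFun, wconvFun, wconvFun, unweight_add, h1.distrib_add h2, smul_add])
      (fun c f g => by
        rw [← Integrable.toL1_smul]
        refine (Integrable.toL1_eq_toL1_iff _ _ _ _).2 ?_
        rw [wconvFun_congr s b (ae_eq_refl _) (Lp.coeFn_smul c g)]
        refine ae_of_all _ fun k => ?_
        change wconvFun s b _ _ k = c • wconvFun s b _ _ k
        rw [wconvFun, wconvFun, unweight_smul, convolution_smul, Pi.smul_apply, smul_comm]))
    ‖b‖ (fun f g => by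
      have hf := L1.integrable_coeFn f
      have hg := L1.integrable_coeFn g
      rw [LinearMap.mk₂_apply, L1.norm_of_fun_eq_integral_norm, L1.norm_eq_integral_norm f,
        L1.norm_eq_integral_norm g, mul_assoc]
      have h := integral_convolution (ContinuousLinearMap.mul ℝ ℝ) hf.norm hg.norm
      rw [ContinuousLinearMap.mul_apply'] at h
      rw [← h, ← integral_const_mul]
      exact integral_mono_ae (integrable_wconvFun s b hf hg).norm
        ((hf.norm.integrable_convolution (ContinuousLinearMap.mul ℝ ℝ) hg.norm).const_mul _)
        (norm_wconvFun_le s b hf hg))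

theorem coeFn_wconv (s : ℕ) (b : E →L[ℂ] F →L[ℂ] G) (f : Lp E 1 (volume : Measure (Space d)))
    (g : Lp F 1 (volume : Measure (Space d))) : wconv s b f g =ᵐ[volume] wconvFun s b f g :=
  (integrable_wconvFun s b (L1.integrable_coeFn f) (L1.integrable_coeFn g)).coeFn_toL1

theorem unweight_smoothing (s : ℕ) (f : Lp E 1 (volume : Measure (Space d))) :
    unweight s ((smoothingSymbol d E).mulL1 f) =ᵐ[volume] unweight (s + 1) f := by
  filter_upwards [(smoothingSymbol d E).coeFn_mulL1 f] with k hk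
  rw [unweight, unweight, hk, smoothingSymbol_apply, smul_smul, pow_succ, mul_inv]

/-- Each application of `J` moves one power of the weight from the outer factor to the arguments. -/
theorem smoothing_wconv (s : ℕ) (b : E →L[ℂ] F →L[ℂ] G) (f : Lp E 1 (volume : Measure (Space d)))
    (g : Lp F 1 (volume : Measure (Space d))) :
    (smoothingSymbol d G).mulL1 (wconv (s + 1) b f g)
      = wconv s b ((smoothingSymbol d E).mulL1 f) ((smoothingSymbol d F).mulL1 g) := by
  refine Lp.ext ?_
  filter_upwards [(smoothingSymbol d G).coeFn_mulL1 (wconv (s + 1) b f g),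
    coeFn_wconv (s + 1) b f g,
    coeFn_wconv s b ((smoothingSymbol d E).mulL1 f) ((smoothingSymbol d F).mulL1 g)]
    with k h1 h2 h3
  rw [h1, h2, h3, smoothingSymbol_apply, wconvFun, wconvFun,
    convolution_congr b (unweight_smoothing s f) (unweight_smoothing s g), smul_smul, pow_succ]
  congr 1
  field_simp [weight_ne_zero k]

theorem unweight_zero (f : Space d → E) : unweight 0 f = f := by
  funext k
  simp [unweight]

theorem fourier_wconv_zero [CompleteSpace E] [CompleteSpace F] [CompleteSpace G]
    (b : E →L[ℂ] F →L[ℂ] G) (f : Lp E 1 (volume : Measure (Space d)))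
    (g : Lp F 1 (volume : Measure (Space d))) (y : Space d) :
    𝓕 (wconv 0 b f g : Space d → G) y = b (𝓕 (f : Space d → E) y) (𝓕 (g : Space d → F) y) := by
  rw [← Real.fourier_bilin_convolution_eq b (L1.integrable_coeFn f) (L1.integrable_coeFn g)]
  have h : (wconv 0 b f g : Space d → G) =ᵐ[volume] (f : Space d → E) ⋆[b, volume] g := by
    filter_upwards [coeFn_wconv 0 b f g] with k hk
    rw [hk, wconvFun, unweight_zero, unweight_zero, pow_zero, one_smul]
  rw [Real.fourier_eq, Real.fourier_eq]
  refine integral_congr_ae ?_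
  filter_upwards [h] with k hk
  rw [hk]

end WeightedConvolution

/-! ### Trilinear maps on the Wiener algebra and their lifts. -/

section Trilinear

set_option maxSynthPendingDepth 3

variable {d n : ℕ}

/-- The constant in the inverse Fourier transform. -/
def fourierConst (d : ℕ) : ℂ := (((2 * π) ^ (-(d : ℝ) / 2) : ℝ) : ℂ)

theorem invFourier_eq_fourier (g : Space d → State n) (x : Space d) :
    invFourier g x = fourierConst d • 𝓕 g (-(2 * π)⁻¹ • x) := by
  rw [invFourier, Real.fourier_eq', fourierConst, Complex.coe_smul]
  congr 2
  funext k
  congr 2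
  rw [inner_smul_right]
  push_cast
  field_simp

/-- The trilinear convolution on `L¹` that corresponds to a trilinear map. -/
def wtriL1 (s : ℕ) (T : State n →L[ℂ] State n →L[ℂ] State n →L[ℂ] State n) :
    Lp (State n) 1 (volume : Measure (Space d)) →L[ℂ] Lp (State n) 1 (volume : Measure (Space d))
      →L[ℂ] Lp (State n) 1 (volume : Measure (Space d))
      →L[ℂ] Lp (State n) 1 (volume : Measure (Space d)) :=
  (ContinuousLinearMap.compL ℂ _ _ _ (wconv s (ContinuousLinearMap.id ℂ (State n →L[ℂ] State n))))
    ∘L (wconv s ((fourierConst d ^ 2) • T))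

set_option synthInstance.maxHeartbeats 400000 in
theorem wtriL1_apply (s : ℕ) (T : State n →L[ℂ] State n →L[ℂ] State n →L[ℂ] State n)
    (f g h : Lp (State n) 1 (volume : Measure (Space d))) : wtriL1 s T f g h
      = wconv s (ContinuousLinearMap.id ℂ (State n →L[ℂ] State n))
        (wconv s ((fourierConst d ^ 2) • T) f g) h := rfl

set_option synthInstance.maxHeartbeats 400000 in
theorem smoothing_wtriL1 (s : ℕ) (T : State n →L[ℂ] State n →L[ℂ] State n →L[ℂ] State n)
    (f g h : Lp (State n) 1 (volume : Measure (Space d))) :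
    (smoothingSymbol d (State n)).mulL1 (wtriL1 (s + 1) T f g h)
      = wtriL1 s T ((smoothingSymbol d (State n)).mulL1 f) ((smoothingSymbol d (State n)).mulL1 g)
        ((smoothingSymbol d (State n)).mulL1 h) := by
  have h1 := smoothing_wconv s (ContinuousLinearMap.id ℂ (State n →L[ℂ] State n))
    (wconv (s + 1) ((fourierConst d ^ 2) • T) f g) h
  rw [smoothing_wconv s ((fourierConst d ^ 2) • T) f g] at h1
  exact h1

attribute [irreducible] wtriL1

/-- A complex trilinear map as a real one. -/
def realTrilinear {X : Type*} [NormedAddCommGroup X] [NormedSpace ℂ X]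
    (M : X →L[ℂ] X →L[ℂ] X →L[ℂ] X) : X →L[ℝ] X →L[ℝ] X →L[ℝ] X :=
  (ContinuousLinearMap.compL ℝ X (X →L[ℂ] X) (X →L[ℝ] X)
    (ContinuousLinearMap.restrictScalarsL ℂ X X ℝ ℝ)) ∘L (M.bilinearRestrictScalars ℝ)

namespace Wiener

/-- The action of a trilinear map on `W`, on the range of the `s`-th power of the smoothing
operator. -/
def tri (s : ℕ) (T : State n →L[ℂ] State n →L[ℂ] State n →L[ℂ] State n) :
    Wiener d n →L[ℝ] Wiener d n →L[ℝ] Wiener d n →L[ℝ] Wiener d n :=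
  realTrilinear (triComp fourierIso.symm.toContinuousLinearEquiv.toContinuousLinearMap
    (wtriL1 s T) fourierIso.toContinuousLinearEquiv.toContinuousLinearMap
    fourierIso.toContinuousLinearEquiv.toContinuousLinearMap
    fourierIso.toContinuousLinearEquiv.toContinuousLinearMap)

set_option synthInstance.maxHeartbeats 400000 in
theorem fourier_tri (s : ℕ) (T : State n →L[ℂ] State n →L[ℂ] State n →L[ℂ] State n)
    (f g h : Wiener d n) : (tri s T f g h).fourier = wtriL1 s T f.fourier g.fourier h.fourier :=
  (fourierIso (d := d) (n := n)).apply_symm_apply _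

set_option synthInstance.maxHeartbeats 400000 in
theorem fourier_tri_of_eq (s : ℕ) (T : State n →L[ℂ] State n →L[ℂ] State n →L[ℂ] State n)
    {f g h : Wiener d n} {f' g' h' : Lp (State n) 1 (volume : Measure (Space d))}
    (hf : f.fourier = f') (hg : g.fourier = g') (hh : h.fourier = h') :
    (tri s T f g h).fourier = wtriL1 s T f' g' h' := by
  subst hf hg hh
  exact fourier_tri s T f g h

attribute [irreducible] tri

theorem fourier_injective : Function.Injective (fourier (d := d) (n := n)) := fourierIso.injective

theorem fourier_smoothing (f : Wiener d n) :
    (smoothing d n f).fourier = (smoothingSymbol d (State n)).mulL1 f.fourier :=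
  fourier_mul _ f

theorem smoothing_tri (s : ℕ) (T : State n →L[ℂ] State n →L[ℂ] State n →L[ℂ] State n)
    (f g h : Wiener d n) : smoothing d n (tri (s + 1) T f g h)
      = tri s T (smoothing d n f) (smoothing d n g) (smoothing d n h) := by
  apply fourier_injective
  have h1 := (fourier_smoothing (tri (s + 1) T f g h)).trans
    (congrArg _ (fourier_tri (s + 1) T f g h))
  exact h1.trans ((smoothing_wtriL1 s T f.fourier g.fourier h.fourier).trans
    (fourier_tri_of_eq s T (fourier_smoothing f) (fourier_smoothing g) (fourier_smoothing h)).symm)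

/-- Two applications of the convolution theorem. The product of three inverse transforms carries the
cube of `fourierConst`; one factor belongs to the inverse transform of the result and the other two
are built into `wtriL1`. -/
theorem tri_zero_apply (T : State n →L[ℂ] State n →L[ℂ] State n →L[ℂ] State n)
    (f g h : Wiener d n) (x : Space d) : tri 0 T f g h x = T (f x) (g x) (h x) := by
  rw [apply_eq, apply_eq f, apply_eq g, apply_eq h, fourier_tri, wtriL1_apply,
    invFourier_eq_fourier, invFourier_eq_fourier, invFourier_eq_fourier, invFourier_eq_fourier,
    fourier_wconv_zero, fourier_wconv_zero]
  simp only [ContinuousLinearMap.id_apply, map_smul, smul_apply, smul_smul]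
  congr 1
  ring

theorem smoothing_pow_injective (s : ℕ) : Function.Injective ⇑(smoothing d n ^ s) := by
  induction s with
  | zero => exact fun a b h => h
  | succ s ih =>
    rw [pow_succ]
    exact ih.comp smoothing_injective

theorem smoothing_pow_tri (s : ℕ) (T : State n →L[ℂ] State n →L[ℂ] State n →L[ℂ] State n)
    (f g h : Wiener d n) (x : Space d) : (smoothing d n ^ s) (tri s T f g h) x
      = T ((smoothing d n ^ s) f x) ((smoothing d n ^ s) g x) ((smoothing d n ^ s) h x) := by
  induction s generalizing f g h with
  | zero => exact tri_zero_apply T f g h x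
  | succ s ih =>
    have e : ∀ q : Wiener d n, (smoothing d n ^ (s + 1)) q
        = (smoothing d n ^ s) (smoothing d n q) := fun q => by
      rw [pow_succ]
      rfl
    rw [e, e, e, e, smoothing_tri, ih]

end Wiener

end Trilinear

/-! ### Constant coefficients, modulation and conjugation. -/

section PointwiseOperators

set_option maxSynthPendingDepth 3

open Set Filter Topology

namespace Wiener

variable {d n : ℕ}

theorem ofFourier_apply (g : Space d → State n) (hg : Integrable g) (x : Space d) :
    ofFourier g hg x = invFourier g x := rfl

/-! ### Constant coefficients -/

/-- The pointwise application of a linear map. -/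
def const (M : State n →L[ℂ] State n) : Wiener d n →L[ℂ] Wiener d n :=
  mul { toFun := fun _ => M
        aestronglyMeasurable := aestronglyMeasurable_const
        bounded := ⟨‖M‖, fun _ => le_rfl⟩ }

theorem coeFn_fourier_const (M : State n →L[ℂ] State n) (f : Wiener d n) :
    ((const M f).fourier : Space d → State n) =ᵐ[volume] fun k => M (f.fourier k) :=
  coeFn_fourier_mul _ f

theorem const_apply (M : State n →L[ℂ] State n) (f : Wiener d n) (x : Space d) :
    const M f x = M (f x) := by
  rw [apply_eq, apply_eq f, invFourier_congr (coeFn_fourier_const M f), invFourier, invFourier,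
    ← Complex.coe_smul, ← Complex.coe_smul, map_smul,
    ← M.integral_comp_comm (integrable_phase f.integrable_fourier x)]
  simp only [map_smul]

theorem smoothing_const (M : State n →L[ℂ] State n) (f : Wiener d n) :
    smoothing d n (const M f) = const M (smoothing d n f) :=
  mul_mul_congr (fun k v => (M.map_smul ((weight k)⁻¹ : ℂ) v).symm) f

theorem smoothing_pow_const (s : ℕ) (M : State n →L[ℂ] State n) (f : Wiener d n) :
    (smoothing d n ^ s) (const M f) = const M ((smoothing d n ^ s) f) := by
  induction s generalizing f with
  | zero => rfl
  | succ s ih =>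
    have e : ∀ q : Wiener d n, (smoothing d n ^ (s + 1)) q
        = (smoothing d n ^ s) (smoothing d n q) := fun q => by
      rw [pow_succ]
      rfl
    rw [e, e, smoothing_const, ih]

/-! ### Modulation -/

theorem integrable_translate (q : Space d) (f : Wiener d n) :
    Integrable fun k => (f.fourier : Space d → State n) (k - q) :=
  f.integrable_fourier.comp_sub_right q

/-- A shift of the frequency variable is a modulation in space. -/
theorem ofFourier_translate_apply (q : Space d) (f : Wiener d n) (x : Space d) :
    ofFourier _ (integrable_translate q f) x = cexp (I * ((⟪q, x⟫_ℝ : ℝ) : ℂ)) • f x := by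
  rw [ofFourier_apply, apply_eq f, invFourier, invFourier, smul_comm (cexp _)]
  congr 1
  rw [← integral_smul, ← integral_sub_right_eq_self
    (fun k => cexp (I * ((⟪q, x⟫_ℝ : ℝ) : ℂ)) • cexp (I * ((⟪k, x⟫_ℝ : ℝ) : ℂ)) • f.fourier k) q]
  congr 1
  funext k
  rw [smul_smul, ← Complex.exp_add, ← mul_add, ← ofReal_add, inner_sub_left, add_sub_cancel]

/-- The multiplication with the function `x ↦ exp (i q·x)`. -/
def modulate (q : Space d) : Wiener d n →L[ℂ] Wiener d n :=
  LinearMap.mkContinuous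
    { toFun := fun f => ofFourier _ (integrable_translate q f)
      map_add' := fun f g => ext_apply fun x => by
        rw [add_apply', ofFourier_translate_apply, ofFourier_translate_apply,
          ofFourier_translate_apply, add_apply', smul_add]
      map_smul' := fun c f => ext_apply fun x => by
        rw [RingHom.id_apply, smul_apply', ofFourier_translate_apply, ofFourier_translate_apply,
          smul_apply', smul_comm] } 1
    (fun f => le_of_eq (by
      rw [one_mul, norm_eq_integral, norm_eq_integral,
        ← integral_sub_right_eq_self (fun k => ‖f.fourier k‖) q]
      refine integral_congr_ae ?_
      filter_upwards [fourier_ofFourier _ (integrable_translate q f)] with k hk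
      exact congrArg norm hk))

theorem coeFn_fourier_modulate (q : Space d) (f : Wiener d n) :
    ((modulate q f).fourier : Space d → State n) =ᵐ[volume] fun k => f.fourier (k - q) :=
  fourier_ofFourier _ (integrable_translate q f)

theorem modulate_apply (q : Space d) (f : Wiener d n) (x : Space d) :
    modulate q f x = cexp (I * ((⟪q, x⟫_ℝ : ℝ) : ℂ)) • f x :=
  ofFourier_translate_apply q f x

theorem norm_modulate_le (q : Space d) (f : Wiener d n) : ‖modulate q f‖ ≤ ‖f‖ :=
  (ContinuousLinearMap.le_of_opNorm_le _ (LinearMap.mkContinuous_norm_le _ zero_le_one _) f).trans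
    (one_mul _).le

/-! ### Conjugation -/

/-- Complex conjugation on `ℂ^n` as a real-linear isometry. -/
def conjₗᵢ (n : ℕ) : State n →ₗᵢ[ℝ] State n where
  toFun := conjState
  map_add' v w := by
    ext i
    simp [conjState]
  map_smul' c v := by
    ext i
    simp [conjState]
  norm_map' v := by
    simp [EuclideanSpace.norm_eq, conjState]

theorem conjₗᵢ_apply (v : State n) : conjₗᵢ n v = conjState v := rfl

theorem conjState_smul (c : ℂ) (v : State n) :
    conjState (c • v) = (starRingEnd ℂ) c • conjState v := by
  ext i
  simp [conjState]

theorem conjState_conjState (v : State n) : conjState (conjState v) = v := by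
  ext i
  simp [conjState]

theorem integrable_conj (f : Wiener d n) :
    Integrable fun k => conjState ((f.fourier : Space d → State n) (-k)) :=
  (conjₗᵢ n).toContinuousLinearMap.integrable_comp f.integrable_fourier.comp_neg

/-- Conjugation reverses the sign of the phase, which the substitution `k ↦ -k` restores. -/
theorem ofFourier_conj_apply (f : Wiener d n) (x : Space d) :
    ofFourier _ (integrable_conj f) x = conjState (f x) := by
  rw [ofFourier_apply, apply_eq f, invFourier, invFourier, ← conjₗᵢ_apply, map_smul]
  congr 1
  have h := (conjₗᵢ n).toContinuousLinearMap.integral_comp_comm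
    (integrable_phase f.integrable_fourier x)
  refine Eq.trans ?_ h
  rw [← integral_neg_eq_self]
  congr 1
  funext k
  change _ = conjState _
  rw [conjState_smul, ← Complex.exp_conj, neg_neg, inner_neg_left]
  simp

/-- The pointwise complex conjugation. -/
def conj (d n : ℕ) : Wiener d n →L[ℝ] Wiener d n :=
  LinearMap.mkContinuous
    { toFun := fun f => ofFourier _ (integrable_conj f)
      map_add' := fun f g => ext_apply fun x => by
        rw [add_apply', ofFourier_conj_apply, ofFourier_conj_apply, ofFourier_conj_apply,
          add_apply']
        exact (conjₗᵢ n).map_add _ _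
      map_smul' := fun c f => ext_apply fun x => by
        rw [RingHom.id_apply, ← Complex.coe_smul, ← Complex.coe_smul, smul_apply',
          ofFourier_conj_apply, ofFourier_conj_apply, smul_apply', conjState_smul, conj_ofReal] } 1
    (fun f => le_of_eq (by
      rw [one_mul, norm_eq_integral, norm_eq_integral,
        ← integral_neg_eq_self (fun k => ‖f.fourier k‖)]
      refine integral_congr_ae ?_
      filter_upwards [fourier_ofFourier _ (integrable_conj f)] with k hk
      exact (congrArg norm hk).trans ((conjₗᵢ n).norm_map _)))

theorem coeFn_fourier_conj (f : Wiener d n) :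
    ((conj d n f).fourier : Space d → State n) =ᵐ[volume] fun k => conjState (f.fourier (-k)) :=
  fourier_ofFourier _ (integrable_conj f)

theorem conj_apply (f : Wiener d n) (x : Space d) : conj d n f x = conjState (f x) :=
  ofFourier_conj_apply f x

theorem norm_conj_le (f : Wiener d n) : ‖conj d n f‖ ≤ ‖f‖ :=
  (ContinuousLinearMap.le_of_opNorm_le _ (LinearMap.mkContinuous_norm_le _ zero_le_one _) f).trans
    (one_mul _).le

theorem conj_conj (f : Wiener d n) : conj d n (conj d n f) = f :=
  ext_apply fun x => by rw [conj_apply, conj_apply, conjState_conjState]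

/-- Multipliers with symbols that satisfy a reality condition commute with conjugation. -/
theorem mul_conj {m : BddSymbol d (State n) (State n)}
    (hm : ∀ k v, m.toFun k (conjState v) = conjState (m.toFun (-k) v)) (f : Wiener d n) :
    mul m (conj d n f) = conj d n (mul m f) := by
  apply ext_fourier
  filter_upwards [coeFn_fourier_mul m (conj d n f), coeFn_fourier_conj f,
    coeFn_fourier_conj (mul m f),
    (Measure.measurePreserving_neg (volume : Measure (Space d))).quasiMeasurePreserving.ae
      (coeFn_fourier_mul m f)] with k h1 h2 h3 h4
  rw [h1, h2, h3, h4, hm]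

theorem mul_modulate {m m' : BddSymbol d (State n) (State n)} {q : Space d}
    (hm : ∀ k, m.toFun k = m'.toFun (k - q)) (f : Wiener d n) :
    mul m (modulate q f) = modulate q (mul m' f) := by
  apply ext_fourier
  filter_upwards [coeFn_fourier_mul m (modulate q f), coeFn_fourier_modulate q f,
    coeFn_fourier_modulate q (mul m' f),
    (measurePreserving_sub_right (volume : Measure (Space d)) q).quasiMeasurePreserving.ae
      (coeFn_fourier_mul m' f)] with k h1 h2 h3 h4
  rw [h1, h2, h3, h4, hm]

end Wiener

end PointwiseOperators

/-! ### Sylvester's equation and matrix exponentials. -/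

section MatrixEquations

set_option maxSynthPendingDepth 3

open Polynomial in
/-- Intertwiners of matrices with disjoint spectra vanish. -/
theorem Matrix.eq_zero_of_mul_eq_mul_of_disjoint_spectrum {n : ℕ} {a b x : Matrix (Fin n) (Fin n) ℂ}
    (h : Disjoint (spectrum ℂ a) (spectrum ℂ b)) (hx : a * x = x * b) : x = 0 := by
  have hq : ∀ q : ℂ[X], aeval a q * x = x * aeval b q := by
    intro q
    induction q using Polynomial.induction_on' with
    | add p q hp hq => rw [map_add, map_add, add_mul, mul_add, hp, hq]
    | monomial m c =>
      have hm : a ^ m * x = x * b ^ m := by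
        induction m with
        | zero => simp
        | succ m ih => rw [pow_succ, mul_assoc, hx, ← mul_assoc, ih, mul_assoc, ← pow_succ]
      rw [aeval_monomial, aeval_monomial, mul_assoc, hm, ← mul_assoc, ← mul_assoc,
        Algebra.commutes]
  -- The characteristic polynomial of `b` splits into linear factors. If its value at `a` were
  -- singular, some root would be an eigenvalue of `a`, contradicting disjointness.
  have hu : IsUnit (aeval a b.charpoly) := by
    by_contra hnu
    have hs := (IsAlgClosed.splits b.charpoly).eq_prod_roots_of_monic b.charpoly_monic
    rw [hs] at hnu
    obtain ⟨k, hk, hk0⟩ := spectrum.exists_mem_of_not_isUnit_aeval_prod hnu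
    exact Set.disjoint_left.1 h hk (Matrix.mem_spectrum_iff_isRoot_charpoly.2 hk0)
  have h0 := hq b.charpoly
  -- By Cayley–Hamilton the right-hand side vanishes, so an invertible matrix annihilates `x`.
  rw [Matrix.aeval_self_charpoly, mul_zero] at h0
  exact hu.mul_right_eq_zero.1 h0

variable {n : ℕ}

/-- A matrix as a continuous linear map on `ℂ^n`. -/
def opMatrix (M : Matrix (Fin n) (Fin n) ℂ) : State n →L[ℂ] State n :=
  Matrix.toEuclideanCLM (n := Fin n) (𝕜 := ℂ) M

theorem opMatrix_apply (M : Matrix (Fin n) (Fin n) ℂ) (v : State n) :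
    opMatrix M v = Matrix.toEuclideanLin M v := rfl

theorem opMatrix_add (M N : Matrix (Fin n) (Fin n) ℂ) :
    opMatrix (M + N) = opMatrix M + opMatrix N := map_add Matrix.toEuclideanCLM M N

theorem opMatrix_smul (c : ℂ) (M : Matrix (Fin n) (Fin n) ℂ) :
    opMatrix (c • M) = c • opMatrix M := map_smul Matrix.toEuclideanCLM c M

theorem opMatrix_mul (M N : Matrix (Fin n) (Fin n) ℂ) :
    opMatrix (M * N) = opMatrix M * opMatrix N := map_mul Matrix.toEuclideanCLM M N

theorem opMatrix_one : opMatrix (1 : Matrix (Fin n) (Fin n) ℂ) = 1 :=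
  map_one (Matrix.toEuclideanCLM (n := Fin n) (𝕜 := ℂ))

theorem opMatrix_exp (M : Matrix (Fin n) (Fin n) ℂ) :
    opMatrix (NormedSpace.exp M) = NormedSpace.exp (opMatrix M) := by
  let _ : NormedRing (Matrix (Fin n) (Fin n) ℂ) := Matrix.linftyOpNormedRing
  let φ : (State n →L[ℂ] State n) ≃⋆ₐ[ℂ] Matrix (Fin n) (Fin n) ℂ :=
    (Matrix.toEuclideanCLM (n := Fin n) (𝕜 := ℂ)).symm
  have hφ : Continuous φ := LinearMap.continuous_of_finiteDimensional
    (φ : (State n →L[ℂ] State n) →ₗ[ℂ] Matrix (Fin n) (Fin n) ℂ)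
  have h := NormedSpace.map_exp φ hφ (opMatrix M)
  have e : φ (opMatrix M) = M := StarAlgEquiv.symm_apply_apply _ M
  rw [e] at h
  exact (congrArg opMatrix h).symm.trans
    (StarAlgEquiv.apply_symm_apply (Matrix.toEuclideanCLM (n := Fin n) (𝕜 := ℂ)) _)

theorem opMatrix_mem_skewAdjoint {M : Matrix (Fin n) (Fin n) ℂ}
    (hM : M.conjTranspose = -M) : opMatrix M ∈ skewAdjoint (State n →L[ℂ] State n) := by
  rw [skewAdjoint.mem_iff, opMatrix, ← map_star, Matrix.star_eq_conjTranspose, hM, map_neg]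

/-- The equation `a x - x b = y` has a solution that depends linearly on `y`, if `a` and `b` have
disjoint spectra. -/
theorem exists_solution_mul_sub_mul {a b : Matrix (Fin n) (Fin n) ℂ}
    (h : Disjoint (spectrum ℂ a) (spectrum ℂ b)) :
    ∃ Φ : (State n →L[ℂ] State n) →L[ℂ] (State n →L[ℂ] State n),
      ∀ y, opMatrix a * Φ y - Φ y * opMatrix b = y := by
  let Ψ : (State n →L[ℂ] State n) →ₗ[ℂ] (State n →L[ℂ] State n) :=
    LinearMap.mulLeft ℂ (opMatrix a) - LinearMap.mulRight ℂ (opMatrix b)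
  have hΨ : ∀ y, Ψ y = opMatrix a * y - y * opMatrix b := fun y => rfl
  have hinj : Function.Injective Ψ := by
    rw [injective_iff_map_eq_zero]
    intro y hy
    obtain ⟨x, rfl⟩ := (Matrix.toEuclideanCLM (n := Fin n) (𝕜 := ℂ)).surjective y
    change Ψ (opMatrix x) = 0 at hy
    rw [hΨ, sub_eq_zero, ← opMatrix_mul, ← opMatrix_mul] at hy
    rw [Matrix.eq_zero_of_mul_eq_mul_of_disjoint_spectrum h
      ((Matrix.toEuclideanCLM (n := Fin n) (𝕜 := ℂ)).injective hy), map_zero]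
  let e := LinearEquiv.ofInjectiveEndo Ψ hinj
  -- In finite dimension injectivity suffices; the inverse is linear, so a solution that depends on
  -- parameters inherits linearity in them.
  refine ⟨LinearMap.toContinuousLinearMap (e.symm : (State n →L[ℂ] State n) →ₗ[ℂ] _), fun y => ?_⟩
  rw [← hΨ]
  exact e.apply_symm_apply y

/-- The exponential intertwines what its argument intertwines. -/
theorem exp_intertwine {a b : State n →L[ℂ] State n} {R : State n →L[ℝ] State n}
    (h : ∀ v, R (a v) = b (R v)) (v : State n) :
    R (NormedSpace.exp a v) = NormedSpace.exp b (R v) := by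
  have hpow : ∀ (m : ℕ) (v : State n), R ((a ^ m) v) = (b ^ m) (R v) := by
    intro m
    induction m with
    | zero => intro v; rfl
    | succ m ih =>
      intro v
      rw [pow_succ, pow_succ]
      change R ((a ^ m) (a v)) = (b ^ m) (b (R v))
      rw [ih, h]
  have hs : ∀ (c : State n →L[ℂ] State n) (w : State n),
      HasSum (fun m : ℕ => ((m.factorial : ℝ)⁻¹) • (c ^ m) w) (NormedSpace.exp c w) := by
    intro c w
    have h1 := (NormedSpace.exp_series_hasSum_exp' (𝕂 := ℝ) c).mapL
      ((ContinuousLinearMap.apply ℂ (State n) w).restrictScalars ℝ)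
    exact h1
  have h1 := (hs a v).mapL R
  simp only [map_smul, hpow] at h1
  exact h1.unique (hs b (R v))

theorem exp_add_smul_one (a : State n →L[ℂ] State n) (c : ℂ) :
    NormedSpace.exp (a + c • (1 : State n →L[ℂ] State n)) = cexp c • NormedSpace.exp a := by
  have h1 : NormedSpace.exp (c • (1 : State n →L[ℂ] State n))
      = cexp c • (1 : State n →L[ℂ] State n) := by
    rw [← Algebra.algebraMap_eq_smul_one, ← Algebra.algebraMap_eq_smul_one,
      ← NormedSpace.algebraMap_exp_comm, Complex.exp_eq_exp_ℂ]
  rw [NormedSpace.exp_add_of_commute ((Commute.one_right a).smul_right c), h1, mul_smul_comm,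
    mul_one]

end MatrixEquations

/-! ### Trilinear maps of the two normal forms. -/

section CubicMaps

set_option maxSynthPendingDepth 3

variable {n : ℕ}

/-- The trilinear extension as a continuous trilinear map. -/
def trilinearCLM (T : (Fin n → ℝ) →ₗ[ℝ] (Fin n → ℝ) →ₗ[ℝ] (Fin n → ℝ) →ₗ[ℝ] (Fin n → ℝ)) :
    State n →L[ℂ] State n →L[ℂ] State n →L[ℂ] State n :=
  ∑ q, ∑ r, ∑ s, (EuclideanSpace.proj q : State n →L[ℂ] ℂ).smulRight
    ((EuclideanSpace.proj r : State n →L[ℂ] ℂ).smulRight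
      ((EuclideanSpace.proj s : State n →L[ℂ] ℂ).smulRight
        (WithLp.toLp 2 (fun i => (T (Pi.single q 1) (Pi.single r 1) (Pi.single s 1) i : ℂ)) :
          State n)))

theorem trilinearCLM_apply
    (T : (Fin n → ℝ) →ₗ[ℝ] (Fin n → ℝ) →ₗ[ℝ] (Fin n → ℝ) →ₗ[ℝ] (Fin n → ℝ)) (a b c : State n) :
    trilinearCLM T a b c = trilinearExt T a b c := by
  simp only [trilinearCLM, trilinearExt, sum_apply, ContinuousLinearMap.smulRight_apply,
    smul_apply, smul_smul, mul_assoc]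
  rfl

theorem conjState_trilinearExt
    (T : (Fin n → ℝ) →ₗ[ℝ] (Fin n → ℝ) →ₗ[ℝ] (Fin n → ℝ) →ₗ[ℝ] (Fin n → ℝ)) (a b c : State n) :
    conjState (trilinearExt T a b c)
      = trilinearExt T (conjState a) (conjState b) (conjState c) := by
  simp only [trilinearExt]
  rw [← Wiener.conjₗᵢ_apply, map_sum]
  refine Finset.sum_congr rfl fun q _ => ?_
  rw [map_sum]
  refine Finset.sum_congr rfl fun r _ => ?_
  rw [map_sum]
  refine Finset.sum_congr rfl fun s _ => ?_
  rw [Wiener.conjₗᵢ_apply, Wiener.conjState_smul]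
  ext i
  simp [conjState]

/-- Supplies the normal form for the third harmonic, with no resonance condition beyond
invertibility because its arguments vary slowly. -/
theorem exists_cubic_of_isUnit {L : Matrix (Fin n) (Fin n) ℂ} (hL : IsUnit L)
    (T : State n →L[ℂ] State n →L[ℂ] State n →L[ℂ] State n) :
    ∃ S : State n →L[ℂ] State n →L[ℂ] State n →L[ℂ] State n,
      ∀ a b c, opMatrix L (S a b c) = T a b c := by
  refine ⟨triComp (opMatrix L⁻¹) T (.id ℂ _) (.id ℂ _) (.id ℂ _), fun a b c => ?_⟩
  have h : opMatrix L * opMatrix L⁻¹ = 1 := by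
    rw [← opMatrix_mul, Matrix.mul_nonsing_inv _ ((Matrix.isUnit_iff_isUnit_det _).1 hL),
      opMatrix_one]
  exact DFunLike.congr_fun h (T a b c)

/-- For fixed `a`, `b` this is Sylvester's equation for the operator `P a b`. The right-hand side
collects the three positions of the rotating argument `c`; linearity of the solution operator makes
`P` trilinear. -/
theorem exists_cubic_of_disjoint_spectrum {L₃ L₅ : Matrix (Fin n) (Fin n) ℂ}
    (h : Disjoint (spectrum ℂ L₃) (spectrum ℂ L₅))
    (T : State n →L[ℂ] State n →L[ℂ] State n →L[ℂ] State n) :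
    ∃ P : State n →L[ℂ] State n →L[ℂ] State n →L[ℂ] State n,
      ∀ a b c, opMatrix L₅ (P a b c) - P a b (opMatrix L₃ c) = T a b c + T a c b + T c a b := by
  obtain ⟨Φ, hΦ⟩ := exists_solution_mul_sub_mul h.symm
  let fl := (ContinuousLinearMap.flipₗᵢ ℂ (State n) (State n)
    (State n)).toContinuousLinearEquiv.toContinuousLinearMap
  let Y : State n →L[ℂ] State n →L[ℂ] State n →L[ℂ] State n := T + fl ∘L T + fl ∘L T.flip
  have hY : ∀ a b c, Y a b c = T a b c + T a c b + T c a b := fun a b c => rfl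
  refine ⟨(ContinuousLinearMap.compL ℂ _ _ _ Φ) ∘L Y, fun a b c => ?_⟩
  rw [← hY]
  exact DFunLike.congr_fun (hΦ (Y a b)) c

end CubicMaps

/-! ### The abstract setting realized on the Wiener algebra. -/

section ConcreteSetting

set_option maxSynthPendingDepth 3

open Set Filter Topology

variable {d n : ℕ} {A : Fin d → Matrix (Fin n) (Fin n) ℝ} {E : Matrix (Fin n) (Fin n) ℝ}

theorem symbolA_add (β β' : Space d) : symbolA A (β + β') = symbolA A β + symbolA A β' := by
  simp [symbolA, add_smul, Finset.sum_add_distrib]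

theorem symbolA_smul (c : ℝ) (β : Space d) : symbolA A (c • β) = (c : ℂ) • symbolA A β := by
  simp only [symbolA, Finset.smul_sum, smul_smul, PiLp.smul_apply, smul_eq_mul, ofReal_mul]

theorem conjTranspose_cMatrix (M : Matrix (Fin n) (Fin n) ℝ) :
    (cMatrix M).conjTranspose = cMatrix M.transpose := by
  ext i j
  simp [cMatrix]

theorem conjTranspose_symbolA (hA : ∀ ℓ, (A ℓ).IsSymm) (β : Space d) :
    (symbolA A β).conjTranspose = symbolA A β := by
  rw [symbolA, Matrix.conjTranspose_sum]
  refine Finset.sum_congr rfl fun ℓ _ => ?_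
  rw [Matrix.conjTranspose_smul, conjTranspose_cMatrix, (hA ℓ).eq, star_def, conj_ofReal]

theorem conjTranspose_symbolL (hA : ∀ ℓ, (A ℓ).IsSymm) (hE : E.transpose = -E) (α : ℝ)
    (β : Space d) : (symbolL A E α β).conjTranspose = symbolL A E α β := by
  have h : cMatrix (-E) = -cMatrix E := by
    ext i j
    simp [cMatrix]
  rw [symbolL, Matrix.conjTranspose_sub, Matrix.conjTranspose_add, conjTranspose_symbolA hA,
    Matrix.conjTranspose_smul, Matrix.conjTranspose_smul, conjTranspose_cMatrix, hE, h]
  simp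

theorem opMatrix_symbolA (k : Space d) :
    opMatrix (symbolA A k) = ∑ ℓ, (k ℓ : ℂ) • opMatrix (cMatrix (A ℓ)) := by
  rw [symbolA, opMatrix, map_sum]
  exact Finset.sum_congr rfl fun ℓ _ => opMatrix_smul _ _

theorem continuous_opMatrix_symbolA : Continuous fun k => opMatrix (symbolA A k) := by
  simp only [opMatrix_symbolA]
  refine continuous_finsetSum _ fun ℓ _ => ?_
  have h : Continuous fun k : Space d => (k ℓ : ℂ) := by fun_prop
  exact h.smul continuous_const

theorem norm_opMatrix_symbolA_le (k : Space d) :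
    ‖opMatrix (symbolA A k)‖ ≤ (∑ ℓ, ‖opMatrix (cMatrix (A ℓ))‖) * weight k := by
  rw [opMatrix_symbolA, Finset.sum_mul]
  refine norm_sum_le_of_le _ fun ℓ _ => ?_
  rw [norm_smul, norm_real, Real.norm_eq_abs, mul_comm]
  exact mul_le_mul_of_nonneg_left (abs_le_weight k ℓ) (norm_nonneg _)

/-- The symbol of the generator `-(i ε⁻¹ L(α, β) + A(∂))`. -/
def waveSymbol (hA : ∀ ℓ, (A ℓ).IsSymm) (hE : E.transpose = -E) (ε α : ℝ) (β : Space d) :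
    WaveSymbol d n where
  D k := (-I) • ((ε⁻¹ : ℂ) • opMatrix (symbolL A E α β) + opMatrix (symbolA A k))
  continuous_D := (continuous_const.add continuous_opMatrix_symbolA).const_smul (-I)
  skew k := by
    rw [← opMatrix_smul, ← opMatrix_add, ← opMatrix_smul]
    refine opMatrix_mem_skewAdjoint ?_
    rw [Matrix.conjTranspose_smul, Matrix.conjTranspose_add, Matrix.conjTranspose_smul,
      conjTranspose_symbolA hA, conjTranspose_symbolL hA hE]
    simp [add_comm]
  growth := by
    refine ⟨‖(ε⁻¹ : ℂ) • opMatrix (symbolL A E α β)‖ + ∑ ℓ, ‖opMatrix (cMatrix (A ℓ))‖,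
      fun k => ?_⟩
    rw [norm_smul, norm_neg, norm_I, one_mul, add_mul]
    exact (norm_add_le _ _).trans (add_le_add
      (le_mul_of_one_le_right (norm_nonneg _) (one_le_weight k)) (norm_opMatrix_symbolA_le k))

/-- The symbol of the spatial part of the generators, divided by the weight. -/
def spatialSymbol (A : Fin d → Matrix (Fin n) (Fin n) ℝ) : BddSymbol d (State n) (State n) where
  toFun k := ((weight k)⁻¹ : ℂ) • opMatrix (symbolA A k)
  aestronglyMeasurable :=
    (continuous_inv_weight.smul continuous_opMatrix_symbolA).aestronglyMeasurable
  bounded := ⟨∑ ℓ, ‖opMatrix (cMatrix (A ℓ))‖, fun k => by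
    rw [norm_smul, norm_inv, norm_real, Real.norm_of_nonneg (weight_pos k).le,
      inv_mul_le_iff₀ (weight_pos k), mul_comm]
    exact norm_opMatrix_symbolA_le k⟩

theorem spatialSymbol_apply (k : Space d) (v : State n) :
    (spatialSymbol A).toFun k v = ((weight k)⁻¹ : ℂ) • opMatrix (symbolA A k) v := rfl

theorem gen_waveSymbol (hA : ∀ ℓ, (A ℓ).IsSymm) (hE : E.transpose = -E) (ε α : ℝ) (β : Space d)
    (f : Wiener d n) : (waveSymbol hA hE ε α β).group.gen f
      = -(I • (ε⁻¹ • Wiener.const (opMatrix (symbolL A E α β)) (Wiener.smoothing d n f)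
        + Wiener.mul (spatialSymbol A) f)) := by
  change Wiener.mul (waveSymbol hA hE ε α β).genSymbol f = _
  rw [← neg_smul, ← Complex.coe_smul, ofReal_inv]
  set q := Wiener.const (opMatrix (symbolL A E α β)) (Wiener.smoothing d n f) with hq
  apply Wiener.ext_fourier
  filter_upwards [Wiener.coeFn_fourier_mul (waveSymbol hA hE ε α β).genSymbol f,
    Wiener.coeFn_fourier_smul (-I) ((ε⁻¹ : ℂ) • q + Wiener.mul (spatialSymbol A) f),
    Wiener.coeFn_fourier_add ((ε⁻¹ : ℂ) • q) (Wiener.mul (spatialSymbol A) f),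
    Wiener.coeFn_fourier_smul (ε⁻¹ : ℂ) q,
    Wiener.coeFn_fourier_const (opMatrix (symbolL A E α β)) (Wiener.smoothing d n f),
    Wiener.coeFn_fourier_smoothing f, Wiener.coeFn_fourier_mul (spatialSymbol A) f]
    with k h1 h2 h3 h4 h5 h6 h7
  rw [h1, h2, h3, h4, hq, h5, h6, h7, spatialSymbol_apply, map_smul]
  change ((weight k)⁻¹ : ℂ) • (-I) • ((ε⁻¹ : ℂ) • opMatrix (symbolL A E α β) (f.fourier k)
    + opMatrix (symbolA A k) (f.fourier k)) = _
  simp only [smul_add, smul_smul]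
  congr 2 <;> ring

theorem waveSymbol_zero_D (hA : ∀ ℓ, (A ℓ).IsSymm) (hE : E.transpose = -E) (ε : ℝ)
    (k : Space d) : (waveSymbol hA hE ε 0 0).D k
      = opMatrix (-(I • symbolA A k + ((1 / ε : ℝ) : ℂ) • cMatrix E)) := by
  change (-I) • ((ε⁻¹ : ℂ) • opMatrix (symbolL A E 0 0) + opMatrix (symbolA A k)) = _
  rw [← opMatrix_smul, ← opMatrix_add, ← opMatrix_smul]
  congr 1
  have h0 : symbolA A (0 : Space d) = 0 := by simp [symbolA]
  rw [symbolL, h0]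
  ext p q
  simp only [Matrix.smul_apply, Matrix.add_apply, Matrix.sub_apply, Matrix.neg_apply, smul_eq_mul,
    Matrix.zero_apply]
  push_cast
  linear_combination ((ε : ℂ)⁻¹ * cMatrix E p q) * I_mul_I

/-- The group of the original problem is the propagator. -/
theorem propagator_eq (hA : ∀ ℓ, (A ℓ).IsSymm) (hE : E.transpose = -E) (ε t : ℝ)
    (f : Wiener d n) : propagator A E ε t f = (waveSymbol hA hE ε 0 0).group.U t f := by
  set g := waveSymbol hA hE ε 0 0
  have hm : ∀ k, opMatrix (NormedSpace.exp
      ((-(t : ℂ)) • (I • symbolA A k + ((1 / ε : ℝ) : ℂ) • cMatrix E))) = g.expD t k := by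
    intro k
    rw [opMatrix_exp, g.expD_eq]
    congr 1
    rw [waveSymbol_zero_D, ← opMatrix_smul, smul_neg, neg_smul]
  have hfun : (fun k => Matrix.toEuclideanLin (NormedSpace.exp
      ((-(t : ℂ)) • (I • symbolA A k + ((1 / ε : ℝ) : ℂ) • cMatrix E))) (f.fourier k))
      = fun k => (g.expSymbol t).toFun k (f.fourier k) :=
    funext fun k => DFunLike.congr_fun (hm k) (f.fourier k)
  have hint := (g.expSymbol t).integrable f.integrable_fourier
  rw [← hfun] at hint
  -- The symbol is unitary, so the product is integrable and the default value `0` of `multiplier`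
  -- never occurs.
  rw [propagator, Wiener.multiplier, dif_pos hint]
  change _ = Wiener.mul (g.expSymbol t) f
  apply Wiener.ext_fourier
  filter_upwards [Wiener.fourier_ofFourier _ hint, Wiener.coeFn_fourier_mul (g.expSymbol t) f]
    with k h1 h2
  rw [h1, h2]
  exact congrFun hfun k

/-- The modulation with the `j`-th power of the carrier wave. -/
def carrier (ω : ℝ) (κ : Space d) (ε : ℝ) (j : ℤ) (t : ℝ) : Wiener d n →L[ℂ] Wiener d n :=
  cexp (I * ((-(j * ω * t) / ε : ℝ) : ℂ)) • Wiener.modulate (((j : ℝ) / ε) • κ)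

theorem carrier_apply (ω : ℝ) (κ : Space d) (ε : ℝ) (j : ℤ) (t : ℝ) (f : Wiener d n)
    (x : Space d) : carrier ω κ ε j t f x
      = cexp (I * (((j : ℝ) * (⟪κ, x⟫_ℝ - ω * t) / ε : ℝ) : ℂ)) • f x := by
  change cexp (I * ((-(j * ω * t) / ε : ℝ) : ℂ)) • (Wiener.modulate (((j : ℝ) / ε) • κ) f) x = _
  rw [Wiener.modulate_apply, smul_smul, ← Complex.exp_add, ← mul_add, ← ofReal_add,
    real_inner_smul_left]
  congr 5
  ring

theorem norm_carrier_le (ω : ℝ) (κ : Space d) (ε : ℝ) (j : ℤ) (t : ℝ) (f : Wiener d n) :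
    ‖carrier ω κ ε j t f‖ ≤ ‖f‖ := by
  change ‖cexp (I * ((-(j * ω * t) / ε : ℝ) : ℂ)) • Wiener.modulate (((j : ℝ) / ε) • κ) f‖ ≤ _
  rw [norm_smul, mul_comm I, norm_exp_ofReal_mul_I, one_mul]
  exact Wiener.norm_modulate_le _ f

theorem conj_carrier (ω : ℝ) (κ : Space d) (ε : ℝ) (j : ℤ) (t : ℝ) (f : Wiener d n) :
    Wiener.conj d n (carrier ω κ ε j t f) = carrier ω κ ε (-j) t (Wiener.conj d n f) :=
  Wiener.ext_apply fun x => by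
    rw [Wiener.conj_apply, carrier_apply, carrier_apply, Wiener.conj_apply, Wiener.conjState_smul,
      ← Complex.exp_conj]
    congr 2
    rw [map_mul, conj_I, conj_ofReal]
    push_cast
    ring

theorem tri_carrier (T : State n →L[ℂ] State n →L[ℂ] State n →L[ℂ] State n) (ω : ℝ)
    (κ : Space d) (ε : ℝ) (i j k : ℤ) (t : ℝ) (a b c : Wiener d n) :
    Wiener.tri 0 T (carrier ω κ ε i t a) (carrier ω κ ε j t b) (carrier ω κ ε k t c)
      = carrier ω κ ε (i + j + k) t (Wiener.tri 0 T a b c) :=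
  Wiener.ext_apply fun x => by
    rw [Wiener.tri_zero_apply, carrier_apply, carrier_apply, carrier_apply, carrier_apply,
      Wiener.tri_zero_apply]
    simp only [map_smul, smul_apply, smul_smul, ← Complex.exp_add]
    congr 2
    push_cast
    ring

/-- The carrier wave intertwines the groups of the original problem and of the amplitudes. -/
theorem U_carrier (hA : ∀ ℓ, (A ℓ).IsSymm) (hE : E.transpose = -E) (ω : ℝ) (κ : Space d) (ε : ℝ)
    (j : ℤ) (t : ℝ) (f : Wiener d n) :
    (waveSymbol hA hE ε 0 0).group.U (-t) (carrier ω κ ε j t f)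
      = carrier ω κ ε j 0 ((waveSymbol hA hE ε (j * ω) ((j : ℝ) • κ)).group.U (-t) f) := by
  set g := waveSymbol hA hE ε 0 0
  set g' := waveSymbol hA hE ε (j * ω) ((j : ℝ) • κ)
  set c := cexp (I * ((-(j * ω * t) / ε : ℝ) : ℂ))
  -- The frequency shift by `jκ/ε` turns `A(k)` into `A(k) - A(jκ)/ε`, which cancels `A(jκ)` in
  -- `L(jω, jκ)`. What remains is a scalar, the temporal phase of the carrier.
  have hD : ∀ k, g'.D (k - ((j : ℝ) / ε) • κ)
      = g.D k + (I * (j * ω / ε : ℝ)) • (1 : State n →L[ℂ] State n) := by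
    intro k
    change (-I) • ((ε⁻¹ : ℂ) • opMatrix (symbolL A E (j * ω) ((j : ℝ) • κ))
        + opMatrix (symbolA A (k - ((j : ℝ) / ε) • κ)))
      = (-I) • ((ε⁻¹ : ℂ) • opMatrix (symbolL A E 0 0) + opMatrix (symbolA A k)) + _
    have h0 : symbolA A (0 : Space d) = 0 := by simp [symbolA]
    rw [← opMatrix_one]
    simp only [← opMatrix_smul, ← opMatrix_add]
    congr 1
    rw [sub_eq_add_neg, ← neg_smul, symbolA_add, symbolL, symbolL, symbolA_smul, symbolA_smul, h0]
    ext p q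
    simp only [Matrix.smul_apply, Matrix.add_apply, Matrix.sub_apply, smul_eq_mul,
      Matrix.zero_apply]
    push_cast
    ring
  let m : BddSymbol d (State n) (State n) :=
    { toFun := fun k => c • g.expD (-t) k
      aestronglyMeasurable := ((g.continuous_expD (-t)).const_smul c).aestronglyMeasurable
      bounded := ⟨‖c‖, fun k => by
        rw [norm_smul]
        exact mul_le_of_le_one_right (norm_nonneg _) (g.norm_expD_le _ k)⟩ }
  have hm : ∀ k, m.toFun k = (g'.expSymbol (-t)).toFun (k - ((j : ℝ) / ε) • κ) := by
    intro k
    change c • g.expD (-t) k = g'.expD (-t) (k - ((j : ℝ) / ε) • κ)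
    rw [g'.expD_eq, hD, smul_add, smul_smul, exp_add_smul_one, g.expD_eq]
    congr 1
    simp only [c]
    congr 1
    push_cast
    ring
  have h1 := Wiener.mul_modulate hm f
  have h2 : Wiener.mul m (Wiener.modulate (((j : ℝ) / ε) • κ) f)
      = Wiener.mul (g.expSymbol (-t)) (carrier ω κ ε j t f) := by
    change _ = Wiener.mul (g.expSymbol (-t)) (c • Wiener.modulate (((j : ℝ) / ε) • κ) f)
    rw [map_smul]
    refine (Wiener.mul_eq_smul_add_smul (m₁ := g.expSymbol (-t)) (m₂ := g.expSymbol (-t)) (a := c)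
      (b := 0) (fun k => ?_) _).trans ?_
    · rw [zero_smul, add_zero]
      rfl
    · rw [zero_smul, add_zero]
  change Wiener.mul (g.expSymbol (-t)) (carrier ω κ ε j t f)
    = cexp (I * ((-(j * ω * 0) / ε : ℝ) : ℂ)) • Wiener.modulate (((j : ℝ) / ε) • κ)
      (Wiener.mul (g'.expSymbol (-t)) f)
  rw [← h2, h1]
  simp

theorem conjState_opMatrix (M : Matrix (Fin n) (Fin n) ℂ) (v : State n) :
    conjState (opMatrix M v) = opMatrix (M.map (starRingEnd ℂ)) (conjState v) := by
  ext i
  simp [conjState, opMatrix_apply, Matrix.toLpLin_apply, Matrix.mulVec, dotProduct]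

/-- The differential operator has real coefficients: its symbol at `-k` is the conjugate of that at
`k`, and the exponential preserves this relation. -/
theorem conj_U (hA : ∀ ℓ, (A ℓ).IsSymm) (hE : E.transpose = -E) (ε t : ℝ) (f : Wiener d n) :
    Wiener.conj d n ((waveSymbol hA hE ε 0 0).group.U t f)
      = (waveSymbol hA hE ε 0 0).group.U t (Wiener.conj d n f) := by
  set g := waveSymbol hA hE ε 0 0
  refine (Wiener.mul_conj (m := g.expSymbol t) (fun k v => ?_) f).symm
  change g.expD t k (conjState v) = conjState (g.expD t (-k) v)
  rw [g.expD_eq, g.expD_eq]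
  refine (exp_intertwine (R := (Wiener.conjₗᵢ n).toContinuousLinearMap) (fun w => ?_) v).symm
  change conjState ((t : ℂ) • g.D (-k) w) = (t : ℂ) • g.D k (conjState w)
  rw [Wiener.conjState_smul, conj_ofReal, waveSymbol_zero_D, waveSymbol_zero_D, conjState_opMatrix]
  congr 3
  ext p q
  simp [symbolA, cMatrix, Matrix.sum_apply]

variable {T : (Fin n → ℝ) →ₗ[ℝ] (Fin n → ℝ) →ₗ[ℝ] (Fin n → ℝ) →ₗ[ℝ] (Fin n → ℝ)} {ω : ℝ}
  {κ : Space d} {S P : State n →L[ℂ] State n →L[ℂ] State n →L[ℂ] State n}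

theorem Wiener.smoothing_conj (f : Wiener d n) :
    Wiener.smoothing d n (Wiener.conj d n f) = Wiener.conj d n (Wiener.smoothing d n f) :=
  Wiener.mul_conj (fun k v => by
    rw [smoothingSymbol_apply, smoothingSymbol_apply, Wiener.conjState_smul, map_inv₀,
      conj_ofReal, weight, weight]
    simp) f

/-- After applying the injective operator `J^s`, both sides act pointwise, where the hypothesis
applies. -/
theorem Wiener.const_tri (s : ℕ) {M : State n →L[ℂ] State n}
    {S T : State n →L[ℂ] State n →L[ℂ] State n →L[ℂ] State n}
    (h : ∀ a b c, M (S a b c) = T a b c) (f g k : Wiener d n) :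
    Wiener.const M (Wiener.tri s S f g k) = Wiener.tri s T f g k := by
  refine Wiener.smoothing_pow_injective s (Wiener.ext_apply fun x => ?_)
  rw [Wiener.smoothing_pow_const, Wiener.const_apply, Wiener.smoothing_pow_tri,
    Wiener.smoothing_pow_tri, h]

/-- The operators of the envelope system on the Wiener algebra. -/
def wienerSetting (A : Fin d → Matrix (Fin n) (Fin n) ℝ) (E : Matrix (Fin n) (Fin n) ℝ)
    (T : (Fin n → ℝ) →ₗ[ℝ] (Fin n → ℝ) →ₗ[ℝ] (Fin n → ℝ) →ₗ[ℝ] (Fin n → ℝ)) (ω : ℝ)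
    (κ : Space d) (S P : State n →L[ℂ] State n →L[ℂ] State n →L[ℂ] State n)
    (hS : ∀ a b c, opMatrix (symbolL A E (3 * ω) ((3 : ℝ) • κ)) (S a b c) = trilinearCLM T a b c)
    (hP : ∀ a b c, opMatrix (symbolL A E (5 * ω) ((5 : ℝ) • κ)) (P a b c)
      - P a b (opMatrix (symbolL A E (3 * ω) ((3 : ℝ) • κ)) c)
      = trilinearCLM T a b c + trilinearCLM T a c b + trilinearCLM T c a b) :
    EnvelopeSetting (Wiener d n) where
  J := (Wiener.smoothing d n).restrictScalars ℝ
  C := Wiener.conj d n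
  Q := (Wiener.mul (spatialSymbol A)).restrictScalars ℝ
  L j := (Wiener.const (opMatrix (symbolL A E (j * ω) ((j : ℝ) • κ)))).restrictScalars ℝ
  T s := Wiener.tri s (trilinearCLM T)
  S s := Wiener.tri s S
  P s := Wiener.tri s P
  norm_J_le := Wiener.norm_smoothing_le
  norm_C_le := Wiener.norm_conj_le
  C_C := Wiener.conj_conj
  J_C := Wiener.smoothing_conj
  J_T s := Wiener.smoothing_tri s _
  J_S s := Wiener.smoothing_tri s _
  J_P s := Wiener.smoothing_tri s _
  C_T a b c := Wiener.ext_apply fun x => by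
    rw [Wiener.conj_apply, Wiener.tri_zero_apply, Wiener.tri_zero_apply, trilinearCLM_apply,
      trilinearCLM_apply, conjState_trilinearExt, Wiener.conj_apply, Wiener.conj_apply,
      Wiener.conj_apply]
  L_S s a b c := Wiener.const_tri s (fun a b c => by simpa using hS a b c) a b c
  L_P a b c := Wiener.ext_apply fun x => by
    change Wiener.tri 0 P a b (I • Wiener.const _ c) x = (I • (Wiener.const _ _) x)
      - I • (Wiener.tri 0 (trilinearCLM T) a b c x + Wiener.tri 0 (trilinearCLM T) a c b x
        + Wiener.tri 0 (trilinearCLM T) c a b x)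
    rw [Wiener.tri_zero_apply, Wiener.const_apply, Wiener.tri_zero_apply, Wiener.tri_zero_apply,
      Wiener.tri_zero_apply, Wiener.tri_zero_apply, ← hP, Wiener.smul_apply', Wiener.const_apply,
      map_smul]
    simp only [Int.cast_ofNat, smul_sub]
    abel

/-- The groups and the modulations of the envelope system on the Wiener algebra. -/
def wienerFrame (hA : ∀ ℓ, (A ℓ).IsSymm) (hE : E.transpose = -E)
    (hS : ∀ a b c, opMatrix (symbolL A E (3 * ω) ((3 : ℝ) • κ)) (S a b c) = trilinearCLM T a b c)
    (hP : ∀ a b c, opMatrix (symbolL A E (5 * ω) ((5 : ℝ) • κ)) (P a b c)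
      - P a b (opMatrix (symbolL A E (3 * ω) ((3 : ℝ) • κ)) c)
      = trilinearCLM T a b c + trilinearCLM T a c b + trilinearCLM T c a b) (ε : ℝ) :
    (wienerSetting A E T ω κ S P hS hP).Frame ε where
  g j := (waveSymbol hA hE ε (j * ω) ((j : ℝ) • κ)).group
  e j t := (carrier ω κ ε j t).restrictScalars ℝ
  gen_eq j f := gen_waveSymbol hA hE ε _ _ f
  U_I_smul j t f :=
    (Wiener.mul ((waveSymbol hA hE ε (j * ω) ((j : ℝ) • κ)).expSymbol t)).map_smul I f
  norm_e_le j t f := norm_carrier_le ω κ ε j t f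
  U_e j t f := by
    have h := U_carrier hA hE ω κ ε j t f
    simpa using h
  e_T i j k t a b c := tri_carrier _ ω κ ε i j k t a b c
  C_e j t f := conj_carrier ω κ ε j t f
  C_U t f := by
    have h : waveSymbol hA hE ε (((0 : ℤ) : ℝ) * ω) (((0 : ℤ) : ℝ) • κ)
        = waveSymbol hA hE ε 0 0 := by simp
    rw [h]
    exact conj_U hA hE ε t f

end ConcreteSetting

/-! ### The spaces `W^s` as ranges of powers of `J`. -/

section PartialDerivatives

set_option maxSynthPendingDepth 3

open Set Filter Topology

namespace Wiener

variable {d n : ℕ}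

/-- The symbol of the partial derivative. -/
def partialWave (d n : ℕ) (ℓ : Fin d) : WaveSymbol d n where
  D k := (I * (k ℓ : ℂ)) • (1 : State n →L[ℂ] State n)
  continuous_D := by
    have h : Continuous fun k : Space d => I * (k ℓ : ℂ) := by fun_prop
    exact h.smul continuous_const
  skew k := by
    rw [skewAdjoint.mem_iff, star_smul, star_one, ← neg_smul]
    congr 1
    simp
  growth := ⟨1, fun k => by
    rw [norm_smul, norm_mul, norm_I, one_mul, one_mul, norm_real, Real.norm_eq_abs]
    exact (mul_le_of_le_one_right (abs_nonneg _) ContinuousLinearMap.norm_id_le).trans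
      (abs_le_weight k ℓ)⟩

/-- The group of translations in the direction of a coordinate axis. -/
abbrev translation (d n : ℕ) (ℓ : Fin d) :
    RegularGroup ((smoothing d n).restrictScalars ℝ) := (partialWave d n ℓ).group

/-- The partial derivative, composed with the smoothing operator. -/
def partialJ (ℓ : Fin d) : Wiener d n →L[ℂ] Wiener d n := mul (partialWave d n ℓ).genSymbol

theorem coeFn_fourier_partialJ (ℓ : Fin d) (f : Wiener d n) :
    ((partialJ ℓ f).fourier : Space d → State n) =ᵐ[volume]
      fun k => (((weight k)⁻¹ : ℂ) * (I * (k ℓ : ℂ))) • f.fourier k := by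
  filter_upwards [coeFn_fourier_mul (partialWave d n ℓ).genSymbol f] with k hk
  rw [mul_smul]
  exact hk

theorem partialJ_smoothing (ℓ : Fin d) (f : Wiener d n) :
    partialJ ℓ (smoothing d n f) = smoothing d n (partialJ ℓ f) := (translation d n ℓ).gen_J f

theorem translation_apply (ℓ : Fin d) (t : ℝ) (f : Wiener d n) (x : Space d) :
    (translation d n ℓ).U t f x = f (x + t • EuclideanSpace.single ℓ 1) := by
  have hexp : ∀ k v, (partialWave d n ℓ).expD t k v = cexp (I * ((t * k ℓ : ℝ) : ℂ)) • v := by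
    intro k v
    rw [WaveSymbol.expD_eq]
    change NormedSpace.exp ((t : ℂ) • (I * (k ℓ : ℂ)) • (1 : State n →L[ℂ] State n)) v = _
    have h := exp_add_smul_one (0 : State n →L[ℂ] State n) ((t : ℂ) * (I * (k ℓ : ℂ)))
    rw [zero_add, NormedSpace.exp_zero] at h
    rw [smul_smul, h]
    change cexp _ • v = _
    congr 2
    push_cast
    ring
  change mul ((partialWave d n ℓ).expSymbol t) f x = _
  rw [apply_eq, apply_eq f, invFourier_congr (coeFn_fourier_mul _ f), invFourier, invFourier]
  congr 2
  funext k
  change cexp _ • (partialWave d n ℓ).expD t k _ = _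
  rw [hexp, smul_smul, ← Complex.exp_add, ← mul_add, ← ofReal_add, inner_add_right,
    real_inner_smul_right, EuclideanSpace.inner_single_right]
  simp

/-- The orbit of a smoothed function under the translation group is differentiable in `W`, and
evaluation at a point is continuous. -/
theorem isPartial_smoothing (ℓ : Fin d) (f : Wiener d n) :
    IsPartial ℓ (smoothing d n f) (partialJ ℓ f) := by
  intro x
  have h := (((eval x).restrictScalars ℝ).hasFDerivAt).comp_hasDerivAt (0 : ℝ)
    ((translation d n ℓ).hasDerivAt f 0)
  rw [(translation d n ℓ).U_zero] at h
  refine HasDerivAt.congr_deriv (f' := partialJ ℓ f x) (h.congr_of_eventuallyEq ?_) rfl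
  exact Eventually.of_forall fun t => (translation_apply ℓ t (smoothing d n f) x).symm

/-- `IsPartial` only provides pointwise derivatives. Integration along lines turns them into an
identity in `W` for the translates of `f`; after smoothing, its derivative at `0` is compared with
the generator. -/
theorem partialJ_eq_of_isPartial {ℓ : Fin d} {f h : Wiener d n} (hf : IsPartial ℓ f h) :
    partialJ ℓ f = smoothing d n h := by
  set G := translation d n ℓ
  have hint : ∀ t : ℝ, G.U t f = f + ∫ s in (0 : ℝ)..t, G.U s h := by
    intro t
    refine ext_apply fun x => ?_
    have hi : IntervalIntegrable (fun s => G.U s h) volume 0 t :=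
      (G.continuous_U h).intervalIntegrable _ _
    have e1 : (∫ s in (0 : ℝ)..t, G.U s h) x = ∫ s in (0 : ℝ)..t, G.U s h x :=
      (((eval x).restrictScalars ℝ).intervalIntegral_comp_comm hi).symm
    have hd : ∀ s ∈ uIcc (0 : ℝ) t, HasDerivAt (fun r => G.U r f x) (G.U s h x) s := by
      intro s _
      have h1 := hf (x + s • EuclideanSpace.single ℓ 1)
      rw [HasLineDerivAt] at h1
      have h2 : HasDerivAt (fun r : ℝ => r - s) 1 s := (hasDerivAt_id s).sub_const s
      have h3 := HasDerivAt.scomp_of_eq s h1 h2 (sub_self s).symm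
      rw [one_smul] at h3
      rw [translation_apply]
      refine h3.congr_of_eventuallyEq (Eventually.of_forall fun r => ?_)
      change G.U r f x = f (x + s • EuclideanSpace.single ℓ 1 + (r - s) • EuclideanSpace.single ℓ 1)
      rw [translation_apply, add_assoc, ← add_smul, add_sub_cancel]
    have e2 := intervalIntegral.integral_eq_sub_of_hasDerivAt hd
      (((eval x).continuous.comp (G.continuous_U h)).intervalIntegrable _ _)
    rw [add_apply', e1, e2, G.U_zero]
    abel
  have h1 : HasDerivAt (fun t => G.U t (smoothing d n f)) (smoothing d n h) 0 := by
    have h2 : HasDerivAt (fun t => f + ∫ s in (0 : ℝ)..t, G.U s h) (G.U 0 h) 0 :=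
      (intervalIntegral.integral_hasDerivAt_right ((G.continuous_U h).intervalIntegrable _ _)
        ((G.continuous_U h).stronglyMeasurableAtFilter _ _)
        (G.continuous_U h).continuousAt).const_add f
    rw [G.U_zero] at h2
    have h3 := (((smoothing d n).restrictScalars ℝ).hasFDerivAt).comp_hasDerivAt (0 : ℝ) h2
    refine h3.congr_of_eventuallyEq (Eventually.of_forall fun t => ?_)
    change G.U t (smoothing d n f) = smoothing d n (f + ∫ s in (0 : ℝ)..t, G.U s h)
    rw [← hint]
    exact G.U_J t f
  have h4 := (G.hasDerivAt f 0).unique h1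
  rw [G.U_zero] at h4
  exact h4

/-- The symbol `-i sign k_ℓ`. -/
def signSymbol (d n : ℕ) (ℓ : Fin d) : BddSymbol d (State n) (State n) :=
  scalarSymbol (State n) (fun k => if 0 ≤ k ℓ then -I else I)
    ((Measurable.ite (measurableSet_le measurable_const (by fun_prop)) measurable_const
      measurable_const).aestronglyMeasurable)
    ⟨1, fun k => by split_ifs <;> simp⟩

/-- The preimage of `f` under the smoothing operator, in terms of `f` and its partial
derivatives. -/
def desmooth (f : Wiener d n) (h : Fin d → Wiener d n) : Wiener d n :=
  f + ∑ ℓ, mul (signSymbol d n ℓ) (h ℓ)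

theorem coeFn_fourier_sum (h : Fin d → Wiener d n) :
    ((∑ ℓ, h ℓ).fourier : Space d → State n) =ᵐ[volume] fun k => ∑ ℓ, (h ℓ).fourier k := by
  have : (∑ ℓ, h ℓ).fourier = ∑ ℓ, (h ℓ).fourier := map_sum (fourierIso (d := d) (n := n)) h _
  rw [this]
  filter_upwards [Lp.coeFn_finsetSum Finset.univ fun ℓ => (h ℓ).fourier] with k hk
  rw [hk, Finset.sum_apply]

/-- The weight is `1 + ∑ |k_ℓ|`, and `|k_ℓ| = (-i sign k_ℓ)(i k_ℓ)` expresses its summands by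
partial derivatives and bounded multipliers. An `ℓ¹` weight makes this decomposition exact. -/
theorem smoothing_desmooth {f : Wiener d n} {h : Fin d → Wiener d n}
    (hf : ∀ ℓ, IsPartial ℓ f (h ℓ)) : smoothing d n (desmooth f h) = f := by
  have h0 : ∀ᵐ k, ∀ ℓ, ((mul (signSymbol d n ℓ) (h ℓ)).fourier : Space d → State n) k
      = ((|k ℓ| : ℝ) : ℂ) • f.fourier k := by
    rw [ae_all_iff]
    intro ℓ
    have e := partialJ_eq_of_isPartial (hf ℓ)
    filter_upwards [coeFn_fourier_mul (signSymbol d n ℓ) (h ℓ), coeFn_fourier_partialJ ℓ f,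
      coeFn_fourier_smoothing (h ℓ)] with k h1 h2 h3
    rw [e, h3, mul_smul] at h2
    have h4 := smul_right_injective _ (inv_ne_zero (weight_ne_zero k)) h2
    rw [h1, h4]
    change (if 0 ≤ k ℓ then -I else I) • ((I * (k ℓ : ℂ)) • f.fourier k) = _
    rw [smul_smul]
    congr 1
    split_ifs with hk
    · rw [abs_of_nonneg hk]
      linear_combination (-(k ℓ : ℂ)) * I_mul_I
    · rw [abs_of_neg (not_le.1 hk)]
      push_cast
      linear_combination ((k ℓ : ℂ)) * I_mul_I
  apply ext_fourier
  filter_upwards [coeFn_fourier_smoothing (desmooth f h),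
    coeFn_fourier_add f (∑ ℓ, mul (signSymbol d n ℓ) (h ℓ)),
    coeFn_fourier_sum fun ℓ => mul (signSymbol d n ℓ) (h ℓ), h0] with k h1 h2 h3 h4
  rw [h1, desmooth, h2, h3, Finset.sum_congr rfl fun ℓ _ => h4 ℓ, ← Finset.sum_smul]
  nth_rewrite 1 [← one_smul ℂ ((f.fourier : Space d → State n) k)]
  rw [← add_smul, smul_smul]
  have : (1 : ℂ) + ∑ ℓ, ((|k ℓ| : ℝ) : ℂ) = (weight k : ℂ) := by
    rw [weight]
    push_cast
    rfl
  rw [this, inv_mul_cancel₀ (weight_ne_zero k), one_smul]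

theorem exists_smoothing_of_memW_one {f : Wiener d n} (hf : MemW 1 f) :
    ∃ y, f = smoothing d n y := by
  choose h hh using hf
  exact ⟨desmooth f h, (smoothing_desmooth fun ℓ => (hh ℓ).1).symm⟩

theorem exists_smoothing_of_memW_two {f : Wiener d n} (hf : MemW 2 f) :
    ∃ y, f = smoothing d n (smoothing d n y) := by
  have h1 : MemW 1 f := fun ℓ => by
    obtain ⟨h, hh, _⟩ := hf ℓ
    exact ⟨h, hh, trivial⟩
  choose h hh using hf
  obtain ⟨y, hy⟩ := exists_smoothing_of_memW_one h1
  choose z hz using fun ℓ => exists_smoothing_of_memW_one (hh ℓ).2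
  refine ⟨y + ∑ ℓ, mul (signSymbol d n ℓ) (z ℓ), ?_⟩
  -- First `f = J (desmooth f h)`. Since `f` and all `h ℓ` lie in the range of `J`, and `J` commutes
  -- with the sign multipliers, a second factor `J` comes out.
  conv_lhs => rw [← smoothing_desmooth fun ℓ => (hh ℓ).1]
  congr 1
  rw [desmooth, map_add, map_sum, ← hy]
  congr 1
  refine Finset.sum_congr rfl fun ℓ _ => ?_
  rw [hz ℓ]
  exact mul_mul_congr (fun k v => ((signSymbol d n ℓ).toFun k).map_smul ((weight k)⁻¹ : ℂ) v) _

/-- Regularity of curves in the range of a power of the smoothing operator. -/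
theorem inCW_of_eq_smoothing_pow {m s : ℕ} {S : Set ℝ} {u w : ℝ → Wiener d n}
    (hu : ∀ t ∈ S, u t = (smoothing d n ^ s) (w t)) (hw : ContDiffOn ℝ m w S) :
    InCW m s S u := by
  induction s generalizing u w with
  | zero => exact hw.congr hu
  | succ s ih =>
    refine ⟨?_, fun ℓ => ⟨fun t => (smoothing d n ^ s) (partialJ ℓ (w t)), fun t ht => ?_, ?_⟩⟩
    · exact ((((smoothing d n ^ (s + 1)).restrictScalars ℝ).contDiff).comp_contDiffOn hw).congr hu
    · have hcomm : ∀ (r : ℕ) (q : Wiener d n), (smoothing d n ^ r) (partialJ ℓ q)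
          = partialJ ℓ ((smoothing d n ^ r) q) := by
        intro r
        induction r with
        | zero => intro q; rfl
        | succ r ihr =>
          intro q
          rw [pow_succ]
          change (smoothing d n ^ r) (smoothing d n (partialJ ℓ q))
            = partialJ ℓ ((smoothing d n ^ r) (smoothing d n q))
          rw [← partialJ_smoothing, ihr]
      have h1 : u t = smoothing d n ((smoothing d n ^ s) (w t)) := by
        rw [hu t ht, pow_succ']
        rfl
      rw [h1]
      change IsPartial ℓ _ ((smoothing d n ^ s) (partialJ ℓ (w t)))
      rw [hcomm]
      exact isPartial_smoothing ℓ _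
    · exact ih (fun t _ => rfl) (((partialJ ℓ).restrictScalars ℝ).contDiff.comp_contDiffOn hw)

theorem InCW.of_le {m m' s : ℕ} {S : Set ℝ} {u : ℝ → Wiener d n} (hm : m' ≤ m)
    (hu : InCW m s S u) : InCW m' s S u := by
  induction s generalizing u with
  | zero => exact ContDiffOn.of_le hu (by exact_mod_cast hm)
  | succ s ih =>
    refine ⟨hu.1.of_le (by exact_mod_cast hm), fun ℓ => ?_⟩
    obtain ⟨v, hv, hw⟩ := hu.2 ℓ
    exact ⟨v, hv, ih hw⟩

/-- A continuous curve in `W¹` is the image of a continuous curve under the smoothing operator. -/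
theorem exists_curve_of_inCW {S : Set ℝ} {u : ℝ → Wiener d n} (hu : InCW 0 1 S u) :
    ∃ y : ℝ → Wiener d n, ∀ t ∈ S, u t = smoothing d n (y t) := by
  obtain ⟨_, h⟩ := hu
  choose v hv using h
  exact ⟨fun t => desmooth (u t) fun ℓ => v ℓ t,
    fun t ht => (smoothing_desmooth fun ℓ => (hv ℓ).1 t ht).symm⟩

end Wiener

variable {d n : ℕ} {A : Fin d → Matrix (Fin n) (Fin n) ℝ} {E : Matrix (Fin n) (Fin n) ℝ}

theorem I_smul_spatial (f : Wiener d n) : I • Wiener.mul (spatialSymbol A) f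
    = ∑ ℓ, Wiener.const (opMatrix (cMatrix (A ℓ))) (Wiener.partialJ ℓ f) := by
  have h0 : ∀ᵐ k, ∀ ℓ, ((Wiener.const (opMatrix (cMatrix (A ℓ))) (Wiener.partialJ ℓ f)).fourier :
      Space d → State n) k
      = (((weight k)⁻¹ : ℂ) * (I * (k ℓ : ℂ))) • opMatrix (cMatrix (A ℓ)) (f.fourier k) := by
    rw [ae_all_iff]
    intro ℓ
    filter_upwards [Wiener.coeFn_fourier_const (opMatrix (cMatrix (A ℓ))) (Wiener.partialJ ℓ f),
      Wiener.coeFn_fourier_partialJ ℓ f] with k h1 h2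
    rw [h1, h2, map_smul]
  apply Wiener.ext_fourier
  filter_upwards [h0, Wiener.coeFn_fourier_smul I (Wiener.mul (spatialSymbol A) f),
    Wiener.coeFn_fourier_mul (spatialSymbol A) f, Wiener.coeFn_fourier_sum fun ℓ =>
      Wiener.const (opMatrix (cMatrix (A ℓ))) (Wiener.partialJ ℓ f)] with k h1 h2 h3 h4
  rw [h2, h3, h4, Finset.sum_congr rfl fun ℓ _ => h1 ℓ, spatialSymbol_apply, opMatrix_symbolA,
    sum_apply, Finset.smul_sum, Finset.smul_sum]
  refine Finset.sum_congr rfl fun ℓ _ => ?_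
  rw [smul_apply, smul_smul, smul_smul]
  congr 1
  ring

/-- The spatial part of the envelope equation in terms of the generator. -/
theorem spatial_part_eq (hA : ∀ ℓ, (A ℓ).IsSymm) (hE : E.transpose = -E) (ε α : ℝ) (β : Space d)
    (y : Wiener d n) (x : Space d) :
    (I / (ε : ℂ)) • Matrix.toEuclideanLin (symbolL A E α β) (Wiener.smoothing d n y x)
      + ∑ ℓ, Matrix.toEuclideanLin (cMatrix (A ℓ)) (lineDeriv ℝ
        (Wiener.smoothing d n y : Space d → State n) x (EuclideanSpace.single ℓ 1))
      = (-(waveSymbol hA hE ε α β).group.gen y) x := by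
  rw [gen_waveSymbol, neg_neg, smul_add, I_smul_spatial, Wiener.add_apply', ← Complex.coe_smul,
    Wiener.smul_apply', Wiener.smul_apply', Wiener.const_apply, smul_smul, ofReal_inv]
  congr 1
  have h : (∑ ℓ, Wiener.const (opMatrix (cMatrix (A ℓ))) (Wiener.partialJ ℓ y)) x
      = ∑ ℓ, Wiener.const (opMatrix (cMatrix (A ℓ))) (Wiener.partialJ ℓ y) x :=
    map_sum (Wiener.eval x) _ _
  rw [h]
  refine Finset.sum_congr rfl fun ℓ _ => ?_
  rw [Wiener.const_apply, (Wiener.isPartial_smoothing ℓ y x).lineDeriv]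
  rfl

end PartialDerivatives

/-! ### Duhamel's formula and time regularity. -/

section GroupRegularity

set_option maxSynthPendingDepth 3

open Set Filter Topology

namespace RegularGroup

variable {Y : Type*} [NormedAddCommGroup Y] [NormedSpace ℝ Y] {J : Y →L[ℝ] Y} (g : RegularGroup J)

/-- The variation-of-constants formula in the moving frame. -/
theorem duhamel_iff [CompleteSpace Y] {ε t : ℝ} {u N : ℝ → Y}
    (hN : IntervalIntegrable (fun s => g.U (-s) (N s)) volume 0 t) :
    u t = g.U t (u 0) + ε • ∫ s in (0 : ℝ)..t, g.U (t - s) (N s) ↔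
      g.U (-t) (u t) = u 0 + ∫ s in (0 : ℝ)..t, ε • g.U (-s) (N s) := by
  have h1 : ∫ s in (0 : ℝ)..t, g.U (t - s) (N s) = g.U t (∫ s in (0 : ℝ)..t, g.U (-s) (N s)) := by
    rw [← (g.U t).intervalIntegral_comp_comm hN]
    refine intervalIntegral.integral_congr fun s _ => ?_
    change g.U (t - s) (N s) = g.U t (g.U (-s) (N s))
    rw [← g.U_add, sub_eq_add_neg]
  rw [h1, intervalIntegral.integral_smul, ← map_smul, ← map_add]
  constructor
  · intro h
    rw [h, g.U_neg_U]
  · intro h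
    rw [← h, g.U_U_neg]

variable {M₀ M₁ M₂ : Y →L[ℝ] Y →L[ℝ] Y →L[ℝ] Y} {ε : ℝ} {z : ℝ → Y} {S : Set ℝ}

/-- For `u = J U J z` the left-hand side is `∂_t u` minus the generator applied to `u`. This
recovers the equation in the original frame. -/
theorem J_U_velocity (hM₁ : ∀ a b c, J (M₂ a b c) = M₁ (J a) (J b) (J c))
    (hM₀ : ∀ a b c, J (M₁ a b c) = M₀ (J a) (J b) (J c)) (t : ℝ) :
    J (g.U t (g.velocity M₂ ε z t)) - g.gen (g.U t (J (z t)))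
      = ε • M₀ (J (g.U t (J (z t)))) (J (g.U t (J (z t)))) (J (g.U t (J (z t)))) := by
  rw [velocity, map_add, map_add, g.U_gen, g.U_J t (z t), g.gen_J, add_sub_cancel_right,
    g.J_cubicField hM₁, ← g.U_J, g.J_cubicField hM₀, cubicField, map_smul, g.U_U_neg, g.U_J, g.U_J]

theorem contDiffOn_one_U_J (hS : UniqueDiffOn ℝ S)
    (hM₁ : ∀ a b c, J (M₂ a b c) = M₁ (J a) (J b) (J c))
    (hz : ∀ t ∈ S, HasDerivWithinAt z (cubicField g.U M₂ ε t (z t)) S t) :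
    ContDiffOn ℝ 1 (fun s => g.U s (J (z s))) S :=
  contDiffOn_one_of_hasDerivWithinAt hS (fun t ht => g.hasDerivWithinAt_U_J (hz t ht))
    (g.continuousOn_U_apply fun t ht =>
      (g.hasDerivWithinAt_velocity hM₁ (hz t ht)).continuousWithinAt)

/-- Each time derivative costs one factor `J`. The first derivative is `U J` applied to the
velocity, which is itself differentiable, so the remaining `J` allows a second differentiation. -/
theorem contDiffOn_two_J_U_J (hS : UniqueDiffOn ℝ S)
    (hM₁ : ∀ a b c, J (M₂ a b c) = M₁ (J a) (J b) (J c))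
    (hz : ∀ t ∈ S, HasDerivWithinAt z (cubicField g.U M₂ ε t (z t)) S t) :
    ContDiffOn ℝ 2 (fun s => J (g.U s (J (z s)))) S := by
  have hv := fun t (ht : t ∈ S) => g.hasDerivWithinAt_velocity hM₁ (hz t ht)
  refine contDiffOn_two_of_hasDerivWithinAt hS
    (f' := fun t => g.U t (J (g.velocity M₂ ε z t)))
    (f'' := fun t => g.U t (J (g.acceleration M₁ M₂ ε z t) + g.gen (g.velocity M₂ ε z t)))
    (fun t ht => ?_) (fun t ht => ?_) ?_
  · rw [g.U_J]
    exact J.hasFDerivAt.comp_hasDerivWithinAt t (g.hasDerivWithinAt_U_J (hz t ht))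
  · exact g.hasDerivWithinAt_U_apply (J.hasFDerivAt.comp_hasDerivWithinAt t (hv t ht)) rfl
  · exact g.continuousOn_U_apply
      ((J.continuous.comp_continuousOn (g.continuousOn_acceleration hM₁ hz)).add
        (g.gen.continuous.comp_continuousOn fun t ht => (hv t ht).continuousWithinAt))

end RegularGroup

end GroupRegularity

/-! ### Mild solutions of the original problem. -/

section MildSolutions

set_option maxSynthPendingDepth 3

open Set Filter Topology

variable {d n : ℕ} {A : Fin d → Matrix (Fin n) (Fin n) ℝ} {E : Matrix (Fin n) (Fin n) ℝ}
  {T : (Fin n → ℝ) →ₗ[ℝ] (Fin n → ℝ) →ₗ[ℝ] (Fin n → ℝ) →ₗ[ℝ] (Fin n → ℝ)} {ω : ℝ} {κ : Space d}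
  {p : Wiener d n} {ε τ : ℝ}

/-- The nonlinearity of the original problem. -/
abbrev cubicTerm (d : ℕ) (T : (Fin n → ℝ) →ₗ[ℝ] (Fin n → ℝ) →ₗ[ℝ] (Fin n → ℝ) →ₗ[ℝ] (Fin n → ℝ)) :
    Wiener d n →L[ℝ] Wiener d n →L[ℝ] Wiener d n →L[ℝ] Wiener d n :=
  Wiener.tri 0 (trilinearCLM T)

theorem cubicTerm_apply (f g h : Wiener d n) (x : Space d) :
    cubicTerm d T f g h x = trilinearExt T (f x) (g x) (h x) := by
  rw [cubicTerm, Wiener.tri_zero_apply, trilinearCLM_apply]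

/-- The initial value of the original problem. -/
def initialWave (ω : ℝ) (κ : Space d) (ε : ℝ) (p : Wiener d n) : Wiener d n :=
  carrier ω κ ε 1 0 p + Wiener.conj d n (carrier ω κ ε 1 0 p)

theorem initialWave_apply (ω : ℝ) (κ : Space d) (ε : ℝ) (p : Wiener d n) (x : Space d) :
    initialWave ω κ ε p x = cexp (I * ((⟪κ, x⟫_ℝ / ε : ℝ) : ℂ)) • p x
      + conjState (cexp (I * ((⟪κ, x⟫_ℝ / ε : ℝ) : ℂ)) • p x) := by
  rw [initialWave, Wiener.add_apply', Wiener.conj_apply, carrier_apply]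
  simp

theorem norm_initialWave_le (ω : ℝ) (κ : Space d) (ε : ℝ) (p : Wiener d n) :
    ‖initialWave ω κ ε p‖ ≤ 2 * ‖p‖ := by
  have h := norm_carrier_le ω κ ε 1 0 p
  refine (norm_add_le _ _).trans ?_
  linarith [(Wiener.norm_conj_le (carrier ω κ ε 1 0 p)).trans h]

theorem conj_initialWave (ω : ℝ) (κ : Space d) (ε : ℝ) (p : Wiener d n) :
    Wiener.conj d n (initialWave ω κ ε p) = initialWave ω κ ε p := by
  rw [initialWave, map_add, Wiener.conj_conj, add_comm]

theorem continuousOn_cubicTerm {u : ℝ → Wiener d n} {S : Set ℝ} (hu : ContinuousOn u S) :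
    ContinuousOn (fun s => cubicTerm d T (u s) (u s) (u s)) S :=
  (((cubicTerm d T).continuous.comp_continuousOn hu).clm_apply hu).clm_apply hu

/-- The group of the original problem. -/
abbrev waveGroup (hA : ∀ ℓ, (A ℓ).IsSymm) (hE : E.transpose = -E) (ε : ℝ) :
    RegularGroup ((Wiener.smoothing d n).restrictScalars ℝ) := (waveSymbol hA hE ε 0 0).group

/-- Mild solutions in the moving frame. -/
theorem isMildSolution_iff (hA : ∀ ℓ, (A ℓ).IsSymm) (hE : E.transpose = -E) (ω : ℝ)
    {u : ℝ → Wiener d n} : IsMildSolution A E T κ p ε τ u ↔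
      u 0 = initialWave ω κ ε p ∧ ∀ t ∈ Icc 0 τ,
        HasDerivWithinAt (fun s => (waveGroup hA hE ε).U (-s) (u s))
          (cubicField (waveGroup hA hE ε).U (cubicTerm d T) ε t
            ((waveGroup hA hE ε).U (-t) (u t))) (Icc 0 τ) t := by
  have hG : ∀ t f, propagator A E ε t f = (waveGroup hA hE ε).U t f := propagator_eq hA hE ε
  have hcf : ∀ s, cubicField (waveGroup hA hE ε).U (cubicTerm d T) ε s
      ((waveGroup hA hE ε).U (-s) (u s))
      = ε • (waveGroup hA hE ε).U (-s) (cubicTerm d T (u s) (u s) (u s)) := fun s => by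
    rw [cubicField, (waveGroup hA hE ε).U_U_neg]
  have hint : ∀ (N : ℝ → Wiener d n), ContinuousOn N (Icc 0 τ) → ∀ t ∈ Icc 0 τ,
      IntervalIntegrable (fun s => (waveGroup hA hE ε).U (-s) (N s)) volume 0 t := by
    intro N hN t ht
    refine ContinuousOn.intervalIntegrable ?_
    rw [uIcc_of_le ht.1]
    exact ((waveGroup hA hE ε).continuousOn_U_neg_apply hN).mono (Icc_subset_Icc_right ht.2)
  simp only [hcf]
  constructor
  · intro h
    refine ⟨Wiener.ext_apply fun x => (h.initial x).trans (initialWave_apply ω κ ε p x).symm, ?_⟩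
    obtain ⟨N, hN, hd⟩ := h.duhamel
    have hNeq : EqOn N (fun s => cubicTerm d T (u s) (u s) (u s)) (Icc 0 τ) := fun s hs =>
      Wiener.ext_apply fun x => (hN s hs x).trans (cubicTerm_apply _ _ _ x).symm
    have hc := continuousOn_cubicTerm (T := T) h.continuousOn
    refine hasDerivWithinAt_of_eq_add_integral (c := u 0)
      (((waveGroup hA hE ε).continuousOn_U_neg_apply hc).const_smul ε) fun t ht => ?_
    refine ((waveGroup hA hE ε).duhamel_iff (hint _ hc t ht)).1 ?_
    have e := hd t ht
    simp only [hG] at e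
    refine e.trans ?_
    congr 1
    rw [Complex.coe_smul]
    congr 1
    refine intervalIntegral.integral_congr fun s hs => ?_
    rw [uIcc_of_le ht.1] at hs
    exact congrArg _ (hNeq (Icc_subset_Icc_right ht.2 hs))
  · rintro ⟨h0, hd⟩
    have huc : ContinuousOn u (Icc 0 τ) := by
      have h1 := (waveGroup hA hE ε).continuousOn_U_apply fun t ht => (hd t ht).continuousWithinAt
      simpa only [(waveGroup hA hE ε).U_U_neg] using h1
    have hc := continuousOn_cubicTerm (T := T) huc
    refine ⟨huc, fun x => by rw [h0, initialWave_apply], fun s => cubicTerm d T (u s) (u s) (u s),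
      fun s _ x => cubicTerm_apply _ _ _ x, fun t ht => ?_⟩
    have e := eq_add_integral_of_hasDerivWithinAt
      (fun t ht => (hd t ht).continuousWithinAt)
      (((waveGroup hA hE ε).continuousOn_U_neg_apply hc).const_smul ε)
      (fun t ht => hd t (Ioo_subset_Icc_self ht)) t ht
    rw [neg_zero, (waveGroup hA hE ε).U_zero] at e
    have e2 := ((waveGroup hA hE ε).duhamel_iff (hint _ hc t ht)).2 e
    simp only [hG]
    exact e2

theorem mild_solution_unique (hA : ∀ ℓ, (A ℓ).IsSymm) (hE : E.transpose = -E) (hε : 0 < ε)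
    {u v : ℝ → Wiener d n} (hu : IsMildSolution A E T κ p ε τ u)
    (hv : IsMildSolution A E T κ p ε τ v) : EqOn v u (Icc 0 τ) := by
  -- The initial wave involves the carrier at time `0` only, so any value of `ω` serves.
  obtain ⟨hu0, hu'⟩ := (isMildSolution_iff hA hE 0).1 hu
  obtain ⟨hv0, hv'⟩ := (isMildSolution_iff hA hE 0).1 hv
  have h := cubic_solution_unique (V := (waveGroup hA hE ε).U)
    (fun t y => ((waveGroup hA hE ε).norm_U t y).le) (waveGroup hA hE ε).continuous_U
    (cubicTerm d T) hε
    (fun t ht => (hv' t ht).continuousWithinAt) (fun t ht => (hu' t ht).continuousWithinAt)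
    (fun t ht => hv' t (Ioo_subset_Icc_self ht)) (fun t ht => hu' t (Ioo_subset_Icc_self ht))
    (by rw [hu0, hv0])
  intro t ht
  have e := congrArg ((waveGroup hA hE ε).U t) (h ht)
  simpa only [(waveGroup hA hE ε).U_U_neg] using e

/-- The conjugate is a mild solution with the same real initial value; uniqueness identifies it with
the solution. -/
theorem mild_solution_real (hA : ∀ ℓ, (A ℓ).IsSymm) (hE : E.transpose = -E) (hε : 0 < ε)
    {u : ℝ → Wiener d n} (hu : IsMildSolution A E T κ p ε τ u) :
    ∀ t ∈ Icc 0 τ, ∀ x i, (u t x i).im = 0 := by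
  obtain ⟨hu0, hu'⟩ := (isMildSolution_iff hA hE 0).1 hu
  have hCU : ∀ t f, (waveGroup hA hE ε).U t (Wiener.conj d n f)
      = Wiener.conj d n ((waveGroup hA hE ε).U t f) :=
    fun t f => (conj_U hA hE ε t f).symm
  have hCT : ∀ a b c : Wiener d n, Wiener.conj d n (cubicTerm d T a b c)
      = cubicTerm d T (Wiener.conj d n a) (Wiener.conj d n b) (Wiener.conj d n c) :=
    fun a b c => Wiener.ext_apply fun x => by
      rw [Wiener.conj_apply, cubicTerm_apply, cubicTerm_apply, conjState_trilinearExt,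
        Wiener.conj_apply, Wiener.conj_apply, Wiener.conj_apply]
  have hc : IsMildSolution A E T κ p ε τ (fun t => Wiener.conj d n (u t)) := by
    refine (isMildSolution_iff hA hE 0).2 ⟨?_, fun t ht => ?_⟩
    · rw [hu0, conj_initialWave]
    · have h := (Wiener.conj d n).hasFDerivAt.comp_hasDerivWithinAt t (hu' t ht)
      refine (h.congr_of_eventuallyEq (Eventually.of_forall fun s => hCU _ _) (hCU _ _)).congr_deriv
        ?_
      simp only [cubicField, map_smul, ← hCU, hCT]
  intro t ht x i
  have h := mild_solution_unique hA hE hε hu hc ht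
  have h1 : conjState (u t x) i = u t x i := by
    rw [← Wiener.conj_apply]
    exact congrFun (congrArg (fun f : Wiener d n => (f x).ofLp) h) i
  exact conj_eq_iff_im.1 h1

end MildSolutions

/-! ### Classical solutions of the envelope system. -/

section EnvelopeSolutions

set_option maxSynthPendingDepth 3

open Set Filter Topology

variable {d n : ℕ} {A : Fin d → Matrix (Fin n) (Fin n) ℝ} {E : Matrix (Fin n) (Fin n) ℝ}
  {T : (Fin n → ℝ) →ₗ[ℝ] (Fin n → ℝ) →ₗ[ℝ] (Fin n → ℝ) →ₗ[ℝ] (Fin n → ℝ)} {ω : ℝ} {κ : Space d}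
  {p : Wiener d n} {ε τ : ℝ}

theorem amplitude_conj_apply (j : ℤ) (y : Wiener d n × Wiener d n) (x : Space d) :
    amplitude (Wiener.conj d n) j y x = envelope (y.1 x) (y.2 x) j := by
  unfold amplitude envelope
  split_ifs
  · rfl
  · rfl
  · exact Wiener.conj_apply _ _
  · exact Wiener.conj_apply _ _
  · rfl

theorem amplitudeCubic_cubicTerm_apply (j : ℤ) (y : Wiener d n × Wiener d n) (x : Space d) :
    amplitudeCubic (cubicTerm d T) (Wiener.conj d n) j y y y x
      = envelopeNonlinearity T (y.1 x) (y.2 x) j := by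
  rw [amplitudeCubic_apply, envelopeNonlinearity]
  refine (map_sum (Wiener.eval x) _ _).trans (Finset.sum_congr rfl fun J _ => ?_)
  rw [Wiener.eval_apply, cubicTerm_apply, amplitude_conj_apply, amplitude_conj_apply,
    amplitude_conj_apply]

/-- The nonlinearity of the envelope system. -/
abbrev envelopeTerm (d : ℕ)
    (T : (Fin n → ℝ) →ₗ[ℝ] (Fin n → ℝ) →ₗ[ℝ] (Fin n → ℝ) →ₗ[ℝ] (Fin n → ℝ)) :
    Wiener d n × Wiener d n →L[ℝ] Wiener d n × Wiener d n →L[ℝ] Wiener d n × Wiener d n →L[ℝ]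
      Wiener d n × Wiener d n :=
  envelopeCubic (cubicTerm d T) (Wiener.conj d n)

/-- The smoothing operator on pairs. -/
abbrev pairSmoothing (d n : ℕ) : Wiener d n × Wiener d n →L[ℝ] Wiener d n × Wiener d n :=
  ((Wiener.smoothing d n).restrictScalars ℝ).prodMap ((Wiener.smoothing d n).restrictScalars ℝ)

/-- The group of an amplitude. -/
abbrev amplitudeGroup (hA : ∀ ℓ, (A ℓ).IsSymm) (hE : E.transpose = -E) (ω : ℝ) (κ : Space d)
    (ε : ℝ) (j : ℤ) : RegularGroup ((Wiener.smoothing d n).restrictScalars ℝ) :=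
  (waveSymbol hA hE ε (j * ω) ((j : ℝ) • κ)).group

/-- The group of the envelope system. -/
abbrev envelopeGroup (hA : ∀ ℓ, (A ℓ).IsSymm) (hE : E.transpose = -E) (ω : ℝ) (κ : Space d)
    (ε : ℝ) : RegularGroup (pairSmoothing d n) :=
  (amplitudeGroup hA hE ω κ ε 1).prod (amplitudeGroup hA hE ω κ ε 3)

theorem pairSmoothing_envelopeCubic (s : ℕ)
    (T : State n →L[ℂ] State n →L[ℂ] State n →L[ℂ] State n) (a b c : Wiener d n × Wiener d n) :
    pairSmoothing d n (envelopeCubic (Wiener.tri (s + 1) T) (Wiener.conj d n) a b c)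
      = envelopeCubic (Wiener.tri s T) (Wiener.conj d n) (pairSmoothing d n a)
        (pairSmoothing d n b) (pairSmoothing d n c) :=
  map_envelopeCubic (J := (Wiener.smoothing d n).restrictScalars ℝ) Wiener.smoothing_conj
    (Wiener.smoothing_tri s T) a b c

/-- The envelope equation at a given time in terms of the generator. -/
theorem envelope_equation_iff (hA : ∀ ℓ, (A ℓ).IsSymm) (hE : E.transpose = -E) (j : ℤ)
    {v' y : Wiener d n} {v : Wiener d n × Wiener d n} :
    (∀ x, v' x + (I / (ε : ℂ)) • Matrix.toEuclideanLin
            (symbolL A E ((j : ℝ) * ω) ((j : ℝ) • κ)) (Wiener.smoothing d n y x)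
        + ∑ ℓ, Matrix.toEuclideanLin (cMatrix (A ℓ)) (lineDeriv ℝ
          (Wiener.smoothing d n y : Space d → State n) x (EuclideanSpace.single ℓ 1))
      = (ε : ℂ) • envelopeNonlinearity T (v.1 x) (v.2 x) j) ↔
    v' - (amplitudeGroup hA hE ω κ ε j).gen y
      = ε • amplitudeCubic (cubicTerm d T) (Wiener.conj d n) j v v v := by
  have h : ∀ x, v' x + (I / (ε : ℂ)) • Matrix.toEuclideanLin
        (symbolL A E ((j : ℝ) * ω) ((j : ℝ) • κ)) (Wiener.smoothing d n y x)
      + ∑ ℓ, Matrix.toEuclideanLin (cMatrix (A ℓ)) (lineDeriv ℝ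
        (Wiener.smoothing d n y : Space d → State n) x (EuclideanSpace.single ℓ 1))
      = (v' - (amplitudeGroup hA hE ω κ ε j).gen y) x := fun x => by
    rw [add_assoc, spatial_part_eq hA hE, sub_eq_add_neg]
    rfl
  have h' : ∀ x, (ε : ℂ) • envelopeNonlinearity T (v.1 x) (v.2 x) j
      = (ε • amplitudeCubic (cubicTerm d T) (Wiener.conj d n) j v v v) x := fun x => by
    rw [← amplitudeCubic_cubicTerm_apply]
    rfl
  simp only [h, h']
  exact ⟨fun e => Wiener.ext_apply e, fun e x => by rw [e]⟩

/-- Classical solutions of the envelope system solve its equation in the moving frame. -/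
theorem IsClassicalEnvelopeSolution.hasDerivWithinAt (hA : ∀ ℓ, (A ℓ).IsSymm)
    (hE : E.transpose = -E) {v₁ v₃ : ℝ → Wiener d n}
    (hv : IsClassicalEnvelopeSolution A E T ω κ p ε τ v₁ v₃) :
    ContinuousOn (fun t => (envelopeGroup hA hE ω κ ε).U (-t) (v₁ t, v₃ t)) (Icc 0 τ) ∧
    ∀ t ∈ Ioo 0 τ, HasDerivWithinAt (fun t => (envelopeGroup hA hE ω κ ε).U (-t) (v₁ t, v₃ t))
      (cubicField (envelopeGroup hA hE ω κ ε).U (envelopeTerm d T) ε t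
        ((envelopeGroup hA hE ω κ ε).U (-t) (v₁ t, v₃ t))) (Icc 0 τ) t := by
  obtain ⟨r₁, r₁'⟩ := hv.regular v₁ (by simp)
  obtain ⟨r₃, r₃'⟩ := hv.regular v₃ (by simp)
  have c₁ : ContDiffOn ℝ 1 v₁ (Icc 0 τ) := r₁
  have c₃ : ContDiffOn ℝ 1 v₃ (Icc 0 τ) := r₃
  obtain ⟨y₁, hy₁⟩ := Wiener.exists_curve_of_inCW r₁'
  obtain ⟨y₃, hy₃⟩ := Wiener.exists_curve_of_inCW r₃'
  refine ⟨(envelopeGroup hA hE ω κ ε).continuousOn_U_neg_apply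
    (c₁.continuousOn.prodMk c₃.continuousOn), fun t ht => ?_⟩
  have ht' : t ∈ Icc 0 τ := Ioo_subset_Icc_self ht
  have d₁ := (c₁.differentiableOn one_ne_zero t ht').hasDerivWithinAt
  have d₃ := (c₃.differentiableOn one_ne_zero t ht').hasDerivWithinAt
  -- Continuity in `W¹` enters here: the values are in the range of `J`, so the group can be
  -- differentiated along the curve.
  have h := (envelopeGroup hA hE ω κ ε).hasDerivWithinAt_U_neg_apply (f := (y₁ t, y₃ t))
    (d₁.prodMk d₃) (Prod.ext (hy₁ t ht') (hy₃ t ht'))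
  have e₁ := hv.equation (1, v₁) (by simp) t ⟨ht.1, ht.2.le⟩
  have e₃ := hv.equation (3, v₃) (by simp) t ⟨ht.1, ht.2.le⟩
  have f₁ := (envelope_equation_iff (ε := ε) (ω := ω) (κ := κ) (T := T) hA hE 1
    (v' := derivWithin v₁ (Icc 0 τ) t) (y := y₁ t) (v := (v₁ t, v₃ t))).1
    (by rw [← hy₁ t ht']; exact e₁)
  have f₃ := (envelope_equation_iff (ε := ε) (ω := ω) (κ := κ) (T := T) hA hE 3
    (v' := derivWithin v₃ (Icc 0 τ) t) (y := y₃ t) (v := (v₁ t, v₃ t))).1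
    (by rw [← hy₃ t ht']; exact e₃)
  refine h.congr_deriv ?_
  rw [cubicField, (envelopeGroup hA hE ω κ ε).U_U_neg, ← map_smul, envelopeCubic_apply]
  exact congrArg _ (Prod.ext f₁ f₃)

theorem envelope_equation_of_hasDerivWithinAt (hA : ∀ ℓ, (A ℓ).IsSymm) (hE : E.transpose = -E)
    (j : ℤ) {S : Set ℝ} {t : ℝ} {w : ℝ → Wiener d n} {v' y : Wiener d n}
    {v : Wiener d n × Wiener d n} (hS : UniqueDiffWithinAt ℝ S t)
    (hw : HasDerivWithinAt w v' S t) (hy : w t = Wiener.smoothing d n y)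
    (h : v' - (amplitudeGroup hA hE ω κ ε j).gen y
      = ε • amplitudeCubic (cubicTerm d T) (Wiener.conj d n) j v v v) (x : Space d) :
    derivWithin w S t x + (I / (ε : ℂ)) • Matrix.toEuclideanLin
            (symbolL A E ((j : ℝ) * ω) ((j : ℝ) • κ)) (w t x)
        + ∑ ℓ, Matrix.toEuclideanLin (cMatrix (A ℓ)) (lineDeriv ℝ
          (w t : Space d → State n) x (EuclideanSpace.single ℓ 1))
      = (ε : ℂ) • envelopeNonlinearity T (v.1 x) (v.2 x) j := by
  rw [hw.derivWithin hS, hy]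
  exact (envelope_equation_iff hA hE j).2 h x

/-- Solutions in the moving frame on the range of the second power of the smoothing operator yield
classical solutions of the envelope system. -/
theorem isClassicalEnvelopeSolution_of_hasDerivWithinAt (hA : ∀ ℓ, (A ℓ).IsSymm)
    (hE : E.transpose = -E) (hτ : 0 < τ) {z : ℝ → Wiener d n × Wiener d n}
    (hz : ∀ t ∈ Icc 0 τ, HasDerivWithinAt z (cubicField (envelopeGroup hA hE ω κ ε).U
      (envelopeCubic (Wiener.tri 2 (trilinearCLM T)) (Wiener.conj d n)) ε t (z t)) (Icc 0 τ) t)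
    {u : ℝ → Wiener d n × Wiener d n} (hu : u = fun t => pairSmoothing d n
      ((envelopeGroup hA hE ω κ ε).U t (pairSmoothing d n (z t)))) (h0 : u 0 = (p, 0)) :
    IsClassicalEnvelopeSolution A E T ω κ p ε τ (fun t => (u t).1) (fun t => (u t).2) ∧
    ∀ w ∈ ({fun t => (u t).1, fun t => (u t).2} : Set (ℝ → Wiener d n)),
      Wiener.InCW 2 0 (Icc 0 τ) w ∧ Wiener.InCW 1 1 (Icc 0 τ) w ∧
      Wiener.InCW 0 2 (Icc 0 τ) w := by
  set G := envelopeGroup hA hE ω κ ε with hG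
  have hM := fun s => pairSmoothing_envelopeCubic (d := d) s (trilinearCLM T)
  have hS := uniqueDiffOn_Icc hτ
  have hC2 : ContDiffOn ℝ 2 u (Icc 0 τ) := by
    rw [hu]
    exact G.contDiffOn_two_J_U_J hS (hM 1) hz
  have hC1 := G.contDiffOn_one_U_J hS (hM 1) hz
  have hC0 : ContDiffOn ℝ 0 (fun t => G.U t (z t)) (Icc 0 τ) :=
    contDiffOn_zero.2 (G.continuousOn_U_apply fun t ht => (hz t ht).continuousWithinAt)
  have hu1 : ∀ t, u t = pairSmoothing d n (G.U t (pairSmoothing d n (z t))) := congrFun hu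
  have hu2 : ∀ t, u t = pairSmoothing d n (pairSmoothing d n (G.U t (z t))) := fun t => by
    rw [hu1, G.U_J]
  have hreg : ∀ w ∈ ({fun t => (u t).1, fun t => (u t).2} : Set (ℝ → Wiener d n)),
      Wiener.InCW 2 0 (Icc 0 τ) w ∧ Wiener.InCW 1 1 (Icc 0 τ) w ∧
      Wiener.InCW 0 2 (Icc 0 τ) w := by
    rintro w (rfl | rfl)
    · exact ⟨Wiener.inCW_of_eq_smoothing_pow (fun t _ => rfl) (contDiff_fst.comp_contDiffOn hC2),
        Wiener.inCW_of_eq_smoothing_pow (fun t _ => congrArg Prod.fst (hu1 t))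
          (contDiff_fst.comp_contDiffOn hC1),
        Wiener.inCW_of_eq_smoothing_pow (fun t _ => congrArg Prod.fst (hu2 t))
          (contDiff_fst.comp_contDiffOn hC0)⟩
    · exact ⟨Wiener.inCW_of_eq_smoothing_pow (fun t _ => rfl) (contDiff_snd.comp_contDiffOn hC2),
        Wiener.inCW_of_eq_smoothing_pow (fun t _ => congrArg Prod.snd (hu1 t))
          (contDiff_snd.comp_contDiffOn hC1),
        Wiener.inCW_of_eq_smoothing_pow (fun t _ => congrArg Prod.snd (hu2 t))
          (contDiff_snd.comp_contDiffOn hC0)⟩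
  refine ⟨⟨fun w hw => ?_, congrArg Prod.fst h0, congrArg Prod.snd h0, ?_⟩, hreg⟩
  · obtain ⟨h20, h11, h02⟩ := hreg w hw
    exact ⟨h20.of_le one_le_two, h11.of_le zero_le_one⟩
  · intro jw hjw t ht
    have ht' := Ioc_subset_Icc_self ht
    have hd : HasDerivWithinAt u (pairSmoothing d n (G.U t (G.velocity
        (envelopeCubic (Wiener.tri 2 (trilinearCLM T)) (Wiener.conj d n)) ε z t))) (Icc 0 τ) t := by
      rw [hu]
      exact (pairSmoothing d n).hasFDerivAt.comp_hasDerivWithinAt t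
        (G.hasDerivWithinAt_U_J (hz t ht'))
    have he := G.J_U_velocity (ε := ε) (z := z) (hM 1) (hM 0) t
    rw [← hu1, envelopeCubic_apply] at he
    rcases hjw with rfl | rfl
    · exact envelope_equation_of_hasDerivWithinAt hA hE 1 (hS t ht')
        ((ContinuousLinearMap.fst ℝ (Wiener d n) (Wiener d n)).hasFDerivAt.comp_hasDerivWithinAt t
          hd) (congrArg Prod.fst (hu1 t)) (congrArg Prod.fst he)
    · exact envelope_equation_of_hasDerivWithinAt hA hE 3 (hS t ht')
        ((ContinuousLinearMap.snd ℝ (Wiener d n) (Wiener d n)).hasFDerivAt.comp_hasDerivWithinAt t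
          hd) (congrArg Prod.snd (hu1 t)) (congrArg Prod.snd he)

/-- Uniqueness is applied in `W` itself, without lifting to a range of `J`: a competing solution
need not have values in `W²`. -/
theorem classical_envelope_solution_unique (hA : ∀ ℓ, (A ℓ).IsSymm) (hE : E.transpose = -E)
    (hε : 0 < ε) {u₁ u₃ v₁ v₃ : ℝ → Wiener d n}
    (hu : IsClassicalEnvelopeSolution A E T ω κ p ε τ u₁ u₃)
    (hv : IsClassicalEnvelopeSolution A E T ω κ p ε τ v₁ v₃) :
    EqOn v₁ u₁ (Icc 0 τ) ∧ EqOn v₃ u₃ (Icc 0 τ) := by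
  obtain ⟨hcu, hu'⟩ := hu.hasDerivWithinAt hA hE
  obtain ⟨hcv, hv'⟩ := hv.hasDerivWithinAt hA hE
  have h := cubic_solution_unique (fun t y => ((envelopeGroup hA hE ω κ ε).norm_U t y).le)
    (envelopeGroup hA hE ω κ ε).continuous_U (envelopeTerm d T) hε hcv hcu hv' hu'
    (by simp only [hu.initial₁, hu.initial₃, hv.initial₁, hv.initial₃])
  have h' : ∀ t ∈ Icc 0 τ, (v₁ t, v₃ t) = (u₁ t, u₃ t) := fun t ht => by
    have e := congrArg ((envelopeGroup hA hE ω κ ε).U t) (h ht)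
    simpa only [RegularGroup.U_U_neg] using e
  exact ⟨fun t ht => congrArg Prod.fst (h' t ht), fun t ht => congrArg Prod.snd (h' t ht)⟩

end EnvelopeSolutions

/-! ### Uniform existence time and error constant. -/

section ErrorBound

set_option maxSynthPendingDepth 3

open Set Filter Topology

theorem exists_pos_mul_le_one {a b : ℝ} (ha : 0 ≤ a) (hb : 0 ≤ b) :
    ∃ τ : ℝ, 0 < τ ∧ τ * a ≤ 1 ∧ τ * b ≤ 1 := by
  refine ⟨(a + b + 1)⁻¹, by positivity, ?_, ?_⟩
  · rw [inv_mul_le_iff₀ (by positivity)]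
    linarith
  · rw [inv_mul_le_iff₀ (by positivity)]
    linarith

/-- The envelope system and the original problem have solutions on time intervals of length
`τ / ε`, and the superposition of the amplitudes approximates the solution of the original problem
up to an error of order `ε ^ 2`. -/
theorem EnvelopeSetting.exists_approximation {X : Type*} [NormedAddCommGroup X] [NormedSpace ℂ X]
    [CompleteSpace X] (σ : EnvelopeSetting X) {y₀ : X} (hL : σ.L 1 (σ.J y₀) = 0) (r : ℝ)
    (hr : 0 ≤ r) : ∃ τ : ℝ, 0 < τ ∧ ∃ K : ℝ, ∀ ε : ℝ, 0 < ε → ε ≤ 1 → ∀ F : σ.Frame ε,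
      ‖F.e 1 0 (σ.J (σ.J y₀)) + σ.C (F.e 1 0 (σ.J (σ.J y₀)))‖ ≤ r → ∃ z w,
        z 0 = (y₀, 0) ∧ w 0 = F.e 1 0 (σ.J (σ.J y₀)) + σ.C (F.e 1 0 (σ.J (σ.J y₀))) ∧
        ∀ t ∈ Icc 0 (τ / ε),
          HasDerivWithinAt z (cubicField F.G.U (σ.M 2) ε t (z t)) (Icc 0 (τ / ε)) t ∧
          HasDerivWithinAt w (cubicField (F.g 0).U (σ.T 0) ε t (w t)) (Icc 0 (τ / ε)) t ∧
          ‖(F.g 0).U t (w t) - F.superposition t (F.G.U t (σ.JJ (σ.JJ (z t))))‖ ≤ K * ε ^ 2 := by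
  obtain ⟨τ, hτ, hτM, hτT⟩ := exists_pos_mul_le_one
    (a := ‖σ.M 2‖ * (‖y₀‖ + 1) ^ 3) (b := ‖σ.T 0‖ * (r + 1) ^ 3)
    (by positivity) (by positivity)
  obtain ⟨K, hK⟩ : ∃ K : ℝ, ∀ ε : ℝ, 0 < ε → ε ≤ 1 → ∀ (F : σ.Frame ε) (z : ℝ → X × X)
      (w : ℝ → X), F.IsSolution τ (‖y₀‖ + 1) z → z 0 = (y₀, 0) →
      (∀ t ∈ Icc 0 (τ / ε), ‖w t‖ ≤ r + 1 ∧
        HasDerivWithinAt w (cubicField (F.g 0).U (σ.T 0) ε t (w t)) (Icc 0 (τ / ε)) t) →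
      w 0 = F.e 1 0 (σ.J (σ.J y₀)) + σ.C (F.e 1 0 (σ.J (σ.J y₀))) →
      ∀ t ∈ Icc 0 (τ / ε),
        ‖(F.g 0).U t (w t) - F.superposition t (F.G.U t (σ.JJ (σ.JJ (z t))))‖ ≤ K * ε ^ 2 := by
    have h1 : ∀ z : ℝ → X × X, z 0 = (y₀, 0) → σ.L 1 (σ.J (z 0).1) = 0 := fun z hz0 => by
      rw [hz0]
      exact hL
    -- The constant is chosen before `ε` and the frame and is determined by unification, so the
    -- bounds used cannot depend on them.
    exact ⟨_, fun ε hε hε1 F z w hz hz0 hw hw0 => Frame.norm_error_le hε hτ hz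
      (congrArg Prod.snd hz0) (Frame.norm_vel_le hε hε1 hτ hz (h1 z hz0) (congrArg Prod.snd hz0))
      (Frame.norm_third_le hε hε1 hτ hz (congrArg Prod.snd hz0)
        (Frame.norm_vel_le hε hε1 hτ hz (h1 z hz0) (congrArg Prod.snd hz0))) hw
      (by rw [hw0, hz0])⟩
  refine ⟨τ, hτ, K, fun ε hε hε1 F hr => ?_⟩
  obtain ⟨z, hz0, hz⟩ := exists_cubic_solution (V := F.G.U) (fun t y => (F.G.norm_U t y).le)
    F.G.continuous_U (σ.M 2) hε hτ (y₀, 0) (r := ‖y₀‖) (by simp) hτM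
  obtain ⟨w, hw0, hw⟩ := exists_cubic_solution (V := (F.g 0).U)
    (fun t y => ((F.g 0).norm_U t y).le) (F.g 0).continuous_U (σ.T 0) hε hτ _ hr hτT
  exact ⟨z, w, hz0, hw0, fun t ht => ⟨(hz t ht).2, (hw t ht).2,
    hK ε hε hε1 F z w hz hz0 hw hw0 t ht⟩⟩

end ErrorBound

/-! ### Translation to the approximation and proof of the theorem. -/

section Approximation

set_option maxSynthPendingDepth 3

open Set Filter Topology

variable {d n : ℕ} {A : Fin d → Matrix (Fin n) (Fin n) ℝ} {E : Matrix (Fin n) (Fin n) ℝ}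
  {T : (Fin n → ℝ) →ₗ[ℝ] (Fin n → ℝ) →ₗ[ℝ] (Fin n → ℝ) →ₗ[ℝ] (Fin n → ℝ)} {ω : ℝ} {κ : Space d}
  {S P : State n →L[ℂ] State n →L[ℂ] State n →L[ℂ] State n}

theorem superposition_apply (hA : ∀ ℓ, (A ℓ).IsSymm) (hE : E.transpose = -E)
    (hS : ∀ a b c, opMatrix (symbolL A E (3 * ω) ((3 : ℝ) • κ)) (S a b c) = trilinearCLM T a b c)
    (hP : ∀ a b c, opMatrix (symbolL A E (5 * ω) ((5 : ℝ) • κ)) (P a b c)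
      - P a b (opMatrix (symbolL A E (3 * ω) ((3 : ℝ) • κ)) c)
      = trilinearCLM T a b c + trilinearCLM T a c b + trilinearCLM T c a b) (ε t : ℝ)
    (u : ℝ → Wiener d n × Wiener d n) (x : Space d) :
    (wienerFrame hA hE hS hP ε).superposition t (u t) x
      = approximation ω κ ε (fun t => (u t).1) (fun t => (u t).2) t x := by
  rw [EnvelopeSetting.Frame.superposition, approximation]
  refine (map_sum (Wiener.eval x) (fun j => (wienerFrame hA hE hS hP ε).e j t
    (amplitude (wienerSetting A E T ω κ S P hS hP).C j (u t))) modes).trans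
    (Finset.sum_congr rfl fun j _ => ?_)
  rw [← amplitude_conj_apply]
  exact carrier_apply ω κ ε j t _ x

/-- Polarization is assumed for `p = J² y₀`, while the initial velocity requires it for `J y₀`.
Constant matrices commute with `J`, and `J` is injective. -/
theorem const_smoothing_eq_zero {L : Matrix (Fin n) (Fin n) ℂ} {y : Wiener d n}
    (h : ∀ x, Wiener.smoothing d n (Wiener.smoothing d n y) x
      ∈ LinearMap.ker (Matrix.toEuclideanLin L)) :
    Wiener.const (opMatrix L) (Wiener.smoothing d n y) = 0 := by
  apply Wiener.smoothing_injective
  rw [Wiener.smoothing_const, map_zero]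
  refine Wiener.ext_apply fun x => ?_
  rw [Wiener.const_apply]
  exact h x

end Approximation
end

theorem mainTheorem1 {d n : ℕ}
    (A : Fin d → Matrix (Fin n) (Fin n) ℝ) (hA : ∀ ℓ, (A ℓ).IsSymm)
    (E : Matrix (Fin n) (Fin n) ℝ) (hE : E.transpose = -E)
    (T : (Fin n → ℝ) →ₗ[ℝ] (Fin n → ℝ) →ₗ[ℝ] (Fin n → ℝ) →ₗ[ℝ] (Fin n → ℝ))
    (κ : Space d) (hκ : κ ≠ 0) (ω : ℝ)
    (p : Wiener d n) (hp : Wiener.MemW 2 p)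
    (hker : Module.finrank ℂ (LinearMap.ker (Matrix.toEuclideanLin (symbolL A E ω κ))) = 1)
    (hpol : ∀ x, p x ∈ LinearMap.ker (Matrix.toEuclideanLin (symbolL A E ω κ)))
    (hinv₃ : IsUnit (symbolL A E (3 * ω) ((3 : ℝ) • κ)))
    (hinv₅ : IsUnit (symbolL A E (5 * ω) ((5 : ℝ) • κ)))
    (heig : HasSmoothEigendecomposition A E)
    (hres : Disjoint (spectrum ℂ (symbolL A E (3 * ω) ((3 : ℝ) • κ)))
      (spectrum ℂ (symbolL A E (5 * ω) ((5 : ℝ) • κ)))) :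
    ∃ tstar : ℝ, 0 < tstar ∧ ∃ C : ℝ, ∀ ε : ℝ, 0 < ε → ε ≤ 1 →
      ∃ u u₁ u₃ : ℝ → Wiener d n,
        -- `u` is the unique mild solution of the original problem, and it is real-valued
        IsMildSolution A E T κ p ε (tstar / ε) u ∧
        (∀ t ∈ Set.Icc 0 (tstar / ε), ∀ x i, (u t x i).im = 0) ∧
        (∀ v, IsMildSolution A E T κ p ε (tstar / ε) v →
          Set.EqOn v u (Set.Icc 0 (tstar / ε))) ∧
        -- `(u₁, u₃)` is the unique classical solution of the envelope system
        IsClassicalEnvelopeSolution A E T ω κ p ε (tstar / ε) u₁ u₃ ∧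
        (∀ w ∈ ({u₁, u₃} : Set (ℝ → Wiener d n)),
          Wiener.InCW 2 0 (Set.Icc 0 (tstar / ε)) w ∧
          Wiener.InCW 1 1 (Set.Icc 0 (tstar / ε)) w ∧
          Wiener.InCW 0 2 (Set.Icc 0 (tstar / ε)) w) ∧
        (∀ v₁ v₃, IsClassicalEnvelopeSolution A E T ω κ p ε (tstar / ε) v₁ v₃ →
          Set.EqOn v₁ u₁ (Set.Icc 0 (tstar / ε)) ∧ Set.EqOn v₃ u₃ (Set.Icc 0 (tstar / ε))) ∧
        -- the error bounds in `W` and in `L^∞`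
        ∀ t ∈ Set.Icc 0 (tstar / ε),
          (∃ δ : Wiener d n, (∀ x, δ x = u t x - approximation ω κ ε u₁ u₃ t x) ∧
            ‖δ‖ ≤ C * ε ^ 2) ∧
          eLpNorm (fun x => u t x - approximation ω κ ε u₁ u₃ t x) ⊤ volume
            ≤ ENNReal.ofReal (C * ε ^ 2) := by
  obtain ⟨S, hS⟩ := exists_cubic_of_isUnit hinv₃ (trilinearCLM T)
  obtain ⟨P, hP⟩ := exists_cubic_of_disjoint_spectrum hres (trilinearCLM T)
  obtain ⟨y₀, rfl⟩ := Wiener.exists_smoothing_of_memW_two hp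
  set p := Wiener.smoothing d n (Wiener.smoothing d n y₀) with hpdef
  let σ := wienerSetting A E T ω κ S P hS hP
  have hL : σ.L 1 (σ.J y₀) = 0 := const_smoothing_eq_zero fun x => by simpa using hpol x
  -- The initial wave is `p` times a phase plus its conjugate, hence bounded by `2 ‖p‖` for every
  -- `ε`.
  obtain ⟨τ, hτ, K, h⟩ := σ.exists_approximation hL (2 * ‖p‖) (by positivity)
  refine ⟨τ, hτ, K, fun ε hε hε1 => ?_⟩
  let F := wienerFrame hA hE hS hP ε
  have hτε : 0 < τ / ε := div_pos hτ hε
  have hg0 : F.g 0 = waveGroup hA hE ε := by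
    change (waveSymbol hA hE ε (((0 : ℤ) : ℝ) * ω) (((0 : ℤ) : ℝ) • κ)).group = _
    simp
  obtain ⟨z, w, hz0, hw0, hzw⟩ := h ε hε hε1 F (norm_initialWave_le ω κ ε p)
  have hu : IsMildSolution A E T κ p ε (τ / ε) (fun t => (waveGroup hA hE ε).U t (w t)) := by
    refine (isMildSolution_iff hA hE ω).2 ⟨?_, fun t ht => ?_⟩
    · rw [(waveGroup hA hE ε).U_zero, hw0]
      rfl
    · simp only [(waveGroup hA hE ε).U_neg_U]
      rw [← hg0]
      exact (hzw t ht).2.1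
  let v : ℝ → Wiener d n × Wiener d n := fun t => pairSmoothing d n
    (F.G.U t (pairSmoothing d n (z t)))
  have hv0 : v 0 = (p, 0) := by
    change pairSmoothing d n (F.G.U 0 (pairSmoothing d n (z 0))) = (p, 0)
    rw [F.G.U_zero, hz0]
    exact Prod.ext rfl (by simp)
  obtain ⟨hv, hreg⟩ := isClassicalEnvelopeSolution_of_hasDerivWithinAt hA hE hτε
    (fun t ht => (hzw t ht).1) (u := v) rfl hv0
  refine ⟨_, _, _, hu, mild_solution_real hA hE hε hu,
    fun v' hv' => mild_solution_unique hA hE hε hu hv', hv, hreg,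
    fun v₁ v₃ h => classical_envelope_solution_unique hA hE hε hv h, fun t ht => ?_⟩
  -- The moving-frame estimate controls an element of `W`; its values are the pointwise error, so
  -- this element serves as `δ` and yields both norms.
  have hδ : ∀ x, ((F.g 0).U t (w t) - F.superposition t (F.G.U t (σ.JJ (σ.JJ (z t))))) x
      = (waveGroup hA hE ε).U t (w t) x
        - approximation ω κ ε (fun t => (v t).1) (fun t => (v t).2) t x := by
    intro x
    have hvt : F.G.U t (σ.JJ (σ.JJ (z t))) = v t := F.G.U_J t _
    rw [hvt, ← superposition_apply hA hE hS hP ε t v x, hg0]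
    rfl
  have hb := (hzw t ht).2.2
  refine ⟨⟨_, hδ, hb⟩, ?_⟩
  rw [eLpNorm_exponent_top]
  refine eLpNormEssSup_le_of_ae_bound (Filter.Eventually.of_forall fun x => ?_)
  rw [← hδ]
  exact (Wiener.norm_apply_le _ x).trans hb
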